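/- Let $d\ge 2$ and $p>0$, with $p<\frac{4}{d-2}$ if $d\ge 3$. For $r\ge 0$ put $$V_d(r)=\frac{(d-1)(d-3)}{4}\,\frac{r^2-\sinh^2 r}{r^2\sinh^2 r},\qquad K(r)=\frac1{p+2}\Big(\frac{r}{\sinh r}\Big)^{\frac{(d-1)p}{2}},\qquad F(x,u)=K(|x|)\,|u|^{p+2}$$ (extended continuously to $r=0$). Let $\Lambda>-\big(\frac{d-1}{2}\big)^2$, $\mu_d=\Lambda+\big(\frac{d-1}{2}\big)^2>0$ and $\lambda>0$. For real-valued or complex-valued $u\in H^1(\mathbb R^d)$ put $$\mathcal E_1(u)=\int_{\mathbb R^d}\Big[\tfrac12|\nabla u|^2+\tfrac12 V_d(|x|)|u|^2-F(x,u)\Big]dx,\qquad \mathcal E_2(u)=\int_{\mathbb R^d}\Big[\tfrac12|\nabla u|^2+\tfrac12\big(\mu_d+V_d(|x|)\big)|u|^2\Big]dx,$$ and consider the constrained minimization problems $$I_\lambda=\inf\{\mathcal E_1(u): u\in H^1(\mathbb R^d),\ \|u\|_{L^2}^2=\lambda\},\qquad J_\lambda=\inf\Big\{\mathcal E_2(u):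 u\in H^1(\mathbb R^d),\ \int_{\mathbb R^d} F(x,u)\,dx=\lambda\Big\}.$$ Lemma (soliton regularity and exponential decay). If $u$ is a spherically symmetric minimizer of $I_\lambda$ or of $J_\lambda$, then, after modification on a null set, $u\in C^2(\mathbb R^d)$, and there are constants $C,\delta>0$ such that $$|D^\alpha u(x)|\le C e^{-\delta|x|}\qquad\text{for all }x\in\mathbb R^d\text{ and all }|\alpha|\le 2 .$$ -/

import Mathlib

open MeasureTheory
open scoped ContDiff

noncomputable section

namespace HypSoliton

/-- Euclidean space `ℝ^d`. -/
abbrev Space (d : ℕ) : Type := EuclideanSpace ℝ (Fin d)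

/-- `G` is the weak gradient of `u` on `ℝ^d`: for every real test function `φ` and every `i`,
`∫ (∂ᵢ φ) u = - ∫ φ Gᵢ`. -/
def IsWeakGradient {𝕜 : Type*} [RCLike 𝕜] {d : ℕ}
    (u : Space d → 𝕜) (G : Fin d → Space d → 𝕜) : Prop :=
  ∀ φ : Space d → ℝ, ContDiff ℝ ∞ φ → HasCompactSupport φ → ∀ i : Fin d,
    ∫ x, (fderiv ℝ φ x (EuclideanSpace.single i (1 : ℝ))) • u x = - ∫ x, φ x • G i x

/-- `u ∈ H¹(ℝ^d)` with weak gradient `G` (which is unique up to null sets): `u` and the components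
of `G` are square integrable, and `G` is the weak gradient of `u`. -/
structure MemH1WithGradient {𝕜 : Type*} [RCLike 𝕜] {d : ℕ}
    (u : Space d → 𝕜) (G : Fin d → Space d → 𝕜) : Prop where
  memLp : MemLp u 2 volume
  memLp_gradient : ∀ i, MemLp (G i) 2 volume
  isWeakGradient : IsWeakGradient u G

/-- `V_d(r) = ((d-1)(d-3)/4) (r² - sinh² r) / (r² sinh² r)`, extended continuously to `r = 0`. -/
def potential (d : ℕ) (r : ℝ) : ℝ :=
  ((d : ℝ) - 1) * ((d : ℝ) - 3) / 4 *
    (if r = 0 then -(1 / 3) else (r ^ 2 - Real.sinh r ^ 2) / (r ^ 2 * Real.sinh r ^ 2))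

/-- `K(r) = (1/(p+2)) (r / sinh r)^((d-1)p/2)`, extended continuously to `r = 0`. -/
def weight (d : ℕ) (p : ℝ) (r : ℝ) : ℝ :=
  1 / (p + 2) * (if r = 0 then 1 else r / Real.sinh r) ^ (((d : ℝ) - 1) * p / 2)

/-- `∫ F(x,u) dx`, where `F(x,u) = K(|x|) |u|^(p+2)`. -/
def nonlinearTerm {𝕜 : Type*} [RCLike 𝕜] (d : ℕ) (p : ℝ) (u : Space d → 𝕜) : ℝ :=
  ∫ x, weight d p ‖x‖ * ‖u x‖ ^ (p + 2)

/-- `∫ (½ |∇u|² + ½ c(|x|) |u|²) dx`, where `G = ∇u`. -/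
def quadraticTerm {𝕜 : Type*} [RCLike 𝕜] (d : ℕ) (c : ℝ → ℝ)
    (u : Space d → 𝕜) (G : Fin d → Space d → 𝕜) : ℝ :=
  ∫ x, (1 / 2 * ∑ i, ‖G i x‖ ^ 2 + 1 / 2 * c ‖x‖ * ‖u x‖ ^ 2)

/-- `𝓔₁(u) = ∫ (½ |∇u|² + ½ V_d |u|² - F(x,u)) dx`, where `G = ∇u`. -/
def energy₁ {𝕜 : Type*} [RCLike 𝕜] (d : ℕ) (p : ℝ)
    (u : Space d → 𝕜) (G : Fin d → Space d → 𝕜) : ℝ :=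
  quadraticTerm d (potential d) u G - nonlinearTerm d p u

/-- `𝓔₂(u) = ∫ (½ |∇u|² + ½ (μ + V_d) |u|²) dx`, where `G = ∇u` and `μ = Λ + ((d-1)/2)²`. -/
def energy₂ {𝕜 : Type*} [RCLike 𝕜] (d : ℕ) (Λ : ℝ)
    (u : Space d → 𝕜) (G : Fin d → Space d → 𝕜) : ℝ :=
  quadraticTerm d (fun r => Λ + (((d : ℝ) - 1) / 2) ^ 2 + potential d r) u G

/-- `u` is a minimizer for `I_lam = inf {𝓔₁(v) : v ∈ H¹(ℝ^d), ‖v‖²_{L²} = lam}`. -/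
def IsMinimizerI {𝕜 : Type*} [RCLike 𝕜] (d : ℕ) (p lam : ℝ) (u : Space d → 𝕜) : Prop :=
  ∃ G : Fin d → Space d → 𝕜, MemH1WithGradient u G ∧ (∫ x, ‖u x‖ ^ 2) = lam ∧
    ∀ (v : Space d → 𝕜) (H : Fin d → Space d → 𝕜), MemH1WithGradient v H →
      (∫ x, ‖v x‖ ^ 2) = lam → energy₁ d p u G ≤ energy₁ d p v H

/-- `u` is a minimizer for `J_lam = inf {𝓔₂(v) : v ∈ H¹(ℝ^d), ∫ F(x,v) dx = lam}`, where `𝓔₂` is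
formed with the soliton parameter `Λ`. -/
def IsMinimizerJ {𝕜 : Type*} [RCLike 𝕜] (d : ℕ) (p Λ lam : ℝ) (u : Space d → 𝕜) : Prop :=
  ∃ G : Fin d → Space d → 𝕜, MemH1WithGradient u G ∧ nonlinearTerm d p u = lam ∧
    ∀ (v : Space d → 𝕜) (H : Fin d → Space d → 𝕜), MemH1WithGradient v H →
      nonlinearTerm d p v = lam → energy₂ d Λ u G ≤ energy₂ d Λ v H

/-- `u` (as a function defined up to null sets) depends on `|x|` only. -/
def IsSphericallySymmetric {𝕜 : Type*} [RCLike 𝕜] {d : ℕ} (u : Space d → 𝕜) : Prop :=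
  ∃ f : ℝ → 𝕜, ∀ᵐ x ∂(volume : Measure (Space d)), u x = f ‖x‖

end HypSoliton

end

/-!
A minimizer is a weak solution of `-Δu + (w + V_d) u = a K |u|^p u`, and `w > 0`: for `J` because
`w = μ_d`, for `I` by testing the equation with `u` and using `I_λ ≤ 0`, which comes from spreading
out a test function. Writing `u = f(|x|)`, this is the weak form on `(0, ∞)` of
`(r^(d-1) f')' = r^(d-1) g`, where `g = (w + V_d - a K |f|^p) f`.

Near the origin `|f| ≤ C r^(-β)` for some `β` slightly above `(d-2)/2`; by subcriticality,
integrating the equation twice improves the exponent until `f` is bounded. Then `f'/r` has a limit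
at `0`, which makes `f(|x|)` twice continuously differentiable there.

At infinity `f → 0`, so the coefficient of `f` tends to `w > 0` and `y = |f|²` satisfies
`y'' + ((d-1)/r) y' ≥ κ² y`. Comparison with `e^(-κr)` gives the decay of `f`; that of `f'` and
`f''` follows from the equation.
-/

open scoped ContDiff

noncomputable section

namespace HypSoliton

open Set Filter Topology

section WeakDerivative

/-- The test functions of the distribution theory of the open set `U ⊆ ℝ`: smooth functions whose
support is a compact subset of `U`. -/
structure IsTestFunctionOn (U : Set ℝ) (ψ : ℝ → ℝ) : Prop where
  contDiff : ContDiff ℝ ∞ ψ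
  hasCompactSupport : HasCompactSupport ψ
  tsupport_subset : tsupport ψ ⊆ U

variable {U : Set ℝ} {φ ψ : ℝ → ℝ} {x₀ : ℝ}

theorem isTestFunctionOn_of_support_subset (hψ : ContDiff ℝ ∞ ψ) {K : Set ℝ} (hK : IsCompact K)
    (hKU : K ⊆ U) (h : Function.support ψ ⊆ K) : IsTestFunctionOn U ψ where
  contDiff := hψ
  hasCompactSupport := HasCompactSupport.of_support_subset_isCompact hK h
  tsupport_subset := (closure_minimal h hK.isClosed).trans hKU

namespace IsTestFunctionOn

theorem deriv (hψ : IsTestFunctionOn U ψ) : IsTestFunctionOn U (deriv ψ) where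
  contDiff := (contDiff_infty_iff_deriv.1 hψ.contDiff).2
  hasCompactSupport := hψ.hasCompactSupport.deriv
  tsupport_subset := tsupport_deriv_subset.trans hψ.tsupport_subset

theorem sub_const_mul (hφ : IsTestFunctionOn U φ) (hψ : IsTestFunctionOn U ψ) (s : ℝ) :
    IsTestFunctionOn U (fun x => φ x - s * ψ x) := by
  refine isTestFunctionOn_of_support_subset (hφ.contDiff.sub (contDiff_const.mul hψ.contDiff))
    (hφ.hasCompactSupport.isCompact.union hψ.hasCompactSupport.isCompact)
    (union_subset hφ.tsupport_subset hψ.tsupport_subset) fun x hx => ?_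
  by_contra h
  rw [mem_union, not_or] at h
  exact hx (by simp [image_eq_zero_of_notMem_tsupport h.1, image_eq_zero_of_notMem_tsupport h.2])

theorem exists_tsupport_subset_Ioo (hψ : IsTestFunctionOn U ψ) (hU : IsOpen U) (hx₀ : x₀ ∈ U) :
    ∃ a ∈ U, ∃ b ∈ U, x₀ ∈ Ioo a b ∧ tsupport ψ ⊆ Ioo a b := by
  have hK : IsCompact (insert x₀ (tsupport ψ)) := hψ.hasCompactSupport.isCompact.insert x₀
  have hKU : insert x₀ (tsupport ψ) ⊆ U := insert_subset hx₀ hψ.tsupport_subset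
  obtain ⟨a', ha', hle⟩ := hK.exists_isLeast (insert_nonempty _ _)
  obtain ⟨b', hb', hge⟩ := hK.exists_isGreatest (insert_nonempty _ _)
  obtain ⟨a, haU, haa'⟩ :=
    (eventually_mem_set.2 <| mem_nhdsWithin_of_mem_nhds (hU.mem_nhds (hKU ha'))).and
      (self_mem_nhdsWithin (s := Iio a')) |>.exists
  obtain ⟨b, hbU, hbb'⟩ :=
    (eventually_mem_set.2 <| mem_nhdsWithin_of_mem_nhds (hU.mem_nhds (hKU hb'))).and
      (self_mem_nhdsWithin (s := Ioi b')) |>.exists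
  have hK_sub : insert x₀ (tsupport ψ) ⊆ Ioo a b :=
    fun x hx => ⟨haa'.trans_le (hle hx), (hge hx).trans_lt hbb'⟩
  exact ⟨a, haU, b, hbU, hK_sub (mem_insert _ _), (subset_insert _ _).trans hK_sub⟩

theorem integrable (hψ : IsTestFunctionOn U ψ) : Integrable ψ :=
  hψ.contDiff.continuous.integrable_of_hasCompactSupport hψ.hasCompactSupport

variable {E : Type*} [NormedAddCommGroup E] [NormedSpace ℝ E]

theorem integrable_smul (hψ : IsTestFunctionOn U ψ) {g : ℝ → E} (hg : LocallyIntegrableOn g U) :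
    Integrable (fun x => ψ x • g x) := by
  refine (integrableOn_iff_integrable_of_support_subset (s := tsupport ψ) ?_).1
    ((hg.integrableOn_compact_subset hψ.tsupport_subset
      hψ.hasCompactSupport.isCompact).continuousOn_smul hψ.contDiff.continuous.continuousOn
        hψ.hasCompactSupport.isCompact)
  exact (Function.support_smul_subset_left ψ g).trans (subset_tsupport ψ)

theorem exists_deriv_eq (hφ : IsTestFunctionOn U φ) (hU : IsOpen U) [U.OrdConnected]
    (h0 : ∫ x, φ x = 0) : ∃ ψ, IsTestFunctionOn U ψ ∧ _root_.deriv ψ = φ := by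
  rcases U.eq_empty_or_nonempty with rfl | ⟨x₀, hx₀⟩
  · refine ⟨φ, hφ, ?_⟩
    rw [tsupport_eq_empty_iff.1 (subset_empty_iff.1 hφ.tsupport_subset)]
    exact deriv_const' 0
  obtain ⟨a, ha, b, hb, -, hab⟩ := hφ.exists_tsupport_subset_Ioo hU hx₀
  have hc : Continuous φ := hφ.contDiff.continuous
  have hderiv : ∀ x, HasDerivAt (fun x => ∫ t in a..x, φ t) (φ x) x := fun x =>
    intervalIntegral.integral_hasDerivAt_right (hc.intervalIntegrable _ _)
      (hc.stronglyMeasurableAtFilter _ _) hc.continuousAt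
  have hd : _root_.deriv (fun x => ∫ t in a..x, φ t) = φ := funext fun x => (hderiv x).deriv
  have hφ0 : ∀ t, t ∉ Ioo a b → φ t = 0 := fun t ht =>
    image_eq_zero_of_notMem_tsupport fun h => ht (hab h)
  refine ⟨fun x => ∫ t in a..x, φ t, isTestFunctionOn_of_support_subset
    (contDiff_infty_iff_deriv.2 ⟨fun x => (hderiv x).differentiableAt, by
      rw [hd]; exact hφ.contDiff⟩) isCompact_Icc (Set.Icc_subset U ha hb) fun x hx => ?_, hd⟩
  by_contra hx'
  refine hx (show ∫ t in a..x, φ t = 0 from ?_)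
  rcases le_or_gt x a with hxa | hxa
  · refine intervalIntegral.integral_zero_ae (Eventually.of_forall fun t ht => hφ0 t fun h => ?_)
    rw [uIoc_of_ge hxa] at ht
    exact h.1.not_ge ht.2
  · have hbx : b < x := not_le.1 fun h => hx' ⟨hxa.le, h⟩
    rw [intervalIntegral.integral_of_le hxa.le, setIntegral_eq_integral_of_forall_compl_eq_zero, h0]
    exact fun t ht => hφ0 t fun h => ht ⟨h.1, (h.2.trans hbx).le⟩

end IsTestFunctionOn

theorem exists_isTestFunctionOn_integral_eq_one (hU : IsOpen U) (hx₀ : x₀ ∈ U) :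
    ∃ ρ, IsTestFunctionOn U ρ ∧ ∫ x, ρ x = 1 := by
  obtain ⟨ε, hε, hεU⟩ := Metric.isOpen_iff.1 hU x₀ hx₀
  let B : ContDiffBump x₀ := ⟨ε / 4, ε / 2, by positivity, by linarith⟩
  refine ⟨B.normed volume, ⟨B.contDiff_normed, B.hasCompactSupport_normed, ?_⟩, B.integral_normed⟩
  rw [B.tsupport_normed_eq]
  exact (Metric.closedBall_subset_ball (half_lt_self hε)).trans hεU

variable {E : Type*} [NormedAddCommGroup E]

theorem intervalIntegrable_of_locallyIntegrableOn [U.OrdConnected] {h : ℝ → E}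
    (hh : LocallyIntegrableOn h U) {a b : ℝ} (ha : a ∈ U) (hb : b ∈ U) :
    IntervalIntegrable h volume a b :=
  (intervalIntegrable_iff').2 <|
    hh.integrableOn_compact_subset (OrdConnected.uIcc_subset ‹_› ha hb) isCompact_uIcc

variable [NormedSpace ℝ E]

theorem continuousOn_primitive_of_locallyIntegrableOn (hU : IsOpen U) [U.OrdConnected]
    {h : ℝ → E} (hh : LocallyIntegrableOn h U) (hx₀ : x₀ ∈ U) :
    ContinuousOn (fun r => ∫ t in x₀..r, h t) U := by
  intro r hr
  obtain ⟨ε, hε, hεU⟩ := Metric.nhds_basis_closedBall.mem_iff.1 (hU.mem_nhds hr)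
  rw [Real.closedBall_eq_Icc] at hεU
  have hlU : r - ε ∈ U := hεU ⟨le_rfl, by linarith⟩
  have hrU : r + ε ∈ U := hεU ⟨by linarith, le_rfl⟩
  have hint := intervalIntegrable_of_locallyIntegrableOn hh
    (a := min x₀ (r - ε)) (b := max x₀ (r + ε))
    (by rcases min_choice x₀ (r - ε) with h | h <;> rwa [h])
    (by rcases max_choice x₀ (r + ε) with h | h <;> rwa [h])
  have hle : min x₀ (r - ε) ≤ max x₀ (r + ε) := (min_le_left _ _).trans (le_max_left _ _)
  have hcont := intervalIntegral.continuousOn_primitive_interval' hint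
    (a := x₀) (by rw [uIcc_of_le hle]; exact ⟨min_le_left _ _, le_max_left _ _⟩)
  refine (hcont.continuousAt ?_).continuousWithinAt
  rw [uIcc_of_le hle]
  exact Icc_mem_nhds ((min_le_right _ _).trans_lt (by linarith))
    ((lt_add_of_pos_right r hε).trans_le (le_max_right _ _))

variable [CompleteSpace E]

/-- Both sides are the integral of `ψ' x • h y` over the triangle `a < y ≤ x ≤ b`. -/
theorem setIntegral_deriv_smul_primitive {a b : ℝ} {ψ' : ℝ → ℝ}
    (hψ : ∀ x ∈ Icc a b, HasDerivAt ψ (ψ' x) x) (hψ' : IntegrableOn ψ' (Icc a b))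
    (hb : ψ b = 0) {h : ℝ → E} (hh : IntegrableOn h (Ioc a b)) :
    ∫ x in Ioc a b, ψ' x • ∫ y in a..x, h y = - ∫ x in Ioc a b, ψ x • h x := by
  let k : ℝ → ℝ → E := fun x y => {q : ℝ × ℝ | q.2 ≤ q.1}.indicator
    (fun q => ψ' q.1 • h q.2) (x, y)
  have hk : Integrable (Function.uncurry k)
      ((volume.restrict (Ioc a b)).prod (volume.restrict (Ioc a b))) :=
    (Integrable.smul_prod (hψ'.mono_set Ioc_subset_Icc_self) hh).indicator
      (measurableSet_le measurable_snd measurable_fst)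
  have h_inner_y : ∫ x in Ioc a b, ∫ y in Ioc a b, k x y
      = ∫ x in Ioc a b, ψ' x • ∫ y in a..x, h y := by
    refine setIntegral_congr_fun measurableSet_Ioc fun x hx => ?_
    have hkx : (fun y => k x y) = (Iic x).indicator (fun y => ψ' x • h y) := by
      ext y; simp [k, indicator]
    simp only [hkx]
    rw [setIntegral_indicator measurableSet_Iic, Ioc_inter_Iic, min_eq_right hx.2,
      integral_smul, intervalIntegral.integral_of_le hx.1.le]
  have h_inner_x : ∫ y in Ioc a b, ∫ x in Ioc a b, k x y = ∫ y in Ioc a b, - ψ y • h y := by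
    refine setIntegral_congr_fun measurableSet_Ioc fun y hy => ?_
    have hky : (fun x => k x y) = (Ici y).indicator (fun x => ψ' x • h y) := by
      ext x; simp [k, indicator]
    have hyb : Icc y b ⊆ Icc a b := Icc_subset_Icc_left hy.1.le
    simp only [hky]
    rw [setIntegral_indicator measurableSet_Ici, inter_comm,
      show Ici y ∩ Ioc a b = Icc y b by ext x; simp; grind, integral_smul_const,
      integral_Icc_eq_integral_Ioc, ← intervalIntegral.integral_of_le hy.2,
      intervalIntegral.integral_eq_sub_of_hasDerivAt (f := ψ), hb, zero_sub]
    · exact fun x hx => hψ x (hyb (by rwa [uIcc_of_le hy.2] at hx))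
    · exact (intervalIntegrable_iff_integrableOn_Icc_of_le hy.2).2 (hψ'.mono_set hyb)
  rw [← h_inner_y, integral_integral_swap hk, h_inner_x]
  simp only [neg_smul, integral_neg]

/-- `h` is a weak derivative of `f` on the open set `U ⊆ ℝ`. -/
def HasWeakDerivOn (f h : ℝ → E) (U : Set ℝ) : Prop :=
  ∀ ψ, IsTestFunctionOn U ψ → ∫ x, deriv ψ x • f x = - ∫ x, ψ x • h x

theorem hasWeakDerivOn_primitive (hU : IsOpen U) [U.OrdConnected] {h : ℝ → E}
    (hh : LocallyIntegrableOn h U) (hx₀ : x₀ ∈ U) :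
    HasWeakDerivOn (fun x => ∫ t in x₀..x, h t) h U := by
  intro ψ hψ
  obtain ⟨a, ha, b, hb, -, hab⟩ := hψ.exists_tsupport_subset_Ioo hU hx₀
  have hsupp : ∀ {χ : ℝ → ℝ} (k : ℝ → E), tsupport χ ⊆ tsupport ψ →
      ∫ x, χ x • k x = ∫ x in Ioc a b, χ x • k x := fun {χ} k hχ => by
    refine (setIntegral_eq_integral_of_forall_compl_eq_zero fun x hx => ?_).symm
    have hxχ : x ∉ tsupport χ := fun h => hx (Ioo_subset_Ioc_self (hab (hχ h)))
    rw [image_eq_zero_of_notMem_tsupport hxχ, zero_smul]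
  have hderiv : ∀ x, HasDerivAt ψ (deriv ψ x) x := fun x =>
    (hψ.contDiff.differentiable (by simp) x).hasDerivAt
  have hint : ∀ k : ℝ → E, LocallyIntegrableOn k U → Integrable fun x => deriv ψ x • k x :=
    fun k hk => hψ.deriv.integrable_smul hk
  have hprim : ∀ {y}, y ∈ U → LocallyIntegrableOn (fun x => ∫ t in y..x, h t) U := fun hy =>
    (continuousOn_primitive_of_locallyIntegrableOn hU hh hy).locallyIntegrableOn hU.measurableSet
  have hshift : ∫ x, deriv ψ x • ∫ t in x₀..x, h t = ∫ x, deriv ψ x • ∫ t in a..x, h t := by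
    have hconst : ∫ x, deriv ψ x • ∫ t in x₀..a, h t = 0 := by
      rw [integral_smul_const, integral_eq_zero_of_hasDerivAt_of_integrable hderiv
        hψ.deriv.integrable hψ.integrable, zero_smul]
    rw [← sub_eq_zero, ← integral_sub (hint _ (hprim hx₀)) (hint _ (hprim ha)), ← hconst]
    refine integral_congr_ae (Eventually.of_forall fun x => ?_)
    by_cases hx : x ∈ U
    · simp only [← smul_sub]
      rw [intervalIntegral.integral_interval_sub_interval_comm'
        (intervalIntegrable_of_locallyIntegrableOn hh hx₀ hx)
        (intervalIntegrable_of_locallyIntegrableOn hh ha hx)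
        (intervalIntegrable_of_locallyIntegrableOn hh hx₀ ha),
        intervalIntegral.integral_same, zero_sub, ← intervalIntegral.integral_symm]
    · have : deriv ψ x = 0 :=
        image_eq_zero_of_notMem_tsupport fun h => hx (hψ.deriv.tsupport_subset h)
      simp only [this, zero_smul, sub_zero]
  have hψb : ψ b = 0 := image_eq_zero_of_notMem_tsupport fun h => (hab h).2.false
  rw [hshift, hsupp _ tsupport_deriv_subset, hsupp _ Subset.rfl,
    setIntegral_deriv_smul_primitive (fun x _ => hderiv x) hψ.deriv.integrable.integrableOn hψb
      (hh.integrableOn_compact_subset (Set.Icc_subset U ha hb) isCompact_Icc |>.mono_set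
        Ioc_subset_Icc_self)]

/-- With `∫ ρ = 1`, the test function `φ - (∫ φ) ρ` has integral zero, hence is the derivative of a
test function and is orthogonal to `f`. -/
theorem ae_eq_const_of_hasWeakDerivOn_zero (hU : IsOpen U) [U.OrdConnected] {f : ℝ → E}
    (hf : LocallyIntegrableOn f U) (hweak : HasWeakDerivOn f 0 U) :
    ∃ c : E, ∀ᵐ x, x ∈ U → f x = c := by
  rcases U.eq_empty_or_nonempty with rfl | ⟨x₀, hx₀⟩
  · exact ⟨0, by simp⟩
  obtain ⟨ρ, hρ, hρ1⟩ := exists_isTestFunctionOn_integral_eq_one hU hx₀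
  set c : E := ∫ x, ρ x • f x
  refine ⟨c, ?_⟩
  have hfc : LocallyIntegrableOn (fun x => f x - c) U :=
    hf.sub ((locallyIntegrable_const c).locallyIntegrableOn U)
  suffices h_orth : ∀ φ, IsTestFunctionOn U φ → ∫ x, φ x • (f x - c) = 0 by
    filter_upwards [hU.ae_eq_zero_of_integral_contDiff_smul_eq_zero hfc
      fun φ h1 h2 h3 => h_orth φ ⟨h1, h2, h3⟩] with x hx hxU using sub_eq_zero.1 (hx hxU)
  intro φ hφ
  obtain ⟨ψ, hψ, hψφ⟩ := (hφ.sub_const_mul hρ (∫ x, φ x)).exists_deriv_eq hU (by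
    rw [integral_sub hφ.integrable (hρ.integrable.const_mul _), integral_const_mul, hρ1,
      mul_one, sub_self])
  have hρf : Integrable fun x => (∫ x, φ x) • ρ x • f x :=
    (hρ.integrable_smul hf).smul (∫ x, φ x)
  calc ∫ x, φ x • (f x - c) = (∫ x, φ x • f x) - (∫ x, φ x) • c := by
        simp only [smul_sub]
        rw [integral_sub (hφ.integrable_smul hf) (hφ.integrable.smul_const c), integral_smul_const]
    _ = ∫ x, (φ x - (∫ x, φ x) * ρ x) • f x := by
        simp only [sub_smul, mul_smul]
        rw [integral_sub (hφ.integrable_smul hf) hρf, integral_smul]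
    _ = 0 := by
        simpa only [hψφ, Pi.zero_apply, smul_zero, integral_zero, neg_zero] using hweak ψ hψ

theorem ae_eq_const_add_primitive_of_hasWeakDerivOn (hU : IsOpen U) [U.OrdConnected] {f h : ℝ → E}
    (hf : LocallyIntegrableOn f U) (hh : LocallyIntegrableOn h U) (hfh : HasWeakDerivOn f h U)
    (hx₀ : x₀ ∈ U) : ∃ c : E, ∀ᵐ r, r ∈ U → f r = c + ∫ t in x₀..r, h t := by
  have hF : LocallyIntegrableOn (fun r => ∫ t in x₀..r, h t) U :=
    (continuousOn_primitive_of_locallyIntegrableOn hU hh hx₀).locallyIntegrableOn hU.measurableSet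
  obtain ⟨c, hc⟩ := ae_eq_const_of_hasWeakDerivOn_zero hU (hf.sub hF) fun ψ hψ => by
    simp only [Pi.sub_apply, smul_sub]
    rw [integral_sub (hψ.deriv.integrable_smul hf) (hψ.deriv.integrable_smul hF), hfh ψ hψ,
      hasWeakDerivOn_primitive hU hh hx₀ ψ hψ, sub_self]
    simp only [Pi.zero_apply, smul_zero, integral_zero, neg_zero]
  exact ⟨c, hc.mono fun r hr hrU => sub_eq_iff_eq_add.1 (hr hrU)⟩

end WeakDerivative

section PolarCoordinates

variable {E : Type*} [NormedAddCommGroup E] [NormedSpace ℝ E] [FiniteDimensional ℝ E]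
  [MeasurableSpace E] [BorelSpace E] {μ : Measure E} [μ.IsAddHaarMeasure]

theorem ae_iff_ae_polar [Nontrivial E] {P : E → Prop} :
    (∀ᵐ x ∂μ, P x) ↔ ∀ᵐ q ∂(μ.toSphere.prod (Measure.volumeIoiPow (Module.finrank ℝ E - 1))),
      P (q.2.1 • q.1.1) := by
  rw [← μ.measurePreserving_homeomorphUnitSphereProd.map_eq,
    (homeomorphUnitSphereProd E).measurableEmbedding.ae_map_iff]
  have h_polar : ∀ x : ({0}ᶜ : Set E), (homeomorphUnitSphereProd E x).2.1 •
      (homeomorphUnitSphereProd E x).1.1 = x.1 := fun x =>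
    congr_arg Subtype.val ((homeomorphUnitSphereProd E).symm_apply_apply x)
  simp only [h_polar]
  rw [← ae_restrict_iff_subtype (measurableSet_singleton 0).compl (p := P),
    restrict_compl_singleton]

theorem ae_comp_norm [Nontrivial E] {P : ℝ → Prop}
    (h : ∀ᵐ r ∂volume.restrict (Ioi (0 : ℝ)), P r) : ∀ᵐ x ∂μ, P ‖x‖ := by
  rw [ae_iff_ae_polar]
  have hIoi : ∀ᵐ r ∂(Measure.volumeIoiPow (Module.finrank ℝ E - 1)), P r.1 :=
    (withDensity_absolutelyContinuous _ _).ae_le ((ae_restrict_iff_subtype measurableSet_Ioi).1 h)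
  filter_upwards [Measure.quasiMeasurePreserving_snd.ae hIoi] with q hq
  rwa [norm_smul, norm_eq_of_mem_sphere q.1, mul_one, Real.norm_of_nonneg q.2.2.le]

/-- Fubini in polar coordinates: on almost every ray from the origin, the measurable
representative of `u` agrees almost everywhere with the profile `f₀`, so it can serve as profile. -/
theorem exists_stronglyMeasurable_profile [Nontrivial E] {Y : Type*} [TopologicalSpace Y]
    {u : E → Y} (hu : AEStronglyMeasurable u μ) {f₀ : ℝ → Y} (hf₀ : ∀ᵐ x ∂μ, u x = f₀ ‖x‖) :
    ∃ f : ℝ → Y, StronglyMeasurable f ∧ u =ᵐ[μ] fun x => f ‖x‖ := by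
  have h_rep : ∀ᵐ x ∂μ, hu.mk u x = f₀ ‖x‖ := by
    filter_upwards [hf₀, hu.ae_eq_mk] with x h h' using h' ▸ h
  have h_polar := ae_iff_ae_polar.1 h_rep
  have h_norm : ∀ q : Metric.sphere (0 : E) 1 × Ioi (0 : ℝ), ‖q.2.1 • q.1.1‖ = q.2.1 := fun q => by
    rw [norm_smul, norm_eq_of_mem_sphere q.1, mul_one, Real.norm_of_nonneg q.2.2.le]
  simp only [h_norm] at h_polar
  have : (ae μ.toSphere).NeBot := ae_neBot.2 (Measure.toSphere_ne_zero _)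
  obtain ⟨e, he⟩ := (Measure.ae_ae_of_ae_prod h_polar).exists
  have h_ray : ∀ᵐ x ∂μ, hu.mk u (‖x‖ • e.1) = f₀ ‖x‖ := by
    rw [ae_iff_ae_polar]
    simp only [h_norm]
    exact Measure.quasiMeasurePreserving_snd.ae he
  refine ⟨fun r => hu.mk u (r • e.1),
    hu.stronglyMeasurable_mk.comp_measurable (by fun_prop), ?_⟩
  filter_upwards [hf₀, h_ray] with x h h' using h.trans h'.symm

end PolarCoordinates

section FiberAverage

variable {𝕜 X Y : Type*} [RCLike 𝕜] [MeasurableSpace X] [MeasurableSpace Y] {μ : Measure X}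

theorem inner_toLp_ofReal {ψ : X → ℝ} (hψ : MemLp (fun x => (ψ x : 𝕜)) 2 μ) (g : Lp 𝕜 2 μ) :
    inner 𝕜 (hψ.toLp _) g = ∫ x, ψ x • g x ∂μ := by
  rw [L2.inner_def]
  refine integral_congr_ae ?_
  filter_upwards [hψ.coeFn_toLp] with x hx
  rw [hx, RCLike.inner_apply, RCLike.conj_ofReal, RCLike.real_smul_eq_coe_mul, mul_comm]

/-- The adjoint of the isometric pullback along `q` replaces `g` by a function of `q`. -/
theorem exists_memLp_comp_integral_smul_eq {q : X → Y} (hq : Measurable q) {g : X → 𝕜}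
    (hg : MemLp g 2 μ) : ∃ h : Y → 𝕜, StronglyMeasurable h ∧ MemLp (fun x => h (q x)) 2 μ ∧
      ∀ ψ : Y → ℝ, Measurable ψ → MemLp (fun x => ψ (q x)) 2 μ →
        ∫ x, ψ (q x) • g x ∂μ = ∫ x, ψ (q x) • h (q x) ∂μ := by
  have hmp : MeasurePreserving q μ (μ.map q) := hq.measurePreserving μ
  let T : Lp 𝕜 2 (μ.map q) →L[𝕜] Lp 𝕜 2 μ :=
    (Lp.compMeasurePreservingₗᵢ 𝕜 q hmp).toContinuousLinearMap
  let h : Lp 𝕜 2 (μ.map q) := T.adjoint (hg.toLp g)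
  refine ⟨h, Lp.stronglyMeasurable h, (Lp.memLp h).comp_measurePreserving hmp, fun ψ hψ hψ2 => ?_⟩
  have hψq : MemLp (fun y => (ψ y : 𝕜)) 2 (μ.map q) :=
    (memLp_map_measure_iff (RCLike.measurable_ofReal.comp hψ).aestronglyMeasurable
      hq.aemeasurable).2 hψ2.ofReal
  have hTψ : T (hψq.toLp _) = (hψq.comp_measurePreserving hmp).toLp _ :=
    Lp.toLp_compMeasurePreserving hψq hmp
  calc ∫ x, ψ (q x) • g x ∂μ = ∫ x, ψ (q x) • (hg.toLp g : Lp 𝕜 2 μ) x ∂μ :=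
        integral_congr_ae (hg.coeFn_toLp.mono fun x hx => by simp only [hx])
    _ = inner 𝕜 (T (hψq.toLp _)) (hg.toLp g) := by
        rw [hTψ]; exact (inner_toLp_ofReal (hψq.comp_measurePreserving hmp) _).symm
    _ = inner 𝕜 (hψq.toLp _) h := (T.adjoint_inner_right _ _).symm
    _ = ∫ y, ψ y • h y ∂μ.map q := inner_toLp_ofReal hψq h
    _ = ∫ x, ψ (q x) • h (q x) ∂μ := integral_map hq.aemeasurable
        (hψ.stronglyMeasurable.smul (Lp.stronglyMeasurable h)).aestronglyMeasurable

end FiberAverage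

section SpacePolar

variable {d : ℕ} [NeZero d] {F : Type*} [NormedAddCommGroup F] [NormedSpace ℝ F]

/-- The surface measure of the unit sphere of `ℝ^d`, the constant of integration in polar
coordinates. -/
def sphereArea (d : ℕ) : ℝ := (volume : Measure (Space d)).toSphere.real univ

theorem sphereArea_pos : 0 < sphereArea d :=
  ENNReal.toReal_pos (Measure.measure_univ_ne_zero.2 (Measure.toSphere_ne_zero _))
    (measure_ne_top _ _)

theorem integrable_comp_norm_iff {f : ℝ → F} : Integrable (fun x : Space d => f ‖x‖) ↔
    IntegrableOn (fun r : ℝ => r ^ (d - 1) • f r) (Ioi 0) := by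
  have h := integrable_fun_norm_addHaar (volume : Measure (Space d)) (f := f)
  rwa [finrank_euclideanSpace_fin] at h

theorem integral_comp_norm (f : ℝ → F) : ∫ x : Space d, f ‖x‖ =
    sphereArea d • ∫ r in Ioi (0 : ℝ), r ^ (d - 1) • f r := by
  have h := integral_fun_norm_addHaar (volume : Measure (Space d)) f
  rwa [← smul_assoc, nsmul_eq_mul, ← Measure.toSphere_real_apply_univ,
    finrank_euclideanSpace_fin] at h

end SpacePolar

section NormComp

theorem IsTestFunctionOn.eventuallyEq_zero {U : Set ℝ} {ψ : ℝ → ℝ}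
    (hψ : IsTestFunctionOn U ψ) {x : ℝ} (hx : x ∉ U) :
    ψ =ᶠ[𝓝 x] 0 :=
  notMem_tsupport_iff_eventuallyEq.1 fun h => hx (hψ.tsupport_subset h)

theorem IsTestFunctionOn.setIntegral_smul {F : Type*} [NormedAddCommGroup F] [NormedSpace ℝ F]
    {U : Set ℝ} {ψ : ℝ → ℝ} (hψ : IsTestFunctionOn U ψ) (g : ℝ → F) :
    ∫ r in U, ψ r • g r = ∫ r, ψ r • g r :=
  setIntegral_eq_integral_of_forall_compl_eq_zero fun r hr => by
    rw [(hψ.eventuallyEq_zero hr).eq_of_nhds, Pi.zero_apply, zero_smul]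

theorem IsTestFunctionOn.comp_norm_eventuallyEq_zero {X : Type*}
    [NormedAddCommGroup X] {χ : ℝ → ℝ} (hχ : IsTestFunctionOn (Ioi 0) χ) :
    (fun x : X => χ ‖x‖) =ᶠ[𝓝 0] fun _ => 0 := by
  have h_norm : Tendsto (fun x : X => ‖x‖) (𝓝 0) (𝓝 0) := by
    simpa using (continuous_norm (E := X)).tendsto 0
  exact h_norm.eventually (hχ.eventuallyEq_zero self_notMem_Ioi)

theorem hasCompactSupport_comp_norm {X : Type*} [NormedAddCommGroup X] [ProperSpace X]
    {χ : ℝ → ℝ} (hχ : HasCompactSupport χ) :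
    HasCompactSupport (fun x : X => χ ‖x‖) := by
  obtain ⟨b, hb⟩ := hχ.isCompact.isBounded.subset_closedBall 0
  refine HasCompactSupport.intro (isCompact_closedBall (0 : X) b) fun x hx => ?_
  exact image_eq_zero_of_notMem_tsupport fun h => hx (by simpa using hb h)

variable {X F : Type*} [NormedAddCommGroup X] [InnerProductSpace ℝ X] [NormedAddCommGroup F]
  [NormedSpace ℝ F] {U : Set ℝ} {ψ χ : ℝ → ℝ}

theorem hasFDerivAt_norm_of_ne_zero {x : X} (hx : x ≠ 0) :
    HasFDerivAt (fun y : X => ‖y‖) (‖x‖⁻¹ • innerSL ℝ x) x := by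
  have h_sqrt := (hasStrictFDerivAt_norm_sq x).hasFDerivAt.sqrt (by simpa using hx)
  simp only [Real.sqrt_sq (norm_nonneg _)] at h_sqrt
  refine h_sqrt.congr_fderiv ?_
  ext y
  simp only [nsmul_eq_mul, Nat.cast_ofNat, smul_apply, smul_eq_mul, innerSL_apply_apply]
  field

theorem hasFDerivAt_comp_norm {f : ℝ → F} {f' : F} {x : X} (hx : x ≠ 0)
    (hf : HasDerivAt f f' ‖x‖) :
    HasFDerivAt (fun y : X => f ‖y‖) ((innerSL ℝ x).smulRight (‖x‖⁻¹ • f')) x := by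
  refine (hf.hasFDerivAt.comp x (hasFDerivAt_norm_of_ne_zero hx)).congr_fderiv ?_
  ext y
  simp [smul_smul, mul_comm]

theorem IsTestFunctionOn.mul_contDiffOn (hψ : IsTestFunctionOn U ψ) (hU : IsOpen U)
    {k : ℝ → ℝ} (hk : ContDiffOn ℝ ∞ k U) : IsTestFunctionOn U (fun r => ψ r * k r) where
  contDiff := contDiff_iff_contDiffAt.2 fun x => by
    by_cases hx : x ∈ U
    · exact hψ.contDiff.contDiffAt.mul (hk.contDiffAt (hU.mem_nhds hx))
    · have h_zero : (fun r => ψ r * k r) =ᶠ[𝓝 x] fun _ => 0 := by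
        filter_upwards [hψ.eventuallyEq_zero hx] with y hy
        rw [hy, Pi.zero_apply, zero_mul]
      exact contDiffAt_const.congr_of_eventuallyEq h_zero
  hasCompactSupport := hψ.hasCompactSupport.mul_right
  tsupport_subset := (tsupport_mul_subset_left).trans hψ.tsupport_subset

theorem IsTestFunctionOn.contDiff_comp_norm (hχ : IsTestFunctionOn (Ioi 0) χ) :
    ContDiff ℝ ∞ (fun x : X => χ ‖x‖) := by
  refine contDiff_iff_contDiffAt.2 fun x => ?_
  rcases eq_or_ne x 0 with rfl | hx
  · exact contDiffAt_const.congr_of_eventuallyEq hχ.comp_norm_eventuallyEq_zero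
  · exact hχ.contDiff.contDiffAt.comp x (contDiffAt_norm ℝ hx)

theorem IsTestFunctionOn.hasFDerivAt_comp_norm (hχ : IsTestFunctionOn (Ioi 0) χ) (x : X) :
    HasFDerivAt (fun x : X => χ ‖x‖) ((_root_.deriv χ ‖x‖ / ‖x‖) • innerSL ℝ x) x := by
  rcases eq_or_ne x 0 with rfl | hx
  · simpa using (hasFDerivAt_const (0 : ℝ) (0 : X)).congr_of_eventuallyEq
      hχ.comp_norm_eventuallyEq_zero
  · refine (HypSoliton.hasFDerivAt_comp_norm hx
      (hχ.contDiff.differentiable (by simp) _).hasDerivAt).congr_fderiv ?_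
    ext y
    simp [div_eq_inv_mul, mul_comm]

end NormComp

section RadialTestFields

variable {d : ℕ} {χ : ℝ → ℝ}

theorem fderiv_comp_norm_single (hχ : IsTestFunctionOn (Ioi 0) χ) (x : Space d) (i : Fin d) :
    fderiv ℝ (fun x : Space d => χ ‖x‖) x (EuclideanSpace.single i 1)
      = deriv χ ‖x‖ * (x i / ‖x‖) := by
  rw [(hχ.hasFDerivAt_comp_norm x).fderiv, smul_apply, innerSL_apply_apply,
    EuclideanSpace.inner_single_right, conj_trivial, one_mul, smul_eq_mul]
  ring

theorem contDiff_radialField (hχ : IsTestFunctionOn (Ioi 0) χ) (i : Fin d) :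
    ContDiff ℝ ∞ fun x : Space d => χ ‖x‖ * x i :=
  hχ.contDiff_comp_norm.mul (by fun_prop)

theorem fderiv_radialField_single (hχ : IsTestFunctionOn (Ioi 0) χ) (x : Space d) (i : Fin d) :
    fderiv ℝ (fun x : Space d => χ ‖x‖ * x i) x (EuclideanSpace.single i 1)
      = deriv χ ‖x‖ / ‖x‖ * x i ^ 2 + χ ‖x‖ := by
  have h_coord : HasFDerivAt (fun x : Space d => x i) (EuclideanSpace.proj i : Space d →L[ℝ] ℝ) x :=
    (EuclideanSpace.proj i : Space d →L[ℝ] ℝ).hasFDerivAt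
  have h_prod : fderiv ℝ (fun x : Space d => χ ‖x‖ * x i) x = _ :=
    ((hχ.hasFDerivAt_comp_norm x).mul h_coord).fderiv
  rw [h_prod]
  simp [EuclideanSpace.inner_single_right]
  ring

theorem sum_fderiv_radialField_single (hχ : IsTestFunctionOn (Ioi 0) χ) (x : Space d) :
    ∑ i, fderiv ℝ (fun x : Space d => χ ‖x‖ * x i) x (EuclideanSpace.single i 1)
      = deriv χ ‖x‖ * ‖x‖ + d * χ ‖x‖ := by
  have h_norm : ∑ i, x i ^ 2 = ‖x‖ ^ 2 := by simp [EuclideanSpace.norm_sq_eq]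
  simp only [fderiv_radialField_single hχ, Finset.sum_add_distrib, ← Finset.mul_sum, h_norm,
    Finset.sum_const, Finset.card_univ, Fintype.card_fin, nsmul_eq_mul]
  rcases eq_or_ne ‖x‖ 0 with h | _
  · simp [h]
  · field_simp

variable {𝕜 : Type*} [RCLike 𝕜]

theorem integrable_smul_of_memLp_two {g : Space d → 𝕜} (hg : MemLp g 2 volume) {φ : Space d → ℝ}
    (hφ : Continuous φ) (hc : HasCompactSupport φ) : Integrable (fun x => φ x • g x) :=
  (hg.locallyIntegrable one_le_two).integrable_smul_left_of_hasCompactSupport hφ hc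

theorem continuous_fderiv_apply {φ : Space d → ℝ} (hφ : ContDiff ℝ ∞ φ) (v : Space d) :
    Continuous fun x => fderiv ℝ φ x v :=
  (hφ.continuous_fderiv (by simp)).clm_apply continuous_const

theorem memH1WithGradient_smul_const {φ : Space d → ℝ} (hφ : ContDiff ℝ ∞ φ)
    (hc : HasCompactSupport φ) (z : 𝕜) :
    MemH1WithGradient (fun x => φ x • z)
      (fun i x => fderiv ℝ φ x (EuclideanSpace.single i 1) • z) where
  memLp := (hφ.continuous.smul continuous_const).memLp_of_hasCompactSupport hc.smul_right
  memLp_gradient i := ((continuous_fderiv_apply hφ _).smul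
    continuous_const).memLp_of_hasCompactSupport (hc.fderiv_apply (𝕜 := ℝ) _).smul_right
  isWeakGradient η hη hηc i := by
    simp only [smul_smul, integral_smul_const]
    rw [← neg_smul, ← neg_eq_iff_eq_neg.2 (integral_mul_fderiv_eq_neg_fderiv_mul_of_integrable
      (μ := (volume : Measure (Space d))) (f := η) (g := φ) (v := EuclideanSpace.single i (1 : ℝ))
      ?_ ?_ ?_ (fun x _ => hη.differentiable (by simp) x)
      (fun x _ => hφ.differentiable (by simp) x))]
    · exact ((continuous_fderiv_apply hη _).mul
        hφ.continuous).integrable_of_hasCompactSupport hc.mul_left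
    · exact (hη.continuous.mul
        (continuous_fderiv_apply hφ _)).integrable_of_hasCompactSupport hηc.mul_right
    · exact (hη.continuous.mul hφ.continuous).integrable_of_hasCompactSupport hηc.mul_right

/-- The radial component `∑ (xᵢ / |x|) Gᵢ` of a vector field `G`, equal to `0` at the origin. -/
def radialComponent (G : Fin d → Space d → 𝕜) (x : Space d) : 𝕜 :=
  ∑ i, (x i / ‖x‖) • G i x

theorem memLp_radialComponent {G : Fin d → Space d → 𝕜} (hG : ∀ i, MemLp (G i) 2 volume) :
    MemLp (radialComponent G) 2 volume := by
  refine memLp_finsetSum _ fun i _ => (hG i).of_le ?_ (ae_of_all _ fun x => ?_)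
  · have h_coord : Measurable fun x : Space d => x i := by fun_prop
    exact (h_coord.div measurable_norm).aestronglyMeasurable.smul (hG i).aestronglyMeasurable
  · have h_le : |x i / ‖x‖| ≤ 1 := by
      rw [abs_div, abs_norm]
      exact div_le_one_of_le₀ (by simpa using PiLp.norm_apply_le x i) (norm_nonneg _)
    rw [norm_smul, Real.norm_eq_abs]
    exact mul_le_of_le_one_left (norm_nonneg _) h_le

theorem norm_smul_radialComponent (G : Fin d → Space d → 𝕜) (x : Space d) :
    ‖x‖ • radialComponent G x = ∑ i, x i • G i x := by
  simp only [radialComponent, Finset.smul_sum, smul_smul]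
  refine Finset.sum_congr rfl fun i _ => ?_
  rcases eq_or_ne x 0 with rfl | hx
  · simp
  · rw [mul_div_cancel₀ _ (norm_ne_zero_iff.2 hx)]

/-- The weak gradient tested with the radial vector field `χ(|x|) x`. -/
theorem integral_div_radialField {u : Space d → 𝕜} {G : Fin d → Space d → 𝕜}
    (hu : MemH1WithGradient u G) (hχ : IsTestFunctionOn (Ioi 0) χ) :
    ∫ x, (deriv χ ‖x‖ * ‖x‖ + d * χ ‖x‖) • u x
      = - ∫ x, (χ ‖x‖ * ‖x‖) • radialComponent G x := by
  let Φ : Fin d → Space d → ℝ := fun i x => χ ‖x‖ * x i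
  have hΦ : ∀ i, ContDiff ℝ ∞ (Φ i) := contDiff_radialField hχ
  have hΦc : ∀ i, HasCompactSupport (Φ i) :=
    fun i => (hasCompactSupport_comp_norm hχ.hasCompactSupport).mul_right
  calc ∫ x, (deriv χ ‖x‖ * ‖x‖ + d * χ ‖x‖) • u x
      = ∫ x, ∑ i, fderiv ℝ (Φ i) x (EuclideanSpace.single i 1) • u x := by
        refine integral_congr_ae (ae_of_all _ fun x => ?_)
        simp only [← Finset.sum_smul, Φ, sum_fderiv_radialField_single hχ]
    _ = ∑ i, ∫ x, fderiv ℝ (Φ i) x (EuclideanSpace.single i 1) • u x :=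
        integral_finsetSum _ fun i _ => integrable_smul_of_memLp_two hu.memLp
          (continuous_fderiv_apply (hΦ i) _) ((hΦc i).fderiv_apply (𝕜 := ℝ) _)
    _ = ∑ i, - ∫ x, Φ i x • G i x :=
        Finset.sum_congr rfl fun i _ => hu.isWeakGradient (Φ i) (hΦ i) (hΦc i) i
    _ = - ∫ x, ∑ i, Φ i x • G i x := by
        rw [Finset.sum_neg_distrib, integral_finsetSum _ fun i _ =>
          integrable_smul_of_memLp_two (hu.memLp_gradient i) (hΦ i).continuous (hΦc i)]
    _ = - ∫ x, (χ ‖x‖ * ‖x‖) • radialComponent G x := by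
        congr 1
        refine integral_congr_ae (ae_of_all _ fun x => ?_)
        simp only [Φ, mul_smul, norm_smul_radialComponent, Finset.smul_sum]

end RadialTestFields

section RadialProfile

/-- `f` is, on `(0, ∞)`, a primitive of the locally integrable function `h`, and both are square
integrable with respect to `r^m dr`. With `m = d - 1` these are the profiles of the radial `H¹`
functions on `ℝ^d`. -/
structure IsRadialProfile {E : Type*} [NormedAddCommGroup E] [NormedSpace ℝ E] (m : ℕ)
    (f h : ℝ → E) : Prop where
  locallyIntegrableOn : LocallyIntegrableOn h (Ioi 0)
  eq_add_integral : ∀ r, 0 < r → f r = f 1 + ∫ t in (1 : ℝ)..r, h t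
  integrableOn_sq : IntegrableOn (fun r => r ^ m * ‖f r‖ ^ 2) (Ioi 0)
  integrableOn_deriv_sq : IntegrableOn (fun r => r ^ m * ‖h r‖ ^ 2) (Ioi 0)

theorem locallyIntegrableOn_of_pow_mul_sq {E : Type*} [NormedAddCommGroup E] {f : ℝ → E}
    (hf : AEStronglyMeasurable f) {m : ℕ}
    (h : IntegrableOn (fun r : ℝ => r ^ m * ‖f r‖ ^ 2) (Ioi 0)) :
    LocallyIntegrableOn f (Ioi 0) := by
  rw [locallyIntegrableOn_iff isOpen_Ioi.isLocallyClosed]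
  intro k hk hkc
  rcases k.eq_empty_or_nonempty with rfl | hne
  · simp
  obtain ⟨a, hak, hale⟩ := hkc.exists_isLeast hne
  have ha : 0 < a := hk hak
  have h_dom : IntegrableOn (fun r : ℝ => 1 + (a ^ m)⁻¹ * (r ^ m * ‖f r‖ ^ 2)) k :=
    (integrableOn_const hkc.measure_lt_top.ne).add ((h.mono_set hk).const_mul _)
  refine h_dom.mono' hf.restrict ?_
  filter_upwards [ae_restrict_mem hkc.measurableSet] with r hr
  have h_sq : ‖f r‖ ^ 2 ≤ (a ^ m)⁻¹ * (r ^ m * ‖f r‖ ^ 2) := by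
    rw [← mul_assoc]
    refine le_mul_of_one_le_left (sq_nonneg _) ?_
    rw [inv_mul_eq_div, one_le_div (by positivity)]
    gcongr
    exact hale hr
  nlinarith [sq_nonneg (‖f r‖ - 1)]

variable {𝕜 : Type*} [RCLike 𝕜] {d : ℕ} [NeZero d] {f h : ℝ → 𝕜}

theorem integrableOn_pow_mul_sq (hf : MemLp (fun x : Space d => f ‖x‖) 2 volume) :
    IntegrableOn (fun r : ℝ => r ^ (d - 1) * ‖f r‖ ^ 2) (Ioi 0) := by
  simpa only [smul_eq_mul] using (integrable_comp_norm_iff (d := d) (f := fun r => ‖f r‖ ^ 2)).1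
    (hf.integrable_norm_pow two_ne_zero)

theorem deriv_eq_of_eq_pow_mul {ψ χ : ℝ → ℝ} (hψχ : ∀ r ∈ Ioi (0 : ℝ), ψ r = r ^ d * χ r)
    (hχ : Differentiable ℝ χ) {r : ℝ} (hr : 0 < r) :
    deriv ψ r = r ^ (d - 1) * (deriv χ r * r + d * χ r) := by
  have h_germ : ψ =ᶠ[𝓝 r] fun r => r ^ d * χ r :=
    eventually_of_mem (Ioi_mem_nhds hr) hψχ
  have h_prod : HasDerivAt (fun r => r ^ d * χ r) (d * r ^ (d - 1) * χ r + r ^ d * deriv χ r) r :=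
    (hasDerivAt_pow d r).mul (hχ r).hasDerivAt
  rw [h_germ.deriv_eq, h_prod.deriv, ← mul_pow_sub_one (NeZero.ne d) r]
  ring

/-- `h(r)` is the average of `g` over the sphere of radius `r`. The condition is tested against
smooth radial functions vanishing near the origin, so that `h` is determined up to null sets. -/
def IsSphericalAverage (g : Space d → 𝕜) (h : ℝ → 𝕜) : Prop :=
  ∀ ψ, IsTestFunctionOn (Ioi 0) ψ →
    ∫ x, ψ ‖x‖ • g x = sphereArea d • ∫ r in Ioi (0 : ℝ), r ^ (d - 1) • ψ r • h r

/-- Testing the weak gradient with the field `χ(|x|) x`, where `χ = ψ / r^d`, leaves `ψ'` on one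
side and `ψ` on the other. -/
theorem hasWeakDerivOn_profile {u : Space d → 𝕜} {G : Fin d → Space d → 𝕜}
    (hu : MemH1WithGradient u G) (huf : u =ᵐ[volume] fun x => f ‖x‖)
    (h_radial : IsSphericalAverage (radialComponent G) h) :
    HasWeakDerivOn f h (Ioi 0) := by
  intro ψ hψ
  let χ : ℝ → ℝ := fun r => ψ r * (r ^ d)⁻¹
  have hχ : IsTestFunctionOn (Ioi 0) χ := hψ.mul_contDiffOn isOpen_Ioi fun r hr =>
    ((contDiffAt_id.pow d).inv (pow_ne_zero _ (ne_of_gt hr))).contDiffWithinAt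
  have hψχ : ∀ r ∈ Ioi (0 : ℝ), ψ r = r ^ d * χ r := fun r hr => by
    rw [mul_comm, inv_mul_cancel_right₀ (pow_ne_zero _ (ne_of_gt hr))]
  have hχr : IsTestFunctionOn (Ioi 0) fun r => χ r * r :=
    hχ.mul_contDiffOn isOpen_Ioi contDiffOn_id
  have h_test := integral_div_radialField hu hχ
  have h_left : ∫ x, (deriv χ ‖x‖ * ‖x‖ + d * χ ‖x‖) • u x
      = ∫ x : Space d, (deriv χ ‖x‖ * ‖x‖ + d * χ ‖x‖) • f ‖x‖ :=
    integral_congr_ae (by filter_upwards [huf] with x hx; rw [hx])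
  rw [h_left, integral_comp_norm fun r => (deriv χ r * r + d * χ r) • f r,
    h_radial _ hχr, ← smul_neg] at h_test
  calc ∫ r, deriv ψ r • f r
      = ∫ r in Ioi (0 : ℝ), r ^ (d - 1) • (deriv χ r * r + d * χ r) • f r := by
        rw [← hψ.deriv.setIntegral_smul]
        refine setIntegral_congr_fun measurableSet_Ioi fun r hr => ?_
        simp only [smul_smul,
          deriv_eq_of_eq_pow_mul hψχ (hχ.contDiff.differentiable (by simp)) hr]
    _ = - ∫ r in Ioi (0 : ℝ), r ^ (d - 1) • (χ r * r) • h r :=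
        smul_right_injective 𝕜 (sphereArea_pos (d := d)).ne' h_test
    _ = - ∫ r, ψ r • h r := by
        rw [← hψ.setIntegral_smul]
        congr 1
        refine setIntegral_congr_fun measurableSet_Ioi fun r hr => ?_
        simp only [smul_smul, hψχ r hr, ← mul_pow_sub_one (NeZero.ne d) r]
        ring_nf

theorem exists_isRadialProfile {u : Space d → 𝕜} {G : Fin d → Space d → 𝕜}
    (hu : MemH1WithGradient u G) (hsym : IsSphericallySymmetric u) :
    ∃ f h : ℝ → 𝕜, (u =ᵐ[volume] fun x => f ‖x‖) ∧ IsRadialProfile (d - 1) f h ∧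
      IsSphericalAverage (radialComponent G) h := by
  obtain ⟨f₀, hf₀⟩ := hsym
  obtain ⟨f, hf, huf⟩ := exists_stronglyMeasurable_profile hu.memLp.aestronglyMeasurable hf₀
  obtain ⟨h, hh, hh2, h_rep⟩ := exists_memLp_comp_integral_smul_eq measurable_norm
    (memLp_radialComponent hu.memLp_gradient)
  have h_radial : IsSphericalAverage (radialComponent G) h := fun ψ hψ => by
    rw [h_rep ψ hψ.contDiff.continuous.measurable
      (hψ.contDiff_comp_norm.continuous.memLp_of_hasCompactSupport
        (hasCompactSupport_comp_norm hψ.hasCompactSupport)),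
      integral_comp_norm fun r => ψ r • h r]
  have hf_sq := integrableOn_pow_mul_sq ((memLp_congr_ae huf).1 hu.memLp)
  have hh_sq := integrableOn_pow_mul_sq hh2
  have hh_loc := locallyIntegrableOn_of_pow_mul_sq hh.aestronglyMeasurable hh_sq
  obtain ⟨c, hc⟩ := ae_eq_const_add_primitive_of_hasWeakDerivOn isOpen_Ioi
    (locallyIntegrableOn_of_pow_mul_sq hf.aestronglyMeasurable hf_sq) hh_loc
    (hasWeakDerivOn_profile hu huf h_radial) (mem_Ioi.2 one_pos)
  have hc' : ∀ᵐ r ∂volume.restrict (Ioi 0), f r = c + ∫ t in (1 : ℝ)..r, h t :=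
    (ae_restrict_iff' measurableSet_Ioi).2 hc
  refine ⟨fun r => c + ∫ t in (1 : ℝ)..r, h t, h, ?_, ⟨hh_loc, fun r _ => by simp, ?_, hh_sq⟩,
    h_radial⟩
  · filter_upwards [huf, ae_comp_norm hc'] with x hx hx'
    rw [hx, hx']
  · refine hf_sq.congr_fun_ae ?_
    filter_upwards [hc'] with r hr
    rw [hr]

end RadialProfile

section ProfileBounds

theorem two_mul_le_mul_sq_add_inv {q x : ℝ} (hq : 0 < q) : 2 * x ≤ q * x ^ 2 + q⁻¹ := by
  have h_sq : q * x ^ 2 + q⁻¹ - 2 * x = (q * x - 1) ^ 2 * q⁻¹ := by field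
  have h_nonneg : 0 ≤ (q * x - 1) ^ 2 * q⁻¹ := by positivity
  linarith

theorem setIntegral_Ioc_rpow_le {r β : ℝ} (hr : 0 < r) (hr1 : r ≤ 1) (hβ : 0 < β) :
    ∫ s in Ioc r 1, s ^ (-β - 1) ≤ r ^ (-β) / β := by
  have h_zero : (0 : ℝ) ∉ uIcc r 1 := by
    rw [uIcc_of_le hr1]
    exact fun h => not_lt.2 h.1 hr
  rw [← intervalIntegral.integral_of_le hr1, integral_rpow (Or.inr ⟨by linarith, h_zero⟩),
    Real.one_rpow, sub_add_cancel, div_neg, neg_div', neg_sub]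
  gcongr
  linarith

variable {E : Type*} [NormedAddCommGroup E] {m : ℕ} {f h : ℝ → E}

theorem integrableOn_Ioc_of_locallyIntegrableOn_Ioi (hh : LocallyIntegrableOn h (Ioi 0)) {r s : ℝ}
    (hr : 0 < r) : IntegrableOn h (Ioc r s) :=
  (hh.integrableOn_compact_subset (fun _ ht => hr.trans_le ht.1) isCompact_Icc).mono_set
    Ioc_subset_Icc_self

theorem setIntegral_pow_mul_sq_le (h2 : IntegrableOn (fun r : ℝ => r ^ m * ‖h r‖ ^ 2) (Ioi 0))
    {s : Set ℝ} (hs : s ⊆ Ioi 0) :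
    ∫ r in s, r ^ m * ‖h r‖ ^ 2 ≤ ∫ r in Ioi (0 : ℝ), r ^ m * ‖h r‖ ^ 2 := by
  refine setIntegral_mono_set h2 ?_ hs.eventuallyLE
  filter_upwards [ae_restrict_mem measurableSet_Ioi] with r (hr : 0 < r)
  exact mul_nonneg (pow_nonneg hr.le m) (sq_nonneg _)

/-- Young's inequality `2 ‖h‖ ≤ q ‖h‖² + 1/q` with `q = r^(-β) s^m` balances the weighted energy of
`h` against the remaining power of `s`. -/
theorem setIntegral_norm_le_rpow (hh : LocallyIntegrableOn h (Ioi 0))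
    (h2 : IntegrableOn (fun r : ℝ => r ^ m * ‖h r‖ ^ 2) (Ioi 0)) {β : ℝ} (hβ : 0 < β)
    (hβm : (m : ℝ) ≤ 2 * β + 1) {r : ℝ} (hr : 0 < r) (hr1 : r ≤ 1) :
    ∫ s in Ioc r 1, ‖h s‖
      ≤ ((∫ s in Ioi (0 : ℝ), s ^ m * ‖h s‖ ^ 2) + (2 * β)⁻¹) / 2 * r ^ (-β) := by
  set A := ∫ s in Ioi (0 : ℝ), s ^ m * ‖h s‖ ^ 2
  have hsub : Ioc r 1 ⊆ Ioi 0 := fun s hs => hr.trans hs.1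
  have hκ : 0 < r ^ (-β) := Real.rpow_pos_of_pos hr _
  have h_rpow : IntegrableOn (fun s : ℝ => s ^ (-(2 * β) - 1)) (Ioc r 1) :=
    (ContinuousOn.integrableOn_Icc fun s hs => (Real.continuousAt_rpow_const _ _
      (Or.inl (hr.trans_le hs.1).ne')).continuousWithinAt).mono_set Ioc_subset_Icc_self
  have h_young : ∀ s ∈ Ioc r 1, ‖h s‖
      ≤ r ^ (-β) / 2 * (s ^ m * ‖h s‖ ^ 2) + (r ^ (-β))⁻¹ / 2 * s ^ (-(2 * β) - 1) := by
    intro s hs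
    have hs0 : 0 < s := hr.trans hs.1
    have h_sq := two_mul_le_mul_sq_add_inv (x := ‖h s‖) (mul_pos hκ (pow_pos hs0 m))
    have h_pow : (s ^ m)⁻¹ ≤ s ^ (-(2 * β) - 1) := by
      rw [← Real.rpow_natCast, ← Real.rpow_neg hs0.le]
      exact Real.rpow_le_rpow_of_exponent_ge hs0 hs.2 (by linarith)
    have h_inv : (r ^ (-β) * s ^ m)⁻¹ ≤ (r ^ (-β))⁻¹ * s ^ (-(2 * β) - 1) := by
      rw [mul_inv]
      gcongr
    linarith
  have h_int₁ : IntegrableOn (fun s => r ^ (-β) / 2 * (s ^ m * ‖h s‖ ^ 2)) (Ioc r 1) :=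
    (h2.mono_set hsub).const_mul _
  have h_int₂ : IntegrableOn (fun s => (r ^ (-β))⁻¹ / 2 * s ^ (-(2 * β) - 1)) (Ioc r 1) :=
    h_rpow.const_mul _
  calc ∫ s in Ioc r 1, ‖h s‖
      ≤ ∫ s in Ioc r 1, (r ^ (-β) / 2 * (s ^ m * ‖h s‖ ^ 2)
          + (r ^ (-β))⁻¹ / 2 * s ^ (-(2 * β) - 1)) :=
        setIntegral_mono_on (integrableOn_Ioc_of_locallyIntegrableOn_Ioi hh hr).norm
          (h_int₁.add h_int₂) measurableSet_Ioc h_young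
    _ = r ^ (-β) / 2 * (∫ s in Ioc r 1, s ^ m * ‖h s‖ ^ 2)
          + (r ^ (-β))⁻¹ / 2 * ∫ s in Ioc r 1, s ^ (-(2 * β) - 1) := by
        rw [integral_add h_int₁ h_int₂, integral_const_mul, integral_const_mul]
    _ ≤ r ^ (-β) / 2 * A + (r ^ (-β))⁻¹ / 2 * (r ^ (-(2 * β)) / (2 * β)) := by
        gcongr
        · exact setIntegral_pow_mul_sq_le h2 hsub
        · exact setIntegral_Ioc_rpow_le hr hr1 (by positivity)
    _ = (A + (2 * β)⁻¹) / 2 * r ^ (-β) := by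
        rw [show -(2 * β) = -β + -β by ring, Real.rpow_add hr]
        field

theorem setIntegral_Ioc_add_one_norm_le (hh : LocallyIntegrableOn h (Ioi 0))
    (h2 : IntegrableOn (fun r : ℝ => r ^ m * ‖h r‖ ^ 2) (Ioi 0)) {r : ℝ} (hr : 1 ≤ r) :
    ∫ s in Ioc r (r + 1), ‖h s‖ ≤ 1 + ∫ s in Ioi (0 : ℝ), s ^ m * ‖h s‖ ^ 2 := by
  have hr0 : 0 < r := by linarith
  have hsub : Ioc r (r + 1) ⊆ Ioi 0 := fun s hs => hr0.trans hs.1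
  have h_one : IntegrableOn (fun _ : ℝ => (1 : ℝ)) (Ioc r (r + 1)) := integrableOn_const (by simp)
  calc ∫ s in Ioc r (r + 1), ‖h s‖
      ≤ ∫ s in Ioc r (r + 1), (1 + s ^ m * ‖h s‖ ^ 2) := by
        refine setIntegral_mono_on (integrableOn_Ioc_of_locallyIntegrableOn_Ioi hh hr0).norm
          (h_one.add (h2.mono_set hsub)) measurableSet_Ioc fun s hs => ?_
        have h_pow : 1 ≤ s ^ m := one_le_pow₀ (hr.trans hs.1.le)
        nlinarith [sq_nonneg (‖h s‖ - 1), mul_le_mul_of_nonneg_right h_pow (sq_nonneg ‖h s‖)]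
    _ = 1 + ∫ s in Ioc r (r + 1), s ^ m * ‖h s‖ ^ 2 := by
        rw [integral_add h_one (h2.mono_set hsub)]
        simp
    _ ≤ _ := add_le_add le_rfl (setIntegral_pow_mul_sq_le h2 hsub)

namespace IsRadialProfile

variable [NormedSpace ℝ E]

theorem continuousOn (hf : IsRadialProfile m f h) : ContinuousOn f (Ioi 0) :=
  (continuousOn_const.add (continuousOn_primitive_of_locallyIntegrableOn isOpen_Ioi
    hf.locallyIntegrableOn (mem_Ioi.2 one_pos))).congr fun r hr => hf.eq_add_integral r hr

theorem sub_eq_integral (hf : IsRadialProfile m f h) {r s : ℝ} (hr : 0 < r) (hs : 0 < s) :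
    f s - f r = ∫ t in r..s, h t := by
  have h_int : ∀ {b : ℝ}, 0 < b → IntervalIntegrable h volume 1 b := fun hb =>
    intervalIntegrable_of_locallyIntegrableOn hf.locallyIntegrableOn (mem_Ioi.2 one_pos) hb
  rw [hf.eq_add_integral s hs, hf.eq_add_integral r hr, add_sub_add_left_eq_sub,
    intervalIntegral.integral_interval_sub_left (h_int hs) (h_int hr)]

theorem norm_sub_le (hf : IsRadialProfile m f h) {r s : ℝ} (hr : 0 < r) (hrs : r ≤ s) :
    ‖f s - f r‖ ≤ ∫ t in Ioc r s, ‖h t‖ := by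
  rw [hf.sub_eq_integral hr (hr.trans_le hrs), intervalIntegral.integral_of_le hrs]
  exact norm_integral_le_integral_norm _

/-- Radial `H¹` functions are `O(r^(-β))` at the origin for every `β > 0` with
`β ≥ (d - 2) / 2`. -/
theorem exists_norm_le_rpow (hf : IsRadialProfile m f h) {β : ℝ} (hβ : 0 < β)
    (hβm : (m : ℝ) ≤ 2 * β + 1) :
    ∃ C, 0 ≤ C ∧ ∀ r, 0 < r → r ≤ 1 → ‖f r‖ ≤ C * r ^ (-β) := by
  have hA : 0 ≤ ∫ r in Ioi (0 : ℝ), r ^ m * ‖h r‖ ^ 2 :=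
    setIntegral_nonneg measurableSet_Ioi fun r (hr : 0 < r) => by positivity
  refine ⟨‖f 1‖ + ((∫ r in Ioi (0 : ℝ), r ^ m * ‖h r‖ ^ 2) + (2 * β)⁻¹) / 2, by positivity,
    fun r hr hr1 => ?_⟩
  have h_one : 1 ≤ r ^ (-β) := Real.one_le_rpow_of_pos_of_le_one_of_nonpos hr hr1 (by linarith)
  have h_diff := (hf.norm_sub_le hr hr1).trans
    (setIntegral_norm_le_rpow hf.locallyIntegrableOn hf.integrableOn_deriv_sq hβ hβm hr hr1)
  calc ‖f r‖ ≤ ‖f 1‖ + ‖f 1 - f r‖ := by simpa using _root_.norm_sub_le (f 1) (f 1 - f r)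
    _ ≤ ‖f 1‖ * r ^ (-β) + _ := add_le_add (le_mul_of_one_le_right (norm_nonneg _) h_one) h_diff
    _ = _ := by ring

theorem exists_norm_le (hf : IsRadialProfile m f h) :
    ∃ C, 0 ≤ C ∧ ∀ r, 1 ≤ r → ‖f r‖ ≤ C := by
  have hf_loc : LocallyIntegrableOn f (Ioi 0) :=
    hf.continuousOn.locallyIntegrableOn measurableSet_Ioi
  suffices h_bound : ∀ r, 1 ≤ r → ‖f r‖ ≤ (1 + ∫ s in Ioi (0 : ℝ), s ^ m * ‖f s‖ ^ 2)
      + (1 + ∫ s in Ioi (0 : ℝ), s ^ m * ‖h s‖ ^ 2) from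
    ⟨_, (norm_nonneg _).trans (h_bound 1 le_rfl), h_bound⟩
  intro r hr
  have hr0 : 0 < r := by linarith
  have hf_int : IntegrableOn (fun s => ‖f s‖) (Ioc r (r + 1)) :=
    (integrableOn_Ioc_of_locallyIntegrableOn_Ioi hf_loc hr0).norm
  have hh_int : IntegrableOn (fun s => ‖h s‖) (Ioc r (r + 1)) :=
    (integrableOn_Ioc_of_locallyIntegrableOn_Ioi hf.locallyIntegrableOn hr0).norm
  have h_const : ∀ k : ℝ, IntegrableOn (fun _ : ℝ => k) (Ioc r (r + 1)) := fun k =>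
    integrableOn_const (by simp)
  have h_compare : ∀ s ∈ Ioc r (r + 1), ‖f r‖ ≤ ‖f s‖ + ∫ t in Ioc r (r + 1), ‖h t‖ := by
    intro s hs
    calc ‖f r‖ ≤ ‖f s‖ + ‖f s - f r‖ := by simpa using _root_.norm_sub_le (f s) (f s - f r)
      _ ≤ ‖f s‖ + ∫ t in Ioc r (r + 1), ‖h t‖ := by
          gcongr
          exact (hf.norm_sub_le hr0 hs.1.le).trans (setIntegral_mono_set hh_int
            (ae_of_all _ fun _ => norm_nonneg _) (Ioc_subset_Ioc_right hs.2).eventuallyLE)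
  calc ‖f r‖ = ∫ _ in Ioc r (r + 1), ‖f r‖ := by simp
    _ ≤ ∫ s in Ioc r (r + 1), (‖f s‖ + ∫ t in Ioc r (r + 1), ‖h t‖) :=
        setIntegral_mono_on (h_const _) (hf_int.add (h_const _)) measurableSet_Ioc h_compare
    _ = (∫ s in Ioc r (r + 1), ‖f s‖) + ∫ t in Ioc r (r + 1), ‖h t‖ := by
        rw [integral_add hf_int (h_const _)]
        simp
    _ ≤ _ := add_le_add (setIntegral_Ioc_add_one_norm_le hf_loc hf.integrableOn_sq hr)
        (setIntegral_Ioc_add_one_norm_le hf.locallyIntegrableOn hf.integrableOn_deriv_sq hr)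

end IsRadialProfile

theorem integrableOn_Ioc_pow_mul_rpow (hfc : ContinuousOn f (Ioi 0)) {β q C : ℝ} (hq : 0 < q)
    (hβ : q * β < m + 1) (hC : 0 ≤ C) (h_le : ∀ r, 0 < r → r ≤ 1 → ‖f r‖ ≤ C * r ^ (-β)) :
    IntegrableOn (fun r : ℝ => r ^ m * ‖f r‖ ^ q) (Ioc 0 1) := by
  have h_cont : ContinuousOn (fun r : ℝ => r ^ m * ‖f r‖ ^ q) (Ioc 0 1) :=
    (continuousOn_id.pow m).mul
      ((hfc.mono Ioc_subset_Ioi_self).norm.rpow_const fun _ _ => Or.inr hq.le)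
  have h_dom : IntegrableOn (fun r : ℝ => C ^ q * r ^ ((m : ℝ) - q * β)) (Ioc 0 1) :=
    ((intervalIntegrable_iff_integrableOn_Ioc_of_le zero_le_one).1
      (intervalIntegral.intervalIntegrable_rpow' (by linarith))).const_mul _
  refine h_dom.mono' (h_cont.aestronglyMeasurable measurableSet_Ioc) ?_
  filter_upwards [ae_restrict_mem measurableSet_Ioc] with r hr
  have hr0 : 0 < r := hr.1
  rw [Real.norm_of_nonneg (by positivity)]
  calc r ^ m * ‖f r‖ ^ q ≤ r ^ m * (C * r ^ (-β)) ^ q := by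
        gcongr
        exact h_le r hr0 hr.2
    _ = C ^ q * (r ^ (m : ℝ) * r ^ (-β * q)) := by
        rw [Real.mul_rpow hC (by positivity), ← Real.rpow_mul hr0.le, Real.rpow_natCast]
        ring
    _ = _ := by
        rw [← Real.rpow_add hr0]
        ring_nf

theorem integrableOn_Ioi_one_pow_mul_rpow (hfc : ContinuousOn f (Ioi 0))
    (hf2 : IntegrableOn (fun r : ℝ => r ^ m * ‖f r‖ ^ 2) (Ioi 0)) {p C : ℝ} (hp : 0 < p)
    (h_le : ∀ r, 1 ≤ r → ‖f r‖ ≤ C) :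
    IntegrableOn (fun r : ℝ => r ^ m * ‖f r‖ ^ (p + 2)) (Ioi 1) := by
  have hsub : Ioi (1 : ℝ) ⊆ Ioi 0 := Ioi_subset_Ioi zero_le_one
  have h_cont : ContinuousOn (fun r : ℝ => r ^ m * ‖f r‖ ^ (p + 2)) (Ioi 1) :=
    (continuousOn_id.pow m).mul ((hfc.mono hsub).norm.rpow_const fun _ _ => Or.inr (by linarith))
  refine ((hf2.mono_set hsub).const_mul (C ^ p)).mono'
    (h_cont.aestronglyMeasurable measurableSet_Ioi) ?_
  filter_upwards [ae_restrict_mem measurableSet_Ioi] with r (hr : 1 < r)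
  have : 0 < r := by linarith
  rw [Real.norm_of_nonneg (by positivity), Real.rpow_add' (norm_nonneg _) (by linarith),
    Real.rpow_two]
  calc r ^ m * (‖f r‖ ^ p * ‖f r‖ ^ 2) ≤ r ^ m * (C ^ p * ‖f r‖ ^ 2) := by
        gcongr
        exact h_le r hr.le
    _ = _ := by ring

/-- `β` is a rate of blow-up above the critical one `(d - 2) / 2` for which the nonlinearity still
gains a positive power of `r`. -/
theorem exists_admissible_exponent {d : ℕ} (hd : 2 ≤ d) {p : ℝ} (hp : 0 < p)
    (hp_sub : 3 ≤ d → p < 4 / ((d : ℝ) - 2)) :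
    ∃ β > 0, ((d : ℝ) - 2) / 2 < β ∧ (p + 2) * β < d := by
  have hd2 : (2 : ℝ) ≤ d := by exact_mod_cast hd
  have h_sub : p * ((d : ℝ) - 2) < 4 := by
    rcases hd.lt_or_eq with h | rfl
    · have hd3 : (2 : ℝ) < d := by exact_mod_cast h
      exact (lt_div_iff₀ (by linarith)).1 (hp_sub h)
    · norm_num
  have h_lt : ((d : ℝ) - 2) / 2 < d / (p + 2) := by
    rw [div_lt_div_iff₀ two_pos (by linarith)]
    linarith
  obtain ⟨β, hβ, hβ'⟩ := exists_between h_lt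
  exact ⟨β, by linarith, hβ, by rwa [mul_comm, ← lt_div_iff₀ (by linarith)]⟩

end ProfileBounds

section Coefficients

theorem continuous_ite_eq {X Y : Type*} [TopologicalSpace X] [T1Space X] [TopologicalSpace Y]
    [DecidableEq X] {f : X → Y} {a : X} {y : Y} (hf : ContinuousOn f {a}ᶜ)
    (ha : Tendsto f (𝓝[≠] a) (𝓝 y)) : Continuous fun x => if x = a then y else f x := by
  have h_update : (fun x => if x = a then y else f x) = Function.update f a y := by
    ext x
    rw [Function.update_apply]
  rw [h_update, continuous_iff_continuousAt]
  intro x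
  rcases eq_or_ne x a with rfl | hx
  · exact continuousAt_update_same.2 ha
  · exact (continuousAt_update_of_ne hx).2 (hf.continuousAt (isOpen_compl_singleton.mem_nhds hx))

theorem tendsto_nhdsNE_zero_of_continuous {k : ℝ → ℝ} (hk : Continuous k) (h0 : k 0 = 0) :
    Tendsto k (𝓝[≠] 0) (𝓝 0) :=
  (hk.tendsto' 0 0 h0).mono_left nhdsWithin_le_nhds

theorem tendsto_div_sinh : Tendsto (fun r : ℝ => r / Real.sinh r) (𝓝[≠] 0) (𝓝 1) := by
  have h_slope := (Real.hasDerivAt_sinh 0).tendsto_slope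
  rw [Real.cosh_zero] at h_slope
  refine (inv_one (G := ℝ) ▸ h_slope.inv₀ one_ne_zero).congr fun r => ?_
  simp [slope_def_field]

theorem tendsto_cosh_sub_one_div_sq :
    Tendsto (fun r : ℝ => (Real.cosh r - 1) / r ^ 2) (𝓝[≠] 0) (𝓝 (1 / 2)) := by
  have h_quot : Tendsto (fun r : ℝ => Real.sinh r / (2 * r)) (𝓝[≠] 0) (𝓝 (1 / 2)) := by
    have h_lim := (tendsto_div_sinh.inv₀ one_ne_zero).const_mul (1 / 2)
    rw [inv_one, mul_one] at h_lim
    refine h_lim.congr fun r => ?_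
    rw [inv_div, div_mul_div_comm, one_mul]
  refine HasDerivAt.lhopital_zero_nhdsNE (f' := Real.sinh) (g' := fun r => 2 * r)
    (Eventually.of_forall fun r => (Real.hasDerivAt_cosh r).sub_const 1)
    (Eventually.of_forall fun r => by simpa using hasDerivAt_pow 2 r) ?_
    (tendsto_nhdsNE_zero_of_continuous (by fun_prop) (by simp))
    (tendsto_nhdsNE_zero_of_continuous (by fun_prop) (by simp)) h_quot
  filter_upwards [self_mem_nhdsWithin] with r hr using mul_ne_zero two_ne_zero hr

theorem tendsto_sinh_sub_self_div_cube :
    Tendsto (fun r : ℝ => (Real.sinh r - r) / r ^ 3) (𝓝[≠] 0) (𝓝 (1 / 6)) := by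
  have h_quot : Tendsto (fun r : ℝ => (Real.cosh r - 1) / (3 * r ^ 2)) (𝓝[≠] 0) (𝓝 (1 / 6)) := by
    have h_lim := tendsto_cosh_sub_one_div_sq.const_mul (1 / 3)
    rw [show (1 / 3 : ℝ) * (1 / 2) = 1 / 6 by norm_num] at h_lim
    refine h_lim.congr fun r => ?_
    rw [div_mul_div_comm, one_mul]
  refine HasDerivAt.lhopital_zero_nhdsNE (f' := fun r => Real.cosh r - 1)
    (g' := fun r => 3 * r ^ 2)
    (Eventually.of_forall fun r => (Real.hasDerivAt_sinh r).sub (hasDerivAt_id r))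
    (Eventually.of_forall fun r => by simpa using hasDerivAt_pow 3 r) ?_
    (tendsto_nhdsNE_zero_of_continuous (by fun_prop) (by simp))
    (tendsto_nhdsNE_zero_of_continuous (by fun_prop) (by simp)) h_quot
  filter_upwards [self_mem_nhdsWithin] with r hr using mul_ne_zero three_ne_zero (pow_ne_zero _ hr)

/-- The ratio `r / sinh r` in the definition of `weight`, continuously extended to `r = 0`. -/
def sinhRatio (r : ℝ) : ℝ := if r = 0 then 1 else r / Real.sinh r

theorem sinhRatio_pos (r : ℝ) : 0 < sinhRatio r := by
  unfold sinhRatio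
  split_ifs with h
  · exact one_pos
  · rcases lt_or_gt_of_ne h with h | h
    · exact div_pos_of_neg_of_neg h (Real.sinh_neg_iff.2 h)
    · exact div_pos h (Real.sinh_pos_iff.2 h)

theorem sinhRatio_le_one {r : ℝ} (hr : 0 ≤ r) : sinhRatio r ≤ 1 := by
  unfold sinhRatio
  split_ifs
  · exact le_rfl
  · exact div_le_one_of_le₀ (Real.self_le_sinh_iff.2 hr) (Real.sinh_nonneg_iff.2 hr)

theorem continuous_sinhRatio : Continuous sinhRatio :=
  continuous_ite_eq (continuousOn_id.div Real.continuous_sinh.continuousOn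
    fun _ hr => Real.sinh_ne_zero.2 hr) tendsto_div_sinh

theorem continuous_weight (d : ℕ) (p : ℝ) : Continuous (weight d p) :=
  continuous_const.mul (continuous_sinhRatio.rpow_const fun r => Or.inl (sinhRatio_pos r).ne')

theorem weight_pos (d : ℕ) {p : ℝ} (hp : 0 ≤ p) (r : ℝ) : 0 < weight d p r :=
  mul_pos (by positivity) (Real.rpow_pos_of_pos (sinhRatio_pos r) _)

theorem weight_le_one {d : ℕ} (hd : 1 ≤ d) {p : ℝ} (hp : 0 ≤ p) {r : ℝ} (hr : 0 ≤ r) :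
    weight d p r ≤ 1 := by
  have hd1 : (1 : ℝ) ≤ d := by exact_mod_cast hd
  have h_coeff : 1 / (p + 2) ≤ 1 := by
    rw [div_le_one (by linarith)]
    linarith
  exact mul_le_one₀ h_coeff (Real.rpow_nonneg (sinhRatio_pos r).le _)
    (Real.rpow_le_one (sinhRatio_pos r).le (sinhRatio_le_one hr)
      (div_nonneg (mul_nonneg (by linarith) hp) two_pos.le))

/-- The factor `(r² - sinh² r) / (r² sinh² r)` of `potential`, continuously extended to `r = 0`. -/
def potentialCore (r : ℝ) : ℝ :=
  if r = 0 then -(1 / 3) else (r ^ 2 - Real.sinh r ^ 2) / (r ^ 2 * Real.sinh r ^ 2)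

theorem continuous_potentialCore : Continuous potentialCore := by
  have h_pos : ∀ r ∈ ({0}ᶜ : Set ℝ), r ^ 2 * Real.sinh r ^ 2 ≠ 0 := fun r hr =>
    mul_ne_zero (pow_ne_zero 2 hr) (pow_ne_zero 2 (Real.sinh_ne_zero.2 hr))
  refine continuous_ite_eq (ContinuousOn.div (by fun_prop) (by fun_prop) h_pos) ?_
  have h_lim := ((tendsto_sinh_sub_self_div_cube.mul
    ((tendsto_div_sinh.inv₀ one_ne_zero).add_const 1)).mul (tendsto_div_sinh.pow 2)).neg
  rw [show -(1 / 6 * ((1 : ℝ)⁻¹ + 1) * 1 ^ 2) = -(1 / 3) by norm_num] at h_lim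
  refine h_lim.congr' ?_
  filter_upwards [self_mem_nhdsWithin] with r (hr : r ≠ 0)
  have h_sinh : Real.sinh r ≠ 0 := Real.sinh_ne_zero.2 hr
  field

theorem abs_potentialCore_le {r : ℝ} (hr : 0 < r) : |potentialCore r| ≤ (r ^ 2)⁻¹ := by
  have h_sinh : r ≤ Real.sinh r := Real.self_le_sinh_iff.2 hr.le
  have : 0 < Real.sinh r := hr.trans_le h_sinh
  have h_eq : potentialCore r = (Real.sinh r ^ 2)⁻¹ - (r ^ 2)⁻¹ := by
    rw [potentialCore, if_neg hr.ne']
    field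
  have h_le : (Real.sinh r ^ 2)⁻¹ ≤ (r ^ 2)⁻¹ := by gcongr
  have h_nonneg : 0 ≤ (Real.sinh r ^ 2)⁻¹ := by positivity
  rw [h_eq, abs_le]
  constructor <;> linarith

theorem continuous_potential (d : ℕ) : Continuous (potential d) :=
  continuous_const.mul continuous_potentialCore

theorem tendsto_potential_atTop (d : ℕ) : Tendsto (potential d) atTop (𝓝 0) := by
  have h_core : Tendsto potentialCore atTop (𝓝 0) := by
    refine squeeze_zero_norm' (a := fun r : ℝ => (r ^ 2)⁻¹) ?_
      (tendsto_pow_atTop two_ne_zero).inv_tendsto_atTop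
    filter_upwards [eventually_gt_atTop 0] with r hr using abs_potentialCore_le hr
  simpa only [mul_zero] using! h_core.const_mul (((d : ℝ) - 1) * ((d : ℝ) - 3) / 4)

theorem exists_abs_potential_le (d : ℕ) : ∃ C, 0 ≤ C ∧ ∀ r, 0 ≤ r → |potential d r| ≤ C := by
  obtain ⟨R, hR⟩ := eventually_atTop.1
    ((tendsto_potential_atTop d).norm.eventually_lt_const (show ‖(0 : ℝ)‖ < 1 by simp))
  obtain ⟨C, hC⟩ := (isCompact_Icc (a := (0 : ℝ)) (b := R)).exists_bound_of_continuousOn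
    (continuous_potential d).continuousOn
  refine ⟨max C 1, by positivity, fun r hr => ?_⟩
  rcases le_total r R with h | h
  · exact (hC r ⟨hr, h⟩).trans (le_max_left _ _)
  · exact (hR r h).le.trans (le_max_right _ _)

end Coefficients

section ConstrainedVariation

variable {E : Type*} [NormedAddCommGroup E] [InnerProductSpace ℝ E]

theorem norm_add_smul_sq (a b : E) (t : ℝ) :
    ‖a + t • b‖ ^ 2 = ‖a‖ ^ 2 + t * (2 * inner ℝ a b) + t ^ 2 * ‖b‖ ^ 2 := by
  rw [norm_add_sq_real, inner_smul_right, norm_smul, mul_pow, Real.norm_eq_abs, sq_abs]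
  ring

theorem hasDerivAt_norm_add_smul_rpow {q : ℝ} (hq : 1 < q) (a b : E) (t : ℝ) :
    HasDerivAt (fun t : ℝ => ‖a + t • b‖ ^ q)
      (q * (‖a + t • b‖ ^ (q - 2) * inner ℝ (a + t • b) b)) t := by
  have h_line : HasDerivAt (fun t : ℝ => a + t • b) b t := by
    simpa using ((hasDerivAt_id t).smul_const b).const_add a
  refine ((hasFDerivAt_norm_rpow (a + t • b) hq).comp_hasDerivAt t h_line).congr_deriv ?_
  simp only [smul_apply, innerSL_apply_apply, smul_eq_mul]
  ring

theorem norm_rpow_mul_inner_le {p : ℝ} (hp : 0 ≤ p) (a b : E) {t : ℝ} (ht : |t| ≤ 1) :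
    |‖a + t • b‖ ^ p * inner ℝ (a + t • b) b|
      ≤ 2 ^ (p + 1) * (‖a‖ ^ (p + 2) + ‖b‖ ^ (p + 2)) := by
  have h_norm : ‖a + t • b‖ ≤ ‖a‖ + ‖b‖ := by
    refine (norm_add_le _ _).trans ?_
    rw [norm_smul, Real.norm_eq_abs]
    gcongr
    exact mul_le_of_le_one_left (norm_nonneg _) ht
  have h_inner : |inner ℝ (a + t • b) b| ≤ (‖a‖ + ‖b‖) ^ 2 := by
    refine (abs_real_inner_le_norm _ _).trans ?_
    rw [sq]
    gcongr
    exact le_add_of_nonneg_left (norm_nonneg a)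
  have h_convex : (‖a‖ + ‖b‖) ^ (p + 2) ≤ 2 ^ (p + 1) * (‖a‖ ^ (p + 2) + ‖b‖ ^ (p + 2)) := by
    have := NNReal.rpow_add_le_mul_rpow_add_rpow ‖a‖₊ ‖b‖₊ (p := p + 2) (by linarith)
    rw [show p + 2 - 1 = p + 1 by ring] at this
    exact_mod_cast this
  rw [abs_mul, abs_of_nonneg (Real.rpow_nonneg (norm_nonneg _) _)]
  calc ‖a + t • b‖ ^ p * |inner ℝ (a + t • b) b|
      ≤ (‖a‖ + ‖b‖) ^ p * (‖a‖ + ‖b‖) ^ 2 := by gcongr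
    _ = (‖a‖ + ‖b‖) ^ (p + 2) := by
        rw [Real.rpow_add' (by positivity) (by linarith), Real.rpow_two]
    _ ≤ _ := h_convex

variable {α : Type*} [MeasurableSpace α] {μ : Measure α} {u v : α → E}

theorem integrable_inner_of_memLp_two (hu : MemLp u 2 μ) (hv : MemLp v 2 μ) :
    Integrable (fun x => inner ℝ (u x) (v x)) μ := by
  refine (L2.integrable_inner (𝕜 := ℝ) (hu.toLp u) (hv.toLp v)).congr ?_
  filter_upwards [hu.coeFn_toLp, hv.coeFn_toLp] with x hux hvx
  rw [hux, hvx]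

theorem integral_norm_sq_add_smul (hu : MemLp u 2 μ) (hv : MemLp v 2 μ) (t : ℝ) :
    ∫ x, ‖u x + t • v x‖ ^ 2 ∂μ
      = ∫ x, ‖u x‖ ^ 2 ∂μ + t * (2 * ∫ x, inner ℝ (u x) (v x) ∂μ)
        + t ^ 2 * ∫ x, ‖v x‖ ^ 2 ∂μ := by
  have h_sq := hu.integrable_norm_pow two_ne_zero
  have h_lin := ((integrable_inner_of_memLp_two hu hv).const_mul 2).const_mul t
  simp only [norm_add_smul_sq]
  rw [integral_add (h_sq.fun_add h_lin) ((hv.integrable_norm_pow two_ne_zero).const_mul _),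
    integral_add h_sq h_lin]
  simp only [integral_const_mul]

theorem integral_norm_sq_smul (u : α → E) (s : ℝ) :
    ∫ x, ‖s • u x‖ ^ 2 ∂μ = s ^ 2 * ∫ x, ‖u x‖ ^ 2 ∂μ := by
  simp only [norm_smul, mul_pow, Real.norm_eq_abs, sq_abs, integral_const_mul]

theorem hasDerivAt_quadratic_zero (a b c : ℝ) :
    HasDerivAt (fun t : ℝ => a + t * b + t ^ 2 * c) b 0 := by
  have h_lin : HasDerivAt (fun t : ℝ => a + t * b) b 0 := by
    simpa using ((hasDerivAt_id (0 : ℝ)).mul_const b).const_add a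
  have h_sq : HasDerivAt (fun t : ℝ => t ^ 2 * c) 0 0 := by
    simpa using (hasDerivAt_pow (𝕜 := ℝ) 2 0).mul_const c
  simpa using h_lin.fun_add h_sq

/-- Scaling the competitor at time `t` back to the constraint `M = c` multiplies its energies `Q`
and `N` by powers of `c / M t`; Fermat's rule then produces the Lagrange multiplier. -/
theorem sub_eq_of_isLocalMin_rescaled {M Q N : ℝ → ℝ} {M' Q' N' c a b : ℝ} (hc : c ≠ 0)
    (hM0 : M 0 = c) (hM : HasDerivAt M M' 0) (hQ : HasDerivAt Q Q' 0) (hN : HasDerivAt N N' 0)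
    (hmin : IsLocalMin (fun t => (c / M t) ^ a * Q t - (c / M t) ^ b * N t) 0) :
    Q' - N' = M' / c * (a * Q 0 - b * N 0) := by
  have h_ratio0 : c / M 0 = 1 := by rw [hM0, div_self hc]
  have h_ratio : HasDerivAt (fun t => c / M t) (-(M' / c)) 0 := by
    refine ((hasDerivAt_const (0 : ℝ) c).fun_div hM (by rwa [hM0])).congr_deriv ?_
    rw [hM0]
    field_simp
    ring
  have h_pow (e : ℝ) : HasDerivAt (fun t => (c / M t) ^ e) (-(M' / c) * e) 0 := by
    refine (h_ratio.rpow_const (Or.inl (by rw [h_ratio0]; exact one_ne_zero))).congr_deriv ?_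
    rw [h_ratio0, Real.one_rpow, mul_one]
  have h_crit := hmin.hasDerivAt_eq_zero (((h_pow a).mul hQ).sub ((h_pow b).mul hN))
  simp only [h_ratio0, Real.one_rpow, one_mul] at h_crit
  linear_combination h_crit

end ConstrainedVariation

section EulerLagrange

variable {𝕜 : Type*} [RCLike 𝕜] {d : ℕ} {p : ℝ} {u v : Space d → 𝕜} {G H : Fin d → Space d → 𝕜}

theorem MemH1WithGradient.add (hu : MemH1WithGradient u G) (hv : MemH1WithGradient v H) :
    MemH1WithGradient (fun x => u x + v x) (fun i x => G i x + H i x) where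
  memLp := hu.memLp.add hv.memLp
  memLp_gradient i := (hu.memLp_gradient i).add (hv.memLp_gradient i)
  isWeakGradient φ hφ hc i := by
    have h_int {g : Space d → 𝕜} (hg : MemLp g 2 volume) := integrable_smul_of_memLp_two hg
      (continuous_fderiv_apply hφ _)
      (hc.fderiv_apply (𝕜 := ℝ) (EuclideanSpace.single i (1 : ℝ)))
    have h_int' {g : Space d → 𝕜} (hg : MemLp g 2 volume) :=
      integrable_smul_of_memLp_two hg hφ.continuous hc
    simp only [smul_add]
    rw [integral_add (h_int hu.memLp) (h_int hv.memLp),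
      integral_add (h_int' (hu.memLp_gradient i)) (h_int' (hv.memLp_gradient i)),
      hu.isWeakGradient φ hφ hc i, hv.isWeakGradient φ hφ hc i, neg_add]

theorem MemH1WithGradient.smul (hu : MemH1WithGradient u G) (s : ℝ) :
    MemH1WithGradient (fun x => s • u x) (fun i x => s • G i x) where
  memLp := hu.memLp.const_smul s
  memLp_gradient i := (hu.memLp_gradient i).const_smul s
  isWeakGradient φ hφ hc i := by
    have h_comm (a : ℝ) (b : 𝕜) : a • s • b = s • a • b := smul_comm _ _ _
    simp only [h_comm, integral_smul]
    rw [hu.isWeakGradient φ hφ hc i, smul_neg]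

theorem nonlinearTerm_smul (p : ℝ) (u : Space d → 𝕜) {s : ℝ} (hs : 0 ≤ s) :
    nonlinearTerm d p (fun x => s • u x) = s ^ (p + 2) * nonlinearTerm d p u := by
  unfold nonlinearTerm
  rw [← integral_const_mul]
  congr 1 with x
  rw [norm_smul, Real.norm_of_nonneg hs, Real.mul_rpow hs (norm_nonneg _)]
  ring

theorem quadraticTerm_smul (c : ℝ → ℝ) (u : Space d → 𝕜) (G : Fin d → Space d → 𝕜) (s : ℝ) :
    quadraticTerm d c (fun x => s • u x) (fun i x => s • G i x)
      = s ^ 2 * quadraticTerm d c u G := by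
  unfold quadraticTerm
  rw [← integral_const_mul]
  congr 1 with x
  simp only [norm_smul, mul_pow, Real.norm_eq_abs, sq_abs, ← Finset.mul_sum]
  ring

/-- A continuous coefficient that is bounded on `[0, ∞)`, where it is evaluated at `‖x‖`. -/
structure IsBoundedCoefficient (c : ℝ → ℝ) : Prop where
  continuous : Continuous c
  exists_bound : ∃ C, ∀ r, 0 ≤ r → |c r| ≤ C

theorem isBoundedCoefficient_weight (hd : 1 ≤ d) (hp : 0 ≤ p) :
    IsBoundedCoefficient (weight d p) where
  continuous := continuous_weight d p
  exists_bound := ⟨1, fun r hr => by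
    rw [abs_of_pos (weight_pos d hp r)]; exact weight_le_one hd hp hr⟩

theorem isBoundedCoefficient_const_add_potential (d : ℕ) (a : ℝ) :
    IsBoundedCoefficient fun r => a + potential d r where
  continuous := continuous_const.add (continuous_potential d)
  exists_bound := by
    obtain ⟨C, -, hC⟩ := exists_abs_potential_le d
    exact ⟨|a| + C, fun r hr => (abs_add_le _ _).trans (by gcongr; exact hC r hr)⟩

theorem isBoundedCoefficient_potential (d : ℕ) : IsBoundedCoefficient (potential d) := by
  simpa using isBoundedCoefficient_const_add_potential d 0

theorem IsBoundedCoefficient.integrable_mul {X : Type*} [NormedAddCommGroup X] [MeasurableSpace X]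
    [OpensMeasurableSpace X] {μ : Measure X} {c : ℝ → ℝ} (hc : IsBoundedCoefficient c) {F : X → ℝ}
    (hF : Integrable F μ) : Integrable (fun x => c ‖x‖ * F x) μ := by
  obtain ⟨C, hC⟩ := hc.exists_bound
  exact hF.bdd_mul (hc.continuous.measurable.comp measurable_norm).aestronglyMeasurable
    (ae_of_all _ fun x => hC _ (norm_nonneg x))

/-- The first variation of `quadraticTerm`: the symmetric bilinear form
`∫ (Re ⟨∇u, ∇v⟩ + c(|x|) Re ⟨u, v⟩) dx`, where `G = ∇u` and `H = ∇v`. -/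
def quadraticForm (c : ℝ → ℝ) (u v : Space d → 𝕜) (G H : Fin d → Space d → 𝕜) : ℝ :=
  ∫ x, (∑ i, inner ℝ (G i x) (H i x) + c ‖x‖ * inner ℝ (u x) (v x))

theorem integrable_sum_inner (hG : ∀ i, MemLp (G i) 2 volume) (hH : ∀ i, MemLp (H i) 2 volume) :
    Integrable fun x => ∑ i, inner ℝ (G i x) (H i x) :=
  integrable_finsetSum _ fun i _ => integrable_inner_of_memLp_two (hG i) (hH i)

theorem integrable_quadraticTerm {c : ℝ → ℝ} (hc : IsBoundedCoefficient c)
    (hu : MemH1WithGradient u G) :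
    Integrable fun x => 1 / 2 * ∑ i, ‖G i x‖ ^ 2 + 1 / 2 * c ‖x‖ * ‖u x‖ ^ 2 := by
  have h_grad : Integrable fun x => ∑ i, ‖G i x‖ ^ 2 :=
    integrable_finsetSum _ fun i _ => (hu.memLp_gradient i).integrable_norm_pow two_ne_zero
  simpa only [mul_assoc] using (h_grad.const_mul (1 / 2)).fun_add
    ((hc.integrable_mul (hu.memLp.integrable_norm_pow two_ne_zero)).const_mul (1 / 2))

theorem quadraticTerm_add_smul {c : ℝ → ℝ} (hc : IsBoundedCoefficient c)
    (hu : MemH1WithGradient u G) (hv : MemH1WithGradient v H) (t : ℝ) :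
    quadraticTerm d c (fun x => u x + t • v x) (fun i x => G i x + t • H i x)
      = quadraticTerm d c u G + t * quadraticForm c u v G H + t ^ 2 * quadraticTerm d c v H := by
  have h_u := integrable_quadraticTerm hc hu
  have h_cross := ((integrable_sum_inner hu.memLp_gradient hv.memLp_gradient).fun_add
    (hc.integrable_mul (integrable_inner_of_memLp_two hu.memLp hv.memLp))).const_mul t
  have h_v := (integrable_quadraticTerm hc hv).const_mul (t ^ 2)
  unfold quadraticTerm quadraticForm
  rw [← integral_const_mul, ← integral_const_mul, ← integral_add h_u h_cross,
    ← integral_add (h_u.fun_add h_cross) h_v]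
  congr 1 with x
  simp only [norm_add_smul_sq, Finset.sum_add_distrib, ← Finset.mul_sum]
  ring

theorem hasDerivAt_quadraticTerm {c : ℝ → ℝ} (hc : IsBoundedCoefficient c)
    (hu : MemH1WithGradient u G) (hv : MemH1WithGradient v H) :
    HasDerivAt (fun t : ℝ => quadraticTerm d c (fun x => u x + t • v x)
      (fun i x => G i x + t • H i x)) (quadraticForm c u v G H) 0 := by
  simpa only [quadraticTerm_add_smul hc hu hv] using hasDerivAt_quadratic_zero _ _ _

/-- The first variation of `nonlinearTerm`, up to the factor `p + 2`:
`∫ K(|x|) |u|^p Re ⟨u, v⟩ dx`. -/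
def nonlinearForm (d : ℕ) (p : ℝ) (u v : Space d → 𝕜) : ℝ :=
  ∫ x, weight d p ‖x‖ * (‖u x‖ ^ p * inner ℝ (u x) (v x))

theorem hasDerivAt_nonlinearTerm (hd : 1 ≤ d) (hp : 0 ≤ p)
    (hum : AEStronglyMeasurable u volume) (hvm : AEStronglyMeasurable v volume)
    (hu : Integrable fun x => ‖u x‖ ^ (p + 2)) (hv : Integrable fun x => ‖v x‖ ^ (p + 2)) :
    HasDerivAt (fun t : ℝ => nonlinearTerm d p fun x => u x + t • v x)
      ((p + 2) * nonlinearForm d p u v) 0 := by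
  have h_weight := isBoundedCoefficient_weight hd hp
  have h_weight_meas : AEStronglyMeasurable (fun x : Space d => weight d p ‖x‖) volume :=
    ((continuous_weight d p).comp continuous_norm).aestronglyMeasurable
  have h_meas (t : ℝ) : AEStronglyMeasurable (fun x => u x + t • v x) volume :=
    hum.add (hvm.const_smul t)
  have h_rpow_meas (t q : ℝ) : AEStronglyMeasurable (fun x => ‖u x + t • v x‖ ^ q) volume :=
    ((h_meas t).norm.aemeasurable.pow_const q).aestronglyMeasurable
  have h_deriv_le (x : Space d) (t : ℝ) (ht : t ∈ Metric.ball (0 : ℝ) 1) :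
      ‖weight d p ‖x‖ * ((p + 2) * (‖u x + t • v x‖ ^ p * inner ℝ (u x + t • v x) (v x)))‖
        ≤ weight d p ‖x‖ * ((p + 2) * (2 ^ (p + 1) * (‖u x‖ ^ (p + 2) + ‖v x‖ ^ (p + 2)))) := by
    have : 0 < weight d p ‖x‖ := weight_pos d hp _
    rw [Real.norm_eq_abs, abs_mul, abs_of_pos this, abs_mul, abs_of_pos (by linarith : 0 < p + 2)]
    gcongr
    exact norm_rpow_mul_inner_le hp _ _ (mem_ball_zero_iff.1 ht).le
  have h_deriv (x : Space d) (t : ℝ) := (hasDerivAt_norm_add_smul_rpow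
    (by linarith : 1 < p + 2) (u x) (v x) t).const_mul (weight d p ‖x‖)
  simp only [add_sub_cancel_right] at h_deriv
  refine (hasDerivAt_integral_of_dominated_loc_of_deriv_le
    (Metric.ball_mem_nhds _ one_pos) (Eventually.of_forall fun t =>
      h_weight_meas.mul (h_rpow_meas t _)) (by simpa [Pi.mul_def] using h_weight.integrable_mul hu)
    (h_weight_meas.mul (((h_rpow_meas 0 p).mul ((h_meas 0).inner hvm)).const_mul _))
    (ae_of_all _ h_deriv_le)
    (h_weight.integrable_mul (((hu.add hv).const_mul _).const_mul _))
    (ae_of_all _ fun x t _ => h_deriv x t)).2.congr_deriv ?_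
  rw [nonlinearForm, ← integral_const_mul]
  congr 1 with x
  simp only [zero_smul, add_zero]
  ring

theorem nonlinearTerm_nonneg (hp : 0 ≤ p) (u : Space d → 𝕜) : 0 ≤ nonlinearTerm d p u :=
  integral_nonneg fun _ => mul_nonneg (weight_pos d hp _).le (Real.rpow_nonneg (norm_nonneg _) _)

theorem nonlinearTerm_pos (hd : 1 ≤ d) (hp : 0 ≤ p)
    (hu : Integrable fun x => ‖u x‖ ^ (p + 2)) (h : 0 < ∫ x, ‖u x‖ ^ 2) :
    0 < nonlinearTerm d p u := by
  refine (nonlinearTerm_nonneg hp u).lt_of_ne fun h_zero => h.ne' ?_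
  have h_ae := (integral_eq_zero_iff_of_nonneg (fun _ => mul_nonneg (weight_pos d hp _).le
    (Real.rpow_nonneg (norm_nonneg _) _))
    ((isBoundedCoefficient_weight hd hp).integrable_mul hu)).1 h_zero.symm
  refine integral_eq_zero_of_ae ?_
  filter_upwards [h_ae] with x hx
  simpa [(weight_pos d hp ‖x‖).ne', Real.rpow_eq_zero (norm_nonneg (u x))
    (by linarith : p + 2 ≠ 0)] using hx

theorem eulerLagrange_of_min_on_mass {c : ℝ → ℝ} (hc : IsBoundedCoefficient c) (hd : 1 ≤ d)
    (hp : 0 ≤ p) {lam : ℝ} (hlam : 0 < lam) (hu : MemH1WithGradient u G)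
    (hu_mass : ∫ x, ‖u x‖ ^ 2 = lam)
    (hmin : ∀ (v : Space d → 𝕜) (H : Fin d → Space d → 𝕜), MemH1WithGradient v H →
      ∫ x, ‖v x‖ ^ 2 = lam →
        quadraticTerm d c u G - nonlinearTerm d p u ≤ quadraticTerm d c v H - nonlinearTerm d p v)
    (hup : Integrable fun x => ‖u x‖ ^ (p + 2)) (hv : MemH1WithGradient v H)
    (hvp : Integrable fun x => ‖v x‖ ^ (p + 2)) :
    quadraticForm c u v G H
      + ((p + 2) * nonlinearTerm d p u - 2 * quadraticTerm d c u G) / lam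
        * ∫ x, inner ℝ (u x) (v x) = (p + 2) * nonlinearForm d p u v := by
  set M : ℝ → ℝ := fun t => ∫ x, ‖u x + t • v x‖ ^ 2 with hM
  have hM0 : M 0 = lam := by simpa [hM] using hu_mass
  have hM' : HasDerivAt M (2 * ∫ x, inner ℝ (u x) (v x)) 0 := by
    simpa only [hM, integral_norm_sq_add_smul hu.memLp hv.memLp] using
      hasDerivAt_quadratic_zero _ _ _
  have h_crit := sub_eq_of_isLocalMin_rescaled (a := 1) (b := (p + 2) / 2) hlam.ne' hM0 hM'
    (hasDerivAt_quadraticTerm hc hu hv) (hasDerivAt_nonlinearTerm hd hp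
      hu.memLp.aestronglyMeasurable hv.memLp.aestronglyMeasurable hup hvp) (by
    filter_upwards [hM'.continuousAt.eventually (lt_mem_nhds (by rwa [hM0]))] with t ht
    have h_ratio : 0 ≤ lam / M t := div_nonneg hlam.le ht.le
    have h_mass : ∫ x, ‖√(lam / M t) • (u x + t • v x)‖ ^ 2 = lam := by
      rw [integral_norm_sq_smul (fun x => u x + t • v x), Real.sq_sqrt h_ratio]
      exact div_mul_cancel₀ _ ht.ne'
    have h_le := hmin _ _ ((hu.add (hv.smul t)).smul √(lam / M t)) h_mass
    rw [quadraticTerm_smul c (fun x => u x + t • v x) (fun i x => G i x + t • H i x),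
      nonlinearTerm_smul p (fun x => u x + t • v x) (Real.sqrt_nonneg _), Real.sq_sqrt h_ratio,
      ← Real.rpow_div_two_eq_sqrt _ h_ratio] at h_le
    simpa [hM0, hlam.ne'] using h_le)
  simp only [zero_smul, add_zero] at h_crit
  linear_combination h_crit

theorem eulerLagrange_of_min_on_nonlinearTerm {c : ℝ → ℝ} (hc : IsBoundedCoefficient c)
    (hd : 1 ≤ d) (hp : 0 ≤ p) {lam : ℝ} (hlam : 0 < lam) (hu : MemH1WithGradient u G)
    (hu_lam : nonlinearTerm d p u = lam)
    (hmin : ∀ (v : Space d → 𝕜) (H : Fin d → Space d → 𝕜), MemH1WithGradient v H →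
      nonlinearTerm d p v = lam → quadraticTerm d c u G ≤ quadraticTerm d c v H)
    (hup : Integrable fun x => ‖u x‖ ^ (p + 2)) (hv : MemH1WithGradient v H)
    (hvp : Integrable fun x => ‖v x‖ ^ (p + 2)) :
    quadraticForm c u v G H = 2 * quadraticTerm d c u G / lam * nonlinearForm d p u v := by
  set N : ℝ → ℝ := fun t => nonlinearTerm d p fun x => u x + t • v x with hN
  have hN0 : N 0 = lam := by simpa [hN] using hu_lam
  have hN' : HasDerivAt N ((p + 2) * nonlinearForm d p u v) 0 := hasDerivAt_nonlinearTerm hd hp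
    hu.memLp.aestronglyMeasurable hv.memLp.aestronglyMeasurable hup hvp
  have hp2 : p + 2 ≠ 0 := by linarith
  have h_crit := sub_eq_of_isLocalMin_rescaled (a := 2 / (p + 2)) (b := 0) hlam.ne' hN0 hN'
    (hasDerivAt_quadraticTerm hc hu hv) (hasDerivAt_const (0 : ℝ) (0 : ℝ)) (by
    filter_upwards [hN'.continuousAt.eventually (lt_mem_nhds (by rwa [hN0]))] with t ht
    have h_ratio : 0 ≤ lam / N t := div_nonneg hlam.le ht.le
    set s : ℝ := (lam / N t) ^ (1 / (p + 2)) with hs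
    have hs_nonneg : 0 ≤ s := Real.rpow_nonneg h_ratio _
    have h_constraint : nonlinearTerm d p (fun x => s • (u x + t • v x)) = lam := by
      rw [nonlinearTerm_smul p (fun x => u x + t • v x) hs_nonneg, hs, ← Real.rpow_mul h_ratio,
        one_div_mul_cancel hp2, Real.rpow_one]
      exact div_mul_cancel₀ _ ht.ne'
    have hs_sq : s ^ 2 = (lam / N t) ^ (2 / (p + 2)) := by
      rw [hs, ← Real.rpow_mul_natCast h_ratio, Nat.cast_ofNat, one_div_mul_eq_div]
    have h_le := hmin _ _ ((hu.add (hv.smul t)).smul s) h_constraint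
    rw [quadraticTerm_smul c (fun x => u x + t • v x) (fun i x => G i x + t • H i x), hs_sq] at h_le
    simpa [hN0, hlam.ne'] using h_le)
  simp only [zero_smul, add_zero, sub_zero, mul_zero] at h_crit
  rw [h_crit]
  field_simp

end EulerLagrange

section WeakSolution

variable {𝕜 : Type*} [RCLike 𝕜] {d : ℕ}

theorem tendsto_integral_comp_mul_norm {E : Type*} [NormedAddCommGroup E] [MeasurableSpace E]
    [OpensMeasurableSpace E] {μ : Measure E} [NullSingletonClass μ] {c : ℝ → ℝ}
    (hc : IsBoundedCoefficient c) (hc0 : Tendsto c atTop (𝓝 0)) {F : E → ℝ} (hF : Integrable F μ) :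
    Tendsto (fun R : ℝ => ∫ y, c (R * ‖y‖) * F y ∂μ) atTop (𝓝 0) := by
  obtain ⟨C, hC⟩ := hc.exists_bound
  rw [← integral_zero E ℝ]
  refine tendsto_integral_filter_of_dominated_convergence (fun y => C * ‖F y‖)
    (Eventually.of_forall fun R => ?_) ?_ (hF.norm.const_mul C) ?_
  · exact (hc.continuous.measurable.comp
      (measurable_const.mul measurable_norm)).aestronglyMeasurable.mul hF.aestronglyMeasurable
  · filter_upwards [eventually_ge_atTop 0] with R hR
    refine ae_of_all _ fun y => ?_
    rw [norm_mul, Real.norm_eq_abs]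
    gcongr
    exact hC _ (by positivity)
  · filter_upwards [compl_mem_ae_iff.2 (measure_singleton (0 : E))] with y hy
    have h_atTop : Tendsto (fun R : ℝ => R * ‖y‖) atTop atTop :=
      tendsto_id.atTop_mul_const (norm_pos_iff.2 hy)
    simpa using (hc0.comp h_atTop).mul_const (F y)

theorem quadraticTerm_comp_inv_smul (c : ℝ → ℝ) (u : Space d → 𝕜) (G : Fin d → Space d → 𝕜)
    {R : ℝ} (hR : 0 < R) :
    quadraticTerm d c (fun x => u (R⁻¹ • x)) (fun i x => R⁻¹ • G i (R⁻¹ • x))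
      = R ^ d * quadraticTerm d (fun r => c (R * r)) u (fun i x => R⁻¹ • G i x) := by
  have h_dilation := Measure.integral_comp_inv_smul_of_nonneg (volume : Measure (Space d))
    (fun y => 1 / 2 * ∑ i, ‖R⁻¹ • G i y‖ ^ 2 + 1 / 2 * c (R * ‖y‖) * ‖u y‖ ^ 2) hR.le
  rw [finrank_euclideanSpace_fin, smul_eq_mul] at h_dilation
  rw [quadraticTerm, quadraticTerm, ← h_dilation]
  have h_norm (x : Space d) : R * ‖R⁻¹ • x‖ = ‖x‖ := by
    rw [norm_smul, norm_inv, Real.norm_of_nonneg hR.le, mul_inv_cancel_left₀ hR.ne']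
  simp only [h_norm]

theorem tendsto_quadraticTerm_dilation [NeZero d] {c : ℝ → ℝ} (hc : IsBoundedCoefficient c)
    (hc0 : Tendsto c atTop (𝓝 0)) {u : Space d → 𝕜} {G : Fin d → Space d → 𝕜}
    (hu : MemH1WithGradient u G) :
    Tendsto (fun R : ℝ => quadraticTerm d (fun r => c (R * r)) u (fun i x => R⁻¹ • G i x))
      atTop (𝓝 0) := by
  have hu_sq := hu.memLp.integrable_norm_pow two_ne_zero
  have hG_sq : Integrable fun x => ∑ i, ‖G i x‖ ^ 2 :=
    integrable_finsetSum _ fun i _ => (hu.memLp_gradient i).integrable_norm_pow two_ne_zero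
  have h_grad : Tendsto (fun R : ℝ => R⁻¹ ^ 2 * ∫ x, ∑ i, ‖G i x‖ ^ 2) atTop (𝓝 0) := by
    simpa using ((tendsto_inv_atTop_zero (𝕜 := ℝ)).pow 2).mul_const (∫ x, ∑ i, ‖G i x‖ ^ 2)
  have h_mass := tendsto_integral_comp_mul_norm hc hc0 hu_sq
  have h_sum := (h_grad.add h_mass).const_mul (1 / 2)
  rw [add_zero, mul_zero] at h_sum
  refine h_sum.congr' ?_
  filter_upwards [eventually_ge_atTop 0] with R hR
  obtain ⟨C, hC⟩ := hc.exists_bound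
  have h_int : Integrable fun x : Space d => c (R * ‖x‖) * ‖u x‖ ^ 2 := hu_sq.bdd_mul
    (hc.continuous.comp (continuous_const.mul continuous_norm)).aestronglyMeasurable
    (ae_of_all _ fun x => hC _ (mul_nonneg hR (norm_nonneg x)))
  rw [quadraticTerm, ← integral_const_mul, ← integral_add (hG_sq.const_mul _) h_int,
    ← integral_const_mul]
  congr 1 with x
  simp only [norm_smul, mul_pow, Real.norm_eq_abs, sq_abs, ← Finset.mul_sum]
  ring

theorem fderiv_comp_inv_smul {E : Type*} [NormedAddCommGroup E] [NormedSpace ℝ E] (φ : E → ℝ)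
    (R : ℝ) (x v : E) : fderiv ℝ (fun y => φ (R⁻¹ • y)) x v = R⁻¹ * fderiv ℝ φ (R⁻¹ • x) v := by
  rw [fderiv_comp_smul, smul_apply, smul_eq_mul]

theorem integral_norm_sq_smul_pos {φ : Space d → ℝ} (hφ : Continuous φ)
    (hc : HasCompactSupport φ) {x₀ : Space d} (hx₀ : φ x₀ ≠ 0) {z : 𝕜} (hz : z ≠ 0) :
    0 < ∫ x, ‖φ x • z‖ ^ 2 := by
  have h_cont : Continuous fun x => ‖φ x • z‖ ^ 2 := (hφ.smul continuous_const).norm.pow 2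
  refine h_cont.integral_pos_of_hasCompactSupport_nonneg_nonzero
    (hc.smul_right.norm.comp_left (g := fun t : ℝ => t ^ 2) (zero_pow two_ne_zero))
    (fun x => sq_nonneg _) (x := x₀) ?_
  simp [hx₀, hz]

/-- Spreading out a bump function makes its quadratic energy negligible compared with its mass. -/
theorem exists_quadraticTerm_le_mul_mass [NeZero d] (𝕜 : Type*) [RCLike 𝕜] {c : ℝ → ℝ}
    (hc : IsBoundedCoefficient c) (hc0 : Tendsto c atTop (𝓝 0)) {ε : ℝ} (hε : 0 < ε) :
    ∃ (v : Space d → 𝕜) (H : Fin d → Space d → 𝕜), MemH1WithGradient v H ∧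
      0 < ∫ x, ‖v x‖ ^ 2 ∧ quadraticTerm d c v H ≤ ε * ∫ x, ‖v x‖ ^ 2 := by
  let b : ContDiffBump (0 : Space d) := ⟨1, 2, one_pos, one_lt_two⟩
  have hb : ContDiff ℝ ∞ b := b.contDiff
  have h_mass : 0 < ∫ x, ‖b x • (1 : 𝕜)‖ ^ 2 := integral_norm_sq_smul_pos b.continuous
    b.hasCompactSupport (x₀ := 0)
    (by simp [b.one_of_mem_closedBall (Metric.mem_closedBall_self zero_le_one)]) one_ne_zero
  obtain ⟨R, hRε, hR⟩ := (((tendsto_quadraticTerm_dilation hc hc0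
    (memH1WithGradient_smul_const hb b.hasCompactSupport (1 : 𝕜))).eventually_lt_const
    (mul_pos hε h_mass)).and (eventually_gt_atTop 0)).exists
  have hv := memH1WithGradient_smul_const (hb.comp (contDiff_const_smul R⁻¹))
    (b.hasCompactSupport.comp_smul (inv_ne_zero hR.ne')) (1 : 𝕜)
  simp only [Function.comp_def, fderiv_comp_inv_smul, mul_smul] at hv
  have hv_mass : ∫ x : Space d, ‖b (R⁻¹ • x) • (1 : 𝕜)‖ ^ 2
      = R ^ d * ∫ x, ‖b x • (1 : 𝕜)‖ ^ 2 := by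
    have := Measure.integral_comp_inv_smul_of_nonneg (volume : Measure (Space d))
      (fun x => ‖b x • (1 : 𝕜)‖ ^ 2) hR.le
    rwa [finrank_euclideanSpace_fin, smul_eq_mul] at this
  refine ⟨_, _, hv, by rw [hv_mass]; positivity, ?_⟩
  rw [quadraticTerm_comp_inv_smul c (fun x => b x • (1 : 𝕜))
    (fun i x => fderiv ℝ b x (EuclideanSpace.single i 1) • (1 : 𝕜)) hR, hv_mass, mul_left_comm]
  gcongr

theorem energy₁_nonpos_of_isMinimizer [NeZero d] {p lam : ℝ} (hp : 0 ≤ p) (hlam : 0 < lam)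
    {u : Space d → 𝕜} {G : Fin d → Space d → 𝕜}
    (hmin : ∀ (v : Space d → 𝕜) (H : Fin d → Space d → 𝕜), MemH1WithGradient v H →
      ∫ x, ‖v x‖ ^ 2 = lam → energy₁ d p u G ≤ energy₁ d p v H) :
    energy₁ d p u G ≤ 0 := by
  refine le_of_forall_pos_le_add fun ε hε => ?_
  obtain ⟨v, H, hv, h_mass, h_le⟩ := exists_quadraticTerm_le_mul_mass (d := d) 𝕜
    (isBoundedCoefficient_potential d) (tendsto_potential_atTop d) (div_pos hε hlam)
  set s := √(lam / ∫ x, ‖v x‖ ^ 2)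
  have hs : s ^ 2 = lam / ∫ x, ‖v x‖ ^ 2 := Real.sq_sqrt (by positivity)
  have h_constraint : ∫ x, ‖s • v x‖ ^ 2 = lam := by
    rw [integral_norm_sq_smul, hs, div_mul_cancel₀ _ h_mass.ne']
  have h_scaled : quadraticTerm d (potential d) (fun x => s • v x) (fun i x => s • H i x) ≤ ε :=
    calc _ = s ^ 2 * quadraticTerm d (potential d) v H := quadraticTerm_smul _ _ _ _
      _ ≤ s ^ 2 * (ε / lam * ∫ x, ‖v x‖ ^ 2) := by gcongr
      _ = ε := by rw [hs]; field_simp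
  have h_nonneg : 0 ≤ nonlinearTerm d p fun x => s • v x := nonlinearTerm_nonneg hp _
  have h_min := hmin _ _ (hv.smul s) h_constraint
  rw [energy₁, energy₁] at h_min
  rw [energy₁]
  linarith

theorem quadraticForm_const_add {c : ℝ → ℝ} (hc : IsBoundedCoefficient c) (w : ℝ)
    {u v : Space d → 𝕜} {G H : Fin d → Space d → 𝕜} (hu : MemH1WithGradient u G)
    (hv : MemH1WithGradient v H) :
    quadraticForm (fun r => w + c r) u v G H
      = quadraticForm c u v G H + w * ∫ x, inner ℝ (u x) (v x) := by
  have h_inner := integrable_inner_of_memLp_two hu.memLp hv.memLp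
  have h_form := (integrable_sum_inner hu.memLp_gradient hv.memLp_gradient).fun_add
    (hc.integrable_mul h_inner)
  rw [quadraticForm, quadraticForm, ← integral_const_mul,
    ← integral_add h_form (h_inner.const_mul w)]
  congr 1 with x
  ring

/-- `u`, with gradient `G`, is a weak solution of `-Δu + (w + V_d) u = a K |u|^p u`, tested against
all functions of `H¹ ∩ L^(p+2)`. -/
def IsWeakSolution (d : ℕ) (p w a : ℝ) (u : Space d → 𝕜) (G : Fin d → Space d → 𝕜) : Prop :=
  ∀ (v : Space d → 𝕜) (H : Fin d → Space d → 𝕜), MemH1WithGradient v H →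
    (Integrable fun x => ‖v x‖ ^ (p + 2)) →
    quadraticForm (fun r => w + potential d r) u v G H = a * nonlinearForm d p u v

/-- The frequency `w` is a Lagrange multiplier for `I_lam`, where its sign follows from
`𝓔₁(u) ≤ 0`; for `J_lam` it is the given `μ_d`. -/
theorem exists_isWeakSolution_of_isMinimizer [NeZero d] {p Λ lam : ℝ} (hp : 0 < p)
    (hΛ : -(((d : ℝ) - 1) / 2) ^ 2 < Λ) (hlam : 0 < lam) {u : Space d → 𝕜}
    (hmin : IsMinimizerI d p lam u ∨ IsMinimizerJ d p Λ lam u)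
    (hup : Integrable fun x => ‖u x‖ ^ (p + 2)) :
    ∃ (G : Fin d → Space d → 𝕜) (w a : ℝ), MemH1WithGradient u G ∧ 0 < w ∧
      IsWeakSolution d p w a u G := by
  have hd : 1 ≤ d := NeZero.one_le
  rcases hmin with ⟨G, hu, hu_mass, hmin⟩ | ⟨G, hu, hu_lam, hmin⟩
  · have h_pos := nonlinearTerm_pos hd hp.le hup (by rwa [hu_mass])
    have h_energy := energy₁_nonpos_of_isMinimizer hp.le hlam hmin
    rw [energy₁] at h_energy
    refine ⟨G, ((p + 2) * nonlinearTerm d p u - 2 * quadraticTerm d (potential d) u G) / lam,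
      p + 2, hu, div_pos (by linarith [mul_pos hp h_pos]) hlam, fun v H hv hvp => ?_⟩
    rw [quadraticForm_const_add (isBoundedCoefficient_potential d) _ hu hv]
    exact eulerLagrange_of_min_on_mass (isBoundedCoefficient_potential d) hd hp.le hlam hu hu_mass
      hmin hup hv hvp
  · exact ⟨G, Λ + (((d : ℝ) - 1) / 2) ^ 2, 2 * energy₂ d Λ u G / lam, hu, by linarith,
      fun v H hv hvp => eulerLagrange_of_min_on_nonlinearTerm
        (isBoundedCoefficient_const_add_potential d _) hd hp.le hlam hu hu_lam hmin hup hv hvp⟩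

theorem locallyIntegrable_rpow_smul {X E : Type*} [TopologicalSpace X] [MeasurableSpace X]
    {μ : Measure X} [IsLocallyFiniteMeasure μ] [NormedAddCommGroup E] [NormedSpace ℝ E]
    {p : ℝ} (hp : 0 ≤ p) {u : X → E} (hum : AEStronglyMeasurable u μ)
    (hup : Integrable (fun x => ‖u x‖ ^ (p + 2)) μ) :
    LocallyIntegrable (fun x => ‖u x‖ ^ p • u x) μ := by
  refine ((locallyIntegrable_const (1 : ℝ)).add hup.locallyIntegrable).mono
    ((hum.norm.aemeasurable.pow_const p).aestronglyMeasurable.smul hum) (ae_of_all _ fun x => ?_)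
  have h_eq : ‖‖u x‖ ^ p • u x‖ = ‖u x‖ ^ (p + 1) := by
    rw [norm_smul, Real.norm_of_nonneg (by positivity),
      Real.rpow_add' (norm_nonneg _) (by linarith), Real.rpow_one]
  rw [h_eq, Pi.add_apply, Real.norm_of_nonneg (by positivity)]
  rcases le_total ‖u x‖ 1 with h | h
  · exact (Real.rpow_le_one (norm_nonneg _) h (by linarith)).trans
      (le_add_of_nonneg_right (by positivity))
  · exact (Real.rpow_le_rpow_of_exponent_le h (by linarith)).trans
      (le_add_of_nonneg_left zero_le_one)

/-- The right-hand side `(w + V_d) f - a K |f|^p f` of the radial profile equation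
`r^(1-d) (r^(d-1) f')' = (w + V_d) f - a K |f|^p f`. -/
def profileRHS (d : ℕ) (p w a : ℝ) (f : ℝ → 𝕜) (r : ℝ) : 𝕜 :=
  (w + potential d r - a * (weight d p r * ‖f r‖ ^ p)) • f r

theorem integrable_norm_rpow_smul_const {φ : Space d → ℝ} (hφ : Continuous φ)
    (hc : HasCompactSupport φ) (z : 𝕜) {q : ℝ} (hq : 0 < q) :
    Integrable fun x => ‖φ x • z‖ ^ q :=
  ((hφ.smul continuous_const).norm.rpow_const fun _ =>
    Or.inr hq.le).integrable_of_hasCompactSupport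
    (hc.smul_right.norm.comp_left (g := fun t : ℝ => t ^ q) (Real.zero_rpow hq.ne'))

/-- Testing the weak equation with `ψ(|x|) z` for every `z : 𝕜` removes the inner product. -/
theorem IsWeakSolution.integral_radial_test {p : ℝ} (hp : 0 ≤ p) {u : Space d → 𝕜}
    {G : Fin d → Space d → 𝕜} {w a : ℝ} (hu : MemH1WithGradient u G)
    (hup : Integrable fun x => ‖u x‖ ^ (p + 2)) (h_sol : IsWeakSolution d p w a u G) {ψ : ℝ → ℝ}
    (hψ : IsTestFunctionOn (Ioi 0) ψ) :
    ∫ x, deriv ψ ‖x‖ • radialComponent G x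
      = - ∫ x, ψ ‖x‖ • (w + potential d ‖x‖ - a * (weight d p ‖x‖ * ‖u x‖ ^ p)) • u x := by
  have hψ_cont : Continuous fun x : Space d => ψ ‖x‖ := hψ.contDiff_comp_norm.continuous
  have hψ_supp := hasCompactSupport_comp_norm (X := Space d) hψ.hasCompactSupport
  let g₁ : Space d → 𝕜 := fun x => deriv ψ ‖x‖ • radialComponent G x
  let g₂ : Space d → 𝕜 := fun x => ((w + potential d ‖x‖) * ψ ‖x‖) • u x
  let g₃ : Space d → 𝕜 := fun x => (weight d p ‖x‖ * ψ ‖x‖) • ‖u x‖ ^ p • u x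
  have hg₁ : Integrable g₁ := integrable_smul_of_memLp_two (memLp_radialComponent hu.memLp_gradient)
    hψ.deriv.contDiff_comp_norm.continuous (hasCompactSupport_comp_norm hψ.deriv.hasCompactSupport)
  have hg₂ : Integrable g₂ := integrable_smul_of_memLp_two hu.memLp
    (((isBoundedCoefficient_const_add_potential d w).continuous.comp continuous_norm).mul hψ_cont)
    hψ_supp.mul_left
  have hg₃ : Integrable g₃ := (locallyIntegrable_rpow_smul hp hu.memLp.aestronglyMeasurable
    hup).integrable_smul_left_of_hasCompactSupport
    (((continuous_weight d p).comp continuous_norm).mul hψ_cont) hψ_supp.mul_left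
  have h_tested (z : 𝕜) : inner ℝ z ((∫ x, g₁ x) + ∫ x, g₂ x) = inner ℝ z (a • ∫ x, g₃ x) := by
    have h_eq := h_sol _ _ (memH1WithGradient_smul_const hψ.contDiff_comp_norm hψ_supp z)
      (integrable_norm_rpow_smul_const hψ_cont hψ_supp z (by linarith))
    rw [← integral_add hg₁ hg₂, ← integral_inner (hg₁.fun_add hg₂), inner_smul_right,
      ← integral_inner hg₃]
    convert h_eq using 1
    · rw [quadraticForm]
      congr 1 with x
      simp only [g₁, g₂, radialComponent, fderiv_comp_norm_single hψ, inner_add_right,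
        inner_smul_right, inner_sum, real_inner_comm z, Finset.mul_sum]
      congr 1
      · exact Finset.sum_congr rfl fun i _ => by ring
      · ring
    · rw [nonlinearForm]
      congr 2 with x
      simp only [g₃, inner_smul_right, real_inner_comm z]
      ring
  have hag₃ : Integrable fun x => a • g₃ x := hg₃.smul a
  have h_strong := ext_inner_left ℝ h_tested
  rw [eq_sub_of_add_eq h_strong, ← integral_smul, ← integral_sub hag₃ hg₂, ← integral_neg]
  congr 1 with x
  simp only [g₂, g₃, smul_smul, ← sub_smul, ← neg_smul]
  ring_nf

theorem IsWeakSolution.hasWeakDerivOn_profile [NeZero d] {p : ℝ} (hp : 0 ≤ p) {u : Space d → 𝕜}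
    {G : Fin d → Space d → 𝕜} {w a : ℝ} (hu : MemH1WithGradient u G)
    (hup : Integrable fun x => ‖u x‖ ^ (p + 2)) (h_sol : IsWeakSolution d p w a u G)
    {f h : ℝ → 𝕜} (huf : u =ᵐ[volume] fun x => f ‖x‖)
    (h_radial : IsSphericalAverage (radialComponent G) h) :
    HasWeakDerivOn (fun r => r ^ (d - 1) • h r) (fun r => r ^ (d - 1) • profileRHS d p w a f r)
      (Ioi 0) := by
  intro ψ hψ
  have h_test := h_sol.integral_radial_test hp hu hup hψ
  have h_right : ∫ x, ψ ‖x‖ • (w + potential d ‖x‖ - a * (weight d p ‖x‖ * ‖u x‖ ^ p)) • u x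
      = ∫ x : Space d, ψ ‖x‖ • profileRHS d p w a f ‖x‖ :=
    integral_congr_ae (by filter_upwards [huf] with x hx; rw [hx, profileRHS])
  rw [h_right, h_radial _ hψ.deriv, integral_comp_norm fun r => ψ r • profileRHS d p w a f r,
    ← smul_neg] at h_test
  rw [← hψ.setIntegral_smul, ← hψ.deriv.setIntegral_smul]
  simpa only [smul_comm (_ : ℝ) (_ : ℝ) (_ : 𝕜)] using
    smul_right_injective 𝕜 (sphereArea_pos (d := d)).ne' h_test

end WeakSolution

section RadialLaplacian

variable {E : Type*} [NormedAddCommGroup E] [NormedSpace ℝ E]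

/-- `k = f'` and `g = r^(-m) (r^m f')'` on `(0, ∞)`: away from the origin of `ℝ^(m+1)`, the radial
function `f(|x|)` has radial derivative `k(|x|)` and Laplacian `g(|x|)`. The second equation is
stated for the flux `r^m k`, which can be integrated from the origin. -/
structure HasRadialLaplacian (m : ℕ) (f k g : ℝ → E) : Prop where
  hasDerivAt : ∀ r, 0 < r → HasDerivAt f (k r) r
  hasDerivAt_flux : ∀ r, 0 < r → HasDerivAt (fun s => s ^ m • k s) (r ^ m • g r) r

variable {m : ℕ} {f h k g : ℝ → E}

theorem hasDerivAt_primitive_of_continuousOn [CompleteSpace E] {U : Set ℝ} (hU : IsOpen U)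
    [U.OrdConnected] (hg : ContinuousOn g U) {x₀ r : ℝ} (hx₀ : x₀ ∈ U) (hr : r ∈ U) :
    HasDerivAt (fun s => ∫ t in x₀..s, g t) (g r) r :=
  intervalIntegral.integral_hasDerivAt_right
    (intervalIntegrable_of_locallyIntegrableOn (hg.locallyIntegrableOn hU.measurableSet) hx₀ hr)
    (hg.stronglyMeasurableAtFilter hU r hr) (hg.continuousAt (hU.mem_nhds hr))

theorem IsRadialProfile.congr_deriv (hf : IsRadialProfile m f h)
    (hkh : ∀ᵐ r ∂volume.restrict (Ioi 0), h r = k r) : IsRadialProfile m f k where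
  locallyIntegrableOn r hr := by
    obtain ⟨s, hs, hs_int⟩ := hf.locallyIntegrableOn r hr
    obtain ⟨t, ht, hts⟩ := mem_nhdsWithin_iff_exists_mem_nhds_inter.1 hs
    refine ⟨t ∩ Ioi 0, inter_mem (mem_nhdsWithin_of_mem_nhds ht) self_mem_nhdsWithin,
      (hs_int.mono_set hts).congr_fun_ae (ae_restrict_of_ae_restrict_of_subset
        inter_subset_right hkh)⟩
  eq_add_integral r hr := by
    rw [hf.eq_add_integral r hr]
    congr 1
    refine intervalIntegral.integral_congr_ae ?_
    filter_upwards [(ae_restrict_iff' measurableSet_Ioi).1 hkh] with t ht ht'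
    exact ht ((lt_min one_pos hr).trans ht'.1)
  integrableOn_sq := hf.integrableOn_sq
  integrableOn_deriv_sq := hf.integrableOn_deriv_sq.congr_fun_ae <| by
    filter_upwards [hkh] with r hr
    rw [hr]

/-- Interior regularity: a weak solution of `(r^m f')' = r^m g` with `g` continuous is `C²`. -/
theorem IsRadialProfile.exists_hasRadialLaplacian [CompleteSpace E] (hf : IsRadialProfile m f h)
    (hg : ContinuousOn g (Ioi 0))
    (h_weak : HasWeakDerivOn (fun r => r ^ m • h r) (fun r => r ^ m • g r) (Ioi 0)) :
    ∃ k, IsRadialProfile m f k ∧ HasRadialLaplacian m f k g := by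
  have h_pow : ContinuousOn (fun r : ℝ => r ^ m) (Ioi 0) := by fun_prop
  have hg_flux : ContinuousOn (fun r => r ^ m • g r) (Ioi 0) := h_pow.smul hg
  obtain ⟨c, hc⟩ := ae_eq_const_add_primitive_of_hasWeakDerivOn isOpen_Ioi
    (hf.locallyIntegrableOn.continuousOn_smul isOpen_Ioi.isLocallyClosed h_pow)
    (hg_flux.locallyIntegrableOn measurableSet_Ioi) h_weak (mem_Ioi.2 one_pos)
  let P : ℝ → E := fun r => c + ∫ t in (1 : ℝ)..r, t ^ m • g t
  let k : ℝ → E := fun r => (r ^ m)⁻¹ • P r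
  have hP (r : ℝ) (hr : 0 < r) : HasDerivAt P (r ^ m • g r) r :=
    (hasDerivAt_primitive_of_continuousOn isOpen_Ioi hg_flux (mem_Ioi.2 one_pos) hr).const_add c
  have hk_cont : ContinuousOn k (Ioi 0) :=
    (h_pow.inv₀ fun r hr => pow_ne_zero m (ne_of_gt hr)).smul
      fun r hr => (hP r hr).continuousAt.continuousWithinAt
  have hkh : ∀ᵐ r ∂volume.restrict (Ioi 0), h r = k r := by
    filter_upwards [(ae_restrict_iff' measurableSet_Ioi).2 hc, ae_restrict_mem measurableSet_Ioi]
      with r hr hr0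
    exact (inv_smul_eq_iff₀ (pow_ne_zero m (ne_of_gt hr0))).2 hr.symm |>.symm
  have hfk := hf.congr_deriv hkh
  refine ⟨k, hfk, fun r hr => ?_, fun r hr => (hP r hr).congr_of_eventuallyEq ?_⟩
  · refine ((hasDerivAt_primitive_of_continuousOn isOpen_Ioi hk_cont (mem_Ioi.2 one_pos)
      hr).const_add (f 1)).congr_of_eventuallyEq ?_
    filter_upwards [Ioi_mem_nhds hr] with s hs using hfk.eq_add_integral s hs
  · filter_upwards [Ioi_mem_nhds hr] with s hs
    exact smul_inv_smul₀ (pow_ne_zero m (ne_of_gt hs)) (P s)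

/-- Otherwise `r^m ‖k‖² ≥ η² r^(-m)`, which is not integrable at the origin. -/
theorem IsRadialProfile.frequently_norm_flux_lt (hf : IsRadialProfile m f k) (hm : 1 ≤ m) {η : ℝ}
    (hη : 0 < η) : ∃ᶠ r in 𝓝[>] 0, ‖r ^ m • k r‖ < η := by
  intro h_not
  simp only [not_lt] at h_not
  obtain ⟨ρ, hρ, h_large⟩ := mem_nhdsGT_iff_exists_Ioo_subset.1
    (h_not.and (Ioo_mem_nhdsGT one_pos))
  have h_inv : IntegrableOn (fun r : ℝ => r⁻¹) (Ioo 0 ρ) := by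
    refine ((hf.integrableOn_deriv_sq.mono_set fun r (hr : r ∈ Ioo 0 ρ) => hr.1).const_mul
      (η ^ 2)⁻¹).mono' measurable_inv.aestronglyMeasurable ?_
    filter_upwards [ae_restrict_mem measurableSet_Ioo] with r hr
    obtain ⟨h_le, hr0, hr1⟩ := h_large hr
    have h_pow : r ^ m ≤ r := pow_le_of_le_one hr0.le hr1.le (by omega)
    rw [norm_smul, norm_pow, Real.norm_of_nonneg hr0.le] at h_le
    rw [Real.norm_of_nonneg (by positivity), inv_mul_eq_div, le_div_iff₀ (by positivity)]
    calc r⁻¹ * η ^ 2 ≤ (r ^ m)⁻¹ * (r ^ m * ‖k r‖) ^ 2 := by gcongr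
      _ = r ^ m * ‖k r‖ ^ 2 := by field_simp
  have h_inv' : IntervalIntegrable (fun r : ℝ => r⁻¹) volume 0 ρ := by
    rwa [intervalIntegrable_iff_integrableOn_Ioo_of_le (le_of_lt hρ)]
  exact (intervalIntegrable_inv_iff.1 h_inv').elim (ne_of_lt hρ) fun h => h left_mem_uIcc

theorem norm_sub_le_of_norm_deriv_le_rpow {a b C q : ℝ} (ha : 0 < a) (hab : a ≤ b) (hq : q ≠ 0)
    (hf : ∀ s ∈ Icc a b, HasDerivAt f (k s) s) (hk : ∀ s ∈ Icc a b, ‖k s‖ ≤ C * s ^ (q - 1)) :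
    ‖f b - f a‖ ≤ C / q * (b ^ q - a ^ q) := by
  have h_bound (s : ℝ) (hs : a ≤ s) :
      HasDerivAt (fun s : ℝ => C / q * (s ^ q - a ^ q)) (C * s ^ (q - 1)) s := by
    refine (((Real.hasDerivAt_rpow_const (Or.inl (ha.trans_le hs).ne')).sub_const _).const_mul
      _).congr_deriv ?_
    field_simp
  exact image_norm_le_of_norm_deriv_right_le_deriv_boundary' (f := fun s => f s - f a)
    (fun s hs => ((hf s hs).continuousAt.sub continuousAt_const).continuousWithinAt)
    (fun s hs => ((hf s (Ico_subset_Icc_self hs)).sub_const _).hasDerivWithinAt) (by simp)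
    (fun s hs => (h_bound s hs.1).continuousAt.continuousWithinAt)
    (fun s hs => (h_bound s hs.1).hasDerivWithinAt) (fun s hs => hk s (Ico_subset_Icc_self hs))
    (right_mem_Icc.2 hab)

/-- The flux through small spheres being negligible, `r^m k` is the integral of `t^m g` over
`(0, r)`. -/
theorem HasRadialLaplacian.norm_deriv_le_rpow (hf : HasRadialLaplacian m f k g)
    (h_flux : ∀ η > 0, ∃ᶠ r in 𝓝[>] 0, ‖r ^ m • k r‖ < η) {C s ρ : ℝ} (hs : s < m + 1)
    (hC : 0 ≤ C) (hg : ∀ r ∈ Ioc 0 ρ, ‖g r‖ ≤ C * r ^ (-s)) :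
    ∀ r ∈ Ioc 0 ρ, ‖k r‖ ≤ C / (m + 1 - s) * r ^ (1 - s) := by
  rintro r ⟨hr, hrρ⟩
  set q : ℝ := m + 1 - s with hq
  have hq0 : 0 < q := by linarith
  have h_pow (t : ℝ) (ht : 0 < t) (e : ℝ) : t ^ m * t ^ e = t ^ (m + e) := by
    rw [← Real.rpow_natCast, ← Real.rpow_add ht]
  have h_flux_le : ‖r ^ m • k r‖ ≤ C / q * r ^ q := by
    refine le_of_forall_pos_le_add fun η hη => ?_
    obtain ⟨a, ha_flux, ha, har⟩ := ((h_flux η hη).and_eventually (Ioo_mem_nhdsGT hr)).exists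
    have h_sub : ‖r ^ m • k r - a ^ m • k a‖ ≤ C / q * (r ^ q - a ^ q) :=
      norm_sub_le_of_norm_deriv_le_rpow (f := fun t => t ^ m • k t) ha har.le hq0.ne'
        (fun t ht => hf.hasDerivAt_flux t (ha.trans_le ht.1)) fun t ht => by
          have ht0 : 0 < t := ha.trans_le ht.1
          rw [norm_smul, norm_pow, Real.norm_of_nonneg ht0.le]
          calc t ^ m * ‖g t‖ ≤ t ^ m * (C * t ^ (-s)) := by
                gcongr; exact hg t ⟨ht0, ht.2.trans hrρ⟩
            _ = C * t ^ (q - 1) := by rw [mul_left_comm, h_pow t ht0, hq]; ring_nf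
    have h_le : C / q * (r ^ q - a ^ q) ≤ C / q * r ^ q := by
      gcongr
      exact sub_le_self _ (by positivity)
    linarith [norm_le_norm_add_norm_sub' (r ^ m • k r) (a ^ m • k a)]
  rw [norm_smul, norm_pow, Real.norm_of_nonneg hr.le] at h_flux_le
  refine le_of_mul_le_mul_left (h_flux_le.trans (le_of_eq ?_)) (pow_pos hr m)
  rw [mul_left_comm, h_pow r hr, hq]
  ring_nf

theorem exists_norm_le_rpow_min_zero {B γ : ℝ} (hB : 0 ≤ B) (hγ : γ ≠ 0)
    (hf : ∀ r, 0 < r → HasDerivAt f (k r) r) (hk : ∀ r ∈ Ioc 0 1, ‖k r‖ ≤ B * r ^ (γ - 1)) :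
    ∃ C, 0 ≤ C ∧ ∀ r ∈ Ioc 0 1, ‖f r‖ ≤ C * r ^ min γ 0 := by
  refine ⟨‖f 1‖ + B / |γ|, by positivity, fun r hr => ?_⟩
  have h_sub := norm_sub_le_of_norm_deriv_le_rpow hr.1 hr.2 hγ
    (fun t ht => hf t (hr.1.trans_le ht.1)) fun t ht => hk t ⟨hr.1.trans_le ht.1, ht.2⟩
  have h_one : 1 ≤ r ^ min γ 0 :=
    Real.one_le_rpow_of_pos_of_le_one_of_nonpos hr.1 hr.2 (min_le_right _ _)
  have h_bound : B / γ * (1 ^ γ - r ^ γ) ≤ B / |γ| * r ^ min γ 0 := by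
    have := Real.rpow_nonneg hr.1.le γ
    rw [Real.one_rpow]
    rcases hγ.lt_or_gt with h_neg | h_pos
    · have : 0 < -γ := neg_pos.2 h_neg
      rw [abs_of_neg h_neg, min_eq_left h_neg.le]
      calc B / γ * (1 - r ^ γ) = B / -γ * (r ^ γ - 1) := by ring
        _ ≤ B / -γ * r ^ γ := by gcongr; linarith
    · rw [abs_of_pos h_pos, min_eq_right h_pos.le, Real.rpow_zero]
      gcongr
      linarith
  calc ‖f r‖ ≤ ‖f 1‖ + ‖f 1 - f r‖ := norm_le_norm_add_norm_sub _ _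
    _ ≤ ‖f 1‖ * r ^ min γ 0 + B / |γ| * r ^ min γ 0 := by
        gcongr
        · exact le_mul_of_one_le_right (norm_nonneg _) h_one
        · exact h_sub.trans h_bound
    _ = _ := by ring

/-- Each application improves the exponent `-β` by any `κ ≤ 2 - s`, until `f` is bounded. -/
theorem HasRadialLaplacian.bootstrap_step (hf : HasRadialLaplacian m f k g)
    (h_flux : ∀ η > 0, ∃ᶠ r in 𝓝[>] 0, ‖r ^ m • k r‖ < η) {A C s κ β : ℝ} (hA : 0 ≤ A)
    (hC : 0 ≤ C) (hg : ∀ r ∈ Ioc 0 1, ‖g r‖ ≤ A * r ^ (-s) * ‖f r‖) (hκ : κ ≤ 2 - s)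
    (hsβ : s + β < m + 1) (hκβ : κ - β ≠ 0) (hfβ : ∀ r ∈ Ioc 0 1, ‖f r‖ ≤ C * r ^ (-β)) :
    ∃ C', 0 ≤ C' ∧ ∀ r ∈ Ioc 0 1, ‖f r‖ ≤ C' * r ^ min (κ - β) 0 := by
  have hgβ (r : ℝ) (hr : r ∈ Ioc (0 : ℝ) 1) : ‖g r‖ ≤ A * C * r ^ (-(s + β)) := by
    have := hr.1
    calc ‖g r‖ ≤ A * r ^ (-s) * (C * r ^ (-β)) := (hg r hr).trans (by gcongr; exact hfβ r hr)
      _ = A * C * r ^ (-(s + β)) := by rw [neg_add, Real.rpow_add hr.1]; ring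
  have : 0 < (m : ℝ) + 1 - (s + β) := by linarith
  refine exists_norm_le_rpow_min_zero (B := A * C / (m + 1 - (s + β))) (by positivity) hκβ
    hf.hasDerivAt fun r hr => ?_
  refine (hf.norm_deriv_le_rpow h_flux hsβ (by positivity) hgβ r hr).trans ?_
  gcongr _ * ?_
  exact Real.rpow_le_rpow_of_exponent_ge hr.1 hr.2 (by linarith)

/-- The increment `κ = β / (n + 1/2)` makes `β - j κ` miss zero, where a step would produce a
logarithm. -/
theorem HasRadialLaplacian.exists_norm_le (hf : HasRadialLaplacian m f k g)
    (h_flux : ∀ η > 0, ∃ᶠ r in 𝓝[>] 0, ‖r ^ m • k r‖ < η) {A C s β : ℝ} (hA : 0 ≤ A)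
    (hC : 0 ≤ C) (hg : ∀ r ∈ Ioc 0 1, ‖g r‖ ≤ A * r ^ (-s) * ‖f r‖) (hs : s < 2)
    (hβ : 0 < β) (hsβ : s + β < m + 1) (hfβ : ∀ r ∈ Ioc 0 1, ‖f r‖ ≤ C * r ^ (-β)) :
    ∃ C', 0 ≤ C' ∧ ∀ r ∈ Ioc 0 1, ‖f r‖ ≤ C' := by
  obtain ⟨n, hn⟩ := exists_nat_gt (β / (2 - s))
  rw [div_lt_iff₀ (by linarith)] at hn
  obtain ⟨κ, hκ, hκβ⟩ : ∃ κ > 0, κ * (n + 1 / 2) = β :=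
    ⟨β / (n + 1 / 2), by positivity, div_mul_cancel₀ _ (by positivity)⟩
  have hκs : κ ≤ 2 - s := by nlinarith [n.cast_nonneg (α := ℝ)]
  have h_step (j : ℕ) : s + (β - j * κ) < m + 1 := by
    nlinarith [mul_nonneg (j.cast_nonneg (α := ℝ)) hκ.le]
  have h_improved (j : ℕ) (hj : j ≤ n) :
      ∃ C', 0 ≤ C' ∧ ∀ r ∈ Ioc 0 1, ‖f r‖ ≤ C' * r ^ (-(β - j * κ)) := by
    induction j with
    | zero => exact ⟨C, hC, by simpa using hfβ⟩
    | succ j ih =>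
      obtain ⟨C₁, hC₁, hf₁⟩ := ih (by omega)
      have h_neg : κ - (β - j * κ) < 0 := by
        have : (j : ℝ) + 1 ≤ n := by exact_mod_cast hj
        nlinarith
      obtain ⟨C₂, hC₂, hf₂⟩ := hf.bootstrap_step h_flux hA hC₁ hg hκs (h_step j) h_neg.ne hf₁
      refine ⟨C₂, hC₂, fun r hr => (hf₂ r hr).trans_eq ?_⟩
      rw [min_eq_left h_neg.le]
      push_cast
      ring_nf
  obtain ⟨C₁, hC₁, hf₁⟩ := h_improved n le_rfl
  have h_pos : 0 < κ - (β - n * κ) := by nlinarith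
  obtain ⟨C₂, hC₂, hf₂⟩ := hf.bootstrap_step h_flux hA hC₁ hg hκs (h_step n) h_pos.ne' hf₁
  exact ⟨C₂, hC₂, fun r hr => by simpa [min_eq_right h_pos.le] using hf₂ r hr⟩

end RadialLaplacian

section RadialC2

variable {X E : Type*} [NormedAddCommGroup X] [InnerProductSpace ℝ X] [NormedAddCommGroup E]
  [NormedSpace ℝ E]

/-- The bilinear map `(x, z) ↦ ⟪x, ·⟫ z`; the gradient of `F(|x|)` is `(x, F'(|x|) / |x|)`. -/
def innerSmulRight (X E : Type*) [NormedAddCommGroup X] [InnerProductSpace ℝ X]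
    [NormedAddCommGroup E] [NormedSpace ℝ E] : X →L[ℝ] E →L[ℝ] X →L[ℝ] E :=
  (ContinuousLinearMap.smulRightL ℝ X E).comp (innerSL ℝ)

theorem innerSmulRight_apply (x : X) (z : E) :
    innerSmulRight X E x z = (innerSL ℝ x).smulRight z := rfl

theorem norm_innerSmulRight_apply (x : X) (z : E) : ‖innerSmulRight X E x z‖ = ‖x‖ * ‖z‖ := by
  rw [innerSmulRight_apply, ContinuousLinearMap.norm_smulRight_apply, innerSL_apply_norm]

/-- Radial data of a `C²` function `F(|x|)`: `ℓ = F' / r` and `M = F'' - F' / r` on `(0, ∞)`, both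
continuous up to the origin, where `M` vanishes. -/
structure IsRadialC2 (F ℓ M : ℝ → E) : Prop where
  continuous : Continuous F
  continuous_slope : Continuous ℓ
  continuous_defect : Continuous M
  defect_zero : M 0 = 0
  hasDerivAt : ∀ r, 0 < r → HasDerivAt F (r • ℓ r) r
  hasDerivAt_slope : ∀ r, 0 < r → HasDerivAt ℓ (r⁻¹ • M r) r

/-- The second derivative `⟪y, z⟫ ℓ + ⟪x, y⟫ ⟪x, z⟫ |x|⁻² M` of `F(|x|)` in terms of the radial data
of `IsRadialC2`. -/
def radialHessian (X : Type*) [NormedAddCommGroup X] [InnerProductSpace ℝ X] (ℓ M : ℝ → E) (x : X) :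
    X →L[ℝ] X →L[ℝ] E :=
  (innerSmulRight X E).flip (ℓ ‖x‖) +
    (innerSL ℝ x).smulRight (innerSmulRight X E x ((‖x‖ ^ 2)⁻¹ • M ‖x‖))

theorem norm_smulRight_innerSmulRight_le (x : X) (z : E) :
    ‖(innerSL ℝ x).smulRight (innerSmulRight X E x ((‖x‖ ^ 2)⁻¹ • z))‖ ≤ ‖z‖ := by
  rw [ContinuousLinearMap.norm_smulRight_apply, innerSL_apply_norm, norm_innerSmulRight_apply,
    norm_smul, norm_inv, norm_pow, norm_norm]
  rcases eq_or_ne ‖x‖ 0 with hx | hx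
  · simp [hx]
  · exact le_of_eq (by field_simp)

theorem norm_radialHessian_le (ℓ M : ℝ → E) (x : X) :
    ‖radialHessian X ℓ M x‖ ≤ ‖ℓ ‖x‖‖ + ‖M ‖x‖‖ := by
  have h_flip : ‖(innerSmulRight X E).flip (ℓ ‖x‖)‖ ≤ ‖ℓ ‖x‖‖ := by
    refine ContinuousLinearMap.opNorm_le_bound _ (norm_nonneg _) fun y => ?_
    rw [ContinuousLinearMap.flip_apply, norm_innerSmulRight_apply, mul_comm]
  exact (norm_add_le (E := X →L[ℝ] X →L[ℝ] E) _ _).trans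
    (add_le_add h_flip (norm_smulRight_innerSmulRight_le x _))

theorem hasFDerivAt_comp_norm_zero {F : ℝ → E} (hF : HasDerivWithinAt F 0 (Ici 0) 0) :
    HasFDerivAt (fun x : X => F ‖x‖) (0 : X →L[ℝ] E) 0 := by
  have h_norm : Tendsto (fun x : X => ‖x‖) (𝓝 0) (𝓝[≥] 0) := by
    refine tendsto_nhdsWithin_iff.2 ⟨?_, Eventually.of_forall norm_nonneg⟩
    simpa using (continuous_norm (E := X)).tendsto 0
  have h_littleO : (fun x : X => F ‖x‖ - F 0) =o[𝓝 0] fun x : X => ‖x‖ := by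
    simpa [Function.comp_def] using (hasDerivWithinAt_iff_isLittleO.1 hF).comp_tendsto h_norm
  refine HasFDerivAt.of_isLittleO ?_
  simpa using h_littleO.of_norm_right

namespace IsRadialC2

variable {F ℓ M : ℝ → E}

theorem hasFDerivAt_comp_norm (hF : IsRadialC2 F ℓ M) (x : X) :
    HasFDerivAt (fun x : X => F ‖x‖) (innerSmulRight X E x (ℓ ‖x‖)) x := by
  rcases eq_or_ne x 0 with rfl | hx
  · have h_deriv : Tendsto (deriv F) (𝓝[>] 0) (𝓝 0) := by
      have h_cont : Continuous fun r => r • ℓ r := continuous_id.smul hF.continuous_slope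
      have h_lim : Tendsto (fun r => r • ℓ r) (𝓝[>] 0) (𝓝 0) :=
        (h_cont.tendsto' 0 0 (zero_smul ℝ _)).mono_left nhdsWithin_le_nhds
      refine h_lim.congr' ?_
      filter_upwards [self_mem_nhdsWithin] with r hr using (hF.hasDerivAt r hr).deriv.symm
    rw [map_zero, zero_apply]
    exact hasFDerivAt_comp_norm_zero <| hasDerivWithinAt_Ici_of_tendsto_deriv (s := Ioi 0)
      (fun r hr => (hF.hasDerivAt r hr).differentiableAt.differentiableWithinAt)
      hF.continuous.continuousAt.continuousWithinAt self_mem_nhdsWithin h_deriv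
  · have h := HypSoliton.hasFDerivAt_comp_norm hx (hF.hasDerivAt ‖x‖ (norm_pos_iff.2 hx))
    rwa [inv_smul_smul₀ (norm_ne_zero_iff.2 hx)] at h

theorem hasFDerivAt_gradient (hF : IsRadialC2 F ℓ M) (x : X) :
    HasFDerivAt (fun x : X => innerSmulRight X E x (ℓ ‖x‖)) (radialHessian X ℓ M x) x := by
  rcases eq_or_ne x 0 with rfl | hx
  · have h_lim : Tendsto (fun y : X => ‖ℓ ‖y‖ - ℓ 0‖) (𝓝 0) (𝓝 0) :=
      ((hF.continuous_slope.comp continuous_norm).sub continuous_const).norm.tendsto' _ _ (by simp)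
    refine HasFDerivAt.of_isLittleO (Asymptotics.isLittleO_iff.2 fun ε hε => ?_)
    filter_upwards [h_lim.eventually_lt_const hε] with y hy
    have h_eq : innerSmulRight X E y (ℓ ‖y‖) - innerSmulRight X E (0 : X) (ℓ ‖(0 : X)‖)
        - radialHessian X ℓ M 0 (y - 0) = innerSmulRight X E y (ℓ ‖y‖ - ℓ 0) := by
      simp [radialHessian]
    rw [h_eq, norm_innerSmulRight_apply, sub_zero, mul_comm]
    gcongr
  · have h_slope := HypSoliton.hasFDerivAt_comp_norm hx
      (hF.hasDerivAt_slope ‖x‖ (norm_pos_iff.2 hx))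
    refine ((innerSmulRight X E).hasFDerivAt_of_bilinear (hasFDerivAt_id x)
      h_slope).congr_fderiv ?_
    ext y z
    simp only [radialHessian, innerSmulRight_apply, add_apply, id_eq, sq, mul_inv, mul_smul,
      ContinuousLinearMap.precompR_apply, ContinuousLinearMap.precompL_apply,
      ContinuousLinearMap.compL_apply, ContinuousLinearMap.comp_apply,
      ContinuousLinearMap.smulRight_apply, ContinuousLinearMap.flip_apply, innerSL_apply_apply,
      ContinuousLinearMap.id_apply, smul_apply]
    rw [add_comm, smul_comm (inner ℝ x z)]

theorem continuous_radialHessian (hF : IsRadialC2 F ℓ M) : Continuous (radialHessian X ℓ M) := by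
  refine ((innerSmulRight X E).flip.continuous.comp
    (hF.continuous_slope.comp continuous_norm)).add (continuous_iff_continuousAt.2 fun x => ?_)
  rcases eq_or_ne x 0 with rfl | hx
  · have h_lim : Tendsto (fun x : X => ‖M ‖x‖‖) (𝓝 0) (𝓝 0) :=
      (hF.continuous_defect.comp continuous_norm).norm.tendsto' _ _ (by simp [hF.defect_zero])
    have h_tendsto := squeeze_zero_norm
      (f := fun x : X => (innerSL ℝ x).smulRight (innerSmulRight X E x ((‖x‖ ^ 2)⁻¹ • M ‖x‖)))
      (fun x => norm_smulRight_innerSmulRight_le x (M ‖x‖)) h_lim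
    unfold ContinuousAt
    simpa using h_tendsto
  · have h_scaled : ContinuousAt (fun x : X => (‖x‖ ^ 2)⁻¹ • M ‖x‖) x :=
      ((continuous_norm.pow 2).continuousAt.inv₀ (pow_ne_zero 2 (norm_ne_zero_iff.2 hx))).smul
        (hF.continuous_defect.comp continuous_norm).continuousAt
    exact ((ContinuousLinearMap.smulRightL ℝ X (X →L[ℝ] E)).continuous.continuousAt.comp
      (innerSL ℝ).continuous.continuousAt).clm_apply
      ((innerSmulRight X E).continuous.continuousAt.clm_apply h_scaled)

theorem fderiv_comp_norm (hF : IsRadialC2 F ℓ M) :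
    fderiv ℝ (fun x : X => F ‖x‖) = fun x => innerSmulRight X E x (ℓ ‖x‖) :=
  funext fun x => (hF.hasFDerivAt_comp_norm x).fderiv

theorem fderiv_gradient (hF : IsRadialC2 F ℓ M) :
    fderiv ℝ (fun x : X => innerSmulRight X E x (ℓ ‖x‖)) = radialHessian X ℓ M :=
  funext fun x => (hF.hasFDerivAt_gradient x).fderiv

theorem contDiff_comp_norm (hF : IsRadialC2 F ℓ M) : ContDiff ℝ 2 (fun x : X => F ‖x‖) := by
  rw [← one_add_one_eq_two, contDiff_succ_iff_fderiv]
  refine ⟨fun x => (hF.hasFDerivAt_comp_norm x).differentiableAt, by simp, ?_⟩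
  rw [hF.fderiv_comp_norm, contDiff_one_iff_fderiv, hF.fderiv_gradient]
  exact ⟨fun x => (hF.hasFDerivAt_gradient x).differentiableAt, hF.continuous_radialHessian⟩

theorem norm_iteratedFDeriv_comp_norm_le (hF : IsRadialC2 F ℓ M) {j : ℕ} (hj : j ≤ 2) (x : X) :
    ‖iteratedFDeriv ℝ j (fun x : X => F ‖x‖) x‖
      ≤ ‖F ‖x‖‖ + ‖x‖ * ‖ℓ ‖x‖‖ + (‖ℓ ‖x‖‖ + ‖M ‖x‖‖) := by
  have h_grad : 0 ≤ ‖x‖ * ‖ℓ ‖x‖‖ := by positivity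
  have h_hess : 0 ≤ ‖ℓ ‖x‖‖ + ‖M ‖x‖‖ := by positivity
  interval_cases j
  · rw [norm_iteratedFDeriv_zero]
    linarith
  · rw [← zero_add 1, ← norm_iteratedFDeriv_fderiv, norm_iteratedFDeriv_zero, hF.fderiv_comp_norm,
      norm_innerSmulRight_apply]
    linarith [norm_nonneg (F ‖x‖)]
  · rw [← one_add_one_eq_two, ← norm_iteratedFDeriv_fderiv, ← zero_add 1,
      ← norm_iteratedFDeriv_fderiv, norm_iteratedFDeriv_zero, hF.fderiv_comp_norm,
      hF.fderiv_gradient]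
    linarith [norm_radialHessian_le ℓ M x, norm_nonneg (F ‖x‖)]

end IsRadialC2

end RadialC2

section Nonlinearity

variable {𝕜 : Type*} [RCLike 𝕜] {d : ℕ} {p : ℝ} {f : ℝ → 𝕜}

theorem continuousOn_profileRHS (d : ℕ) (hp : 0 ≤ p) (w a : ℝ) {s : Set ℝ}
    (hf : ContinuousOn f s) : ContinuousOn (profileRHS d p w a f) s := by
  have h_rpow : ContinuousOn (fun r => ‖f r‖ ^ p) s := hf.norm.rpow_const fun _ _ => Or.inr hp
  exact ((continuous_const.add (continuous_potential d)).continuousOn.sub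
    (continuousOn_const.mul ((continuous_weight d p).continuousOn.mul h_rpow))).smul hf

theorem tendsto_profileRHS (d : ℕ) (hp : 0 ≤ p) (w a : ℝ) {r₀ : ℝ} {l : Filter ℝ}
    (hl : l ≤ 𝓝 r₀) {f₀ : 𝕜} (hf : Tendsto f l (𝓝 f₀)) :
    Tendsto (profileRHS d p w a f) l
      (𝓝 ((w + potential d r₀ - a * (weight d p r₀ * ‖f₀‖ ^ p)) • f₀)) :=
  ((tendsto_const_nhds.add (((continuous_potential d).tendsto r₀).mono_left hl)).sub
    (tendsto_const_nhds.mul ((((continuous_weight d p).tendsto r₀).mono_left hl).mul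
      (hf.norm.rpow_const (Or.inr hp))))).smul hf

theorem norm_profileRHS_le (hd : 1 ≤ d) (hp : 0 ≤ p) (w a : ℝ) :
    ∃ A, 0 ≤ A ∧ ∀ (f : ℝ → 𝕜) (r : ℝ), 0 ≤ r →
      ‖profileRHS d p w a f r‖ ≤ (A + |a| * ‖f r‖ ^ p) * ‖f r‖ := by
  obtain ⟨C, hC, h_potential⟩ := exists_abs_potential_le d
  refine ⟨|w| + C, by positivity, fun f r hr => ?_⟩
  rw [profileRHS, norm_smul]
  gcongr
  have h_weight := (weight_pos d hp r).le
  calc ‖w + potential d r - a * (weight d p r * ‖f r‖ ^ p)‖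
      ≤ |w| + |potential d r| + |a * (weight d p r * ‖f r‖ ^ p)| :=
        (norm_sub_le _ _).trans (add_le_add (abs_add_le _ _) le_rfl)
    _ ≤ |w| + C + |a| * ‖f r‖ ^ p := by
        rw [abs_mul, abs_of_nonneg (by positivity : 0 ≤ weight d p r * ‖f r‖ ^ p)]
        gcongr
        · exact h_potential r hr
        · exact mul_le_of_le_one_left (by positivity) (weight_le_one hd hp hr)

end Nonlinearity

section Origin

theorem exists_continuous_extension {Y : Type*} [TopologicalSpace Y] {f : ℝ → Y} {y : Y}
    (hf : ContinuousOn f (Ioi 0)) (h_lim : Tendsto f (𝓝[>] 0) (𝓝 y)) :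
    ∃ F, Continuous F ∧ F 0 = y ∧ ∀ r, 0 < r → F r = f r := by
  have h_update : ContinuousOn (Function.update f 0 y) (Ici 0) := by
    refine continuousOn_update_iff.2 ⟨?_, fun _ => ?_⟩ <;> rw [Ici_sdiff_left] <;> assumption
  refine ⟨fun r => Function.update f 0 y (max r 0),
    h_update.comp_continuous (by fun_prop) fun r => le_max_right r 0, by simp, fun r hr => ?_⟩
  simp only [max_eq_left hr.le, Function.update_of_ne hr.ne']

variable {E : Type*} [NormedAddCommGroup E] [NormedSpace ℝ E] {m : ℕ} {f k g : ℝ → E}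

theorem frequently_norm_flux_sub_lt
    (h_flux : ∀ η > 0, ∃ᶠ r in 𝓝[>] 0, ‖r ^ m • k r‖ < η) {j : ℝ → E}
    (hj : Tendsto j (𝓝[>] 0) (𝓝 0)) {η : ℝ} (hη : 0 < η) :
    ∃ᶠ r in 𝓝[>] 0, ‖r ^ m • (k r - j r)‖ < η := by
  have h_pow : Tendsto (fun r : ℝ => r ^ m) (𝓝[>] 0) (𝓝 (0 ^ m)) :=
    ((continuous_pow m).tendsto 0).mono_left nhdsWithin_le_nhds
  have h_lim : Tendsto (fun r => ‖r ^ m • j r‖) (𝓝[>] 0) (𝓝 0) := by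
    simpa using (h_pow.smul hj).norm
  refine ((h_flux (η / 2) (half_pos hη)).and_eventually
    (h_lim.eventually_lt_const (half_pos hη))).mono fun r hr => ?_
  rw [smul_sub]
  linarith [norm_sub_le (r ^ m • k r) (r ^ m • j r), hr.1, hr.2]

namespace HasRadialLaplacian

theorem hasDerivAt_deriv (hf : HasRadialLaplacian m f k g) {r : ℝ} (hr : 0 < r) :
    HasDerivAt k (g r - (m / r) • k r) r := by
  have h_pow : r ^ m ≠ 0 := pow_ne_zero m hr.ne'
  have h_eq : k =ᶠ[𝓝 r] fun s => (s ^ m)⁻¹ • s ^ m • k s := by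
    filter_upwards [Ioi_mem_nhds hr] with s hs
    exact (inv_smul_smul₀ (pow_ne_zero m (ne_of_gt hs)) _).symm
  refine ((((hasDerivAt_pow m r).inv h_pow).smul
    (hf.hasDerivAt_flux r hr)).congr_of_eventuallyEq h_eq).congr_deriv ?_
  have h_coeff : -(m * r ^ (m - 1)) / (r ^ m) ^ 2 * r ^ m = -(m / r) := by
    rcases m with _ | m
    · simp
    · rw [Nat.add_sub_cancel]
      field_simp
      ring
  rw [Pi.inv_apply, inv_smul_smul₀ h_pow, smul_smul, h_coeff, neg_smul, sub_eq_add_neg]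

theorem hasDerivAt_inv_smul (hf : HasRadialLaplacian m f k g) {r : ℝ} (hr : 0 < r) :
    HasDerivAt (fun s => s⁻¹ • k s) (r⁻¹ • (g r - ((m : ℝ) + 1) • r⁻¹ • k r)) r := by
  refine ((hasDerivAt_inv hr.ne').smul (hf.hasDerivAt_deriv hr)).congr_deriv ?_
  match_scalars
  · field_simp
  · field_simp
    ring

theorem exists_tendsto [CompleteSpace E] (hf : HasRadialLaplacian m f k g)
    (h_flux : ∀ η > 0, ∃ᶠ r in 𝓝[>] 0, ‖r ^ m • k r‖ < η) {B : ℝ}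
    (hg : ∀ r ∈ Ioc 0 1, ‖g r‖ ≤ B) : ∃ f₀, Tendsto f (𝓝[>] 0) (𝓝 f₀) := by
  have hB : 0 ≤ B := (norm_nonneg _).trans (hg 1 ⟨one_pos, le_rfl⟩)
  have hk (r : ℝ) (hr : r ∈ Ioc (0 : ℝ) 1) : ‖k r‖ ≤ B / (m + 1) := by
    have h_le := hf.norm_deriv_le_rpow h_flux (s := 0) (by positivity) hB (by simpa using hg) r hr
    rw [sub_zero, sub_zero, Real.rpow_one] at h_le
    exact h_le.trans (mul_le_of_le_one_right (by positivity) hr.2)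
  have h_lipschitz : LipschitzOnWith ⟨B / (m + 1), by positivity⟩ f (Ioc 0 1) :=
    (convex_Ioc (0 : ℝ) 1).lipschitzOnWith_of_nnnorm_hasDerivWithin_le
      (fun r hr => (hf.hasDerivAt r hr.1).hasDerivWithinAt) hk
  exact CompleteSpace.complete <| (cauchy_nhds.mono nhdsWithin_le_nhds).map_of_le
    h_lipschitz.uniformContinuousOn (le_principal_iff.2 (Ioc_mem_nhdsGT one_pos))

theorem sub_quadratic (hf : HasRadialLaplacian m f k g) (z : E) :
    HasRadialLaplacian m (fun r => f r - (r ^ 2 / (2 * (m + 1))) • z)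
      (fun r => k r - (r / (m + 1)) • z) (fun r => g r - z) where
  hasDerivAt r hr := by
    refine (hf.hasDerivAt r hr).sub (HasDerivAt.smul_const ?_ z)
    refine ((hasDerivAt_pow 2 r).div_const _).congr_deriv ?_
    field_simp
    simp
  hasDerivAt_flux r hr := by
    have h_pow : HasDerivAt (fun s : ℝ => s ^ (m + 1) / (m + 1)) (r ^ m) r := by
      refine ((hasDerivAt_pow (m + 1) r).div_const _).congr_deriv ?_
      rw [Nat.add_sub_cancel]
      push_cast
      field_simp
    have h_sub := (hf.hasDerivAt_flux r hr).fun_sub (h_pow.smul_const z)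
    simpa only [smul_sub, smul_smul, pow_succ, mul_div_assoc] using h_sub

theorem tendsto_inv_smul_deriv (hf : HasRadialLaplacian m f k g)
    (h_flux : ∀ η > 0, ∃ᶠ r in 𝓝[>] 0, ‖r ^ m • k r‖ < η) {g₀ : E}
    (hg : Tendsto g (𝓝[>] 0) (𝓝 g₀)) :
    Tendsto (fun r => r⁻¹ • k r) (𝓝[>] 0) (𝓝 (((m : ℝ) + 1)⁻¹ • g₀)) := by
  rw [tendsto_iff_norm_sub_tendsto_zero] at hg ⊢
  have h_linear : Tendsto (fun r : ℝ => (r / (m + 1)) • g₀) (𝓝[>] 0) (𝓝 0) := by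
    have h_cont : Continuous fun r : ℝ => (r / (m + 1)) • g₀ := by fun_prop
    exact (h_cont.tendsto' 0 0 (by simp)).mono_left nhdsWithin_le_nhds
  refine (nhds_basis_zero_abs_lt ℝ).tendsto_right_iff.2 fun ε hε => ?_
  obtain ⟨ρ, hρ, h_small⟩ := mem_nhdsGT_iff_exists_Ioc_subset.1
    (hg.eventually_lt_const (half_pos hε))
  filter_upwards [Ioc_mem_nhdsGT hρ] with r hr
  have h_deriv := (hf.sub_quadratic g₀).norm_deriv_le_rpow
    (fun η hη => frequently_norm_flux_sub_lt h_flux h_linear hη) (s := 0) (by positivity)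
    (half_pos hε).le (fun t ht => by simpa using (h_small ht).le) r hr
  rw [sub_zero, sub_zero, Real.rpow_one] at h_deriv
  have h_eq : r⁻¹ • k r - ((m : ℝ) + 1)⁻¹ • g₀ = r⁻¹ • (k r - (r / (m + 1)) • g₀) := by
    have := hr.1.ne'
    match_scalars <;> field_simp
  rw [abs_norm, h_eq, norm_smul, norm_inv, Real.norm_of_nonneg hr.1.le, inv_mul_lt_iff₀ hr.1,
    mul_comm]
  refine h_deriv.trans_lt (mul_lt_mul_of_pos_right ?_ hr.1)
  have : ε / 2 / (m + 1) ≤ ε / 2 := div_le_self (half_pos hε).le (by simp)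
  linarith

theorem exists_isRadialC2 (hf : HasRadialLaplacian m f k g)
    (h_flux : ∀ η > 0, ∃ᶠ r in 𝓝[>] 0, ‖r ^ m • k r‖ < η) {f₀ g₀ : E}
    (hg_cont : ContinuousOn g (Ioi 0)) (hf₀ : Tendsto f (𝓝[>] 0) (𝓝 f₀))
    (hg₀ : Tendsto g (𝓝[>] 0) (𝓝 g₀)) :
    ∃ F ℓ M, IsRadialC2 F ℓ M ∧
      ∀ r, 0 < r → F r = f r ∧ r • ℓ r = k r ∧ M r = g r - ((m : ℝ) + 1) • ℓ r := by
  obtain ⟨F, hF_cont, -, hF⟩ := exists_continuous_extension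
    (fun r hr => (hf.hasDerivAt r hr).continuousAt.continuousWithinAt) hf₀
  obtain ⟨ℓ, hℓ_cont, hℓ_zero, hℓ⟩ := exists_continuous_extension
    (fun r hr => (hf.hasDerivAt_inv_smul hr).continuousAt.continuousWithinAt)
    (hf.tendsto_inv_smul_deriv h_flux hg₀)
  obtain ⟨G, hG_cont, hG_zero, hG⟩ := exists_continuous_extension hg_cont hg₀
  have hℓk (r : ℝ) (hr : 0 < r) : r • ℓ r = k r := by rw [hℓ r hr, smul_inv_smul₀ hr.ne']
  refine ⟨F, ℓ, fun r => G r - ((m : ℝ) + 1) • ℓ r, ⟨hF_cont, hℓ_cont,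
    hG_cont.sub (hℓ_cont.const_smul _), ?_, fun r hr => ?_, fun r hr => ?_⟩,
    fun r hr => ⟨hF r hr, hℓk r hr, congrArg (· - _) (hG r hr)⟩⟩
  · rw [hG_zero, hℓ_zero, smul_inv_smul₀ (by positivity), sub_self]
  · rw [hℓk r hr]
    refine (hf.hasDerivAt r hr).congr_of_eventuallyEq ?_
    filter_upwards [Ioi_mem_nhds hr] with s hs using hF s hs
  · rw [hG r hr, hℓ r hr]
    refine (hf.hasDerivAt_inv_smul hr).congr_of_eventuallyEq ?_
    filter_upwards [Ioi_mem_nhds hr] with s hs using hℓ s hs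

end HasRadialLaplacian

end Origin

section MaximumPrinciple

theorem nonpos_of_isLocalMax_of_hasDerivAt {D D₁ : ℝ → ℝ} {x c : ℝ} (h_max : IsLocalMax D x)
    (hD : ∀ᶠ r in 𝓝 x, HasDerivAt D (D₁ r) r) (hD₁ : HasDerivAt D₁ c x) : c ≤ 0 := by
  by_contra! hc
  have h_deriv : deriv D =ᶠ[𝓝 x] D₁ := hD.mono fun r hr => hr.deriv
  have h_deriv₂ : deriv (deriv D) x = c := by rw [h_deriv.deriv_eq, hD₁.deriv]
  have h_min : IsLocalMin D x :=
    isLocalMin_of_deriv_deriv_pos (h_deriv₂ ▸ hc) h_max.deriv_eq_zero hD.self_of_nhds.continuousAt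
  have h_const : D =ᶠ[𝓝 x] fun _ => D x := by
    filter_upwards [h_max, h_min] with y hy hy' using le_antisymm hy hy'
  have h_zero : deriv D =ᶠ[𝓝 x] fun _ => 0 := by simpa using h_const.deriv
  rw [h_zero.deriv_eq, deriv_const] at h_deriv₂
  exact hc.ne h_deriv₂

variable {y y₁ y₂ b : ℝ → ℝ} {R κ : ℝ}

theorem nonpos_of_sq_mul_sub_mul_le (hκ : 0 < κ) (hy : ∀ r, R ≤ r → HasDerivAt y (y₁ r) r)
    (hy₁ : ∀ r, R ≤ r → HasDerivAt y₁ (y₂ r) r)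
    (h_le : ∀ r, R ≤ r → κ ^ 2 * y r - b r * y₁ r ≤ y₂ r) (hR : y R ≤ 0)
    (h_lim : Tendsto y atTop (𝓝 0)) {r : ℝ} (hr : R ≤ r) : y r ≤ 0 := by
  by_contra! h_pos
  obtain ⟨T, hT, hrT⟩ := ((h_lim.eventually_lt_const h_pos).and (eventually_gt_atTop r)).exists
  have h_cont : ContinuousOn y (Icc R T) := fun s hs => (hy s hs.1).continuousAt.continuousWithinAt
  obtain ⟨x, hx, h_max⟩ := isCompact_Icc.exists_isMaxOn ⟨r, hr, hrT.le⟩ h_cont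
  have hrx : y r ≤ y x := h_max ⟨hr, hrT.le⟩
  have hRx : R < x := hx.1.lt_of_ne fun h => by subst h; linarith
  have hxT : x < T := hx.2.lt_of_ne fun h => by subst h; linarith
  have h_local : IsLocalMax y x := h_max.isLocalMax (Icc_mem_nhds hRx hxT)
  have h_deriv : y₁ x = 0 := h_local.hasDerivAt_eq_zero (hy x hx.1)
  have h_nonpos : y₂ x ≤ 0 := nonpos_of_isLocalMax_of_hasDerivAt h_local
    (by filter_upwards [Ioi_mem_nhds hRx] with s hs using hy s (le_of_lt hs)) (hy₁ x hx.1)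
  have h_ge := h_le x hx.1
  rw [h_deriv, mul_zero, sub_zero] at h_ge
  have : 0 < κ ^ 2 * y x := mul_pos (by positivity) (h_pos.trans_le hrx)
  linarith

theorem le_mul_exp_of_sq_mul_sub_mul_le {C : ℝ} (hκ : 0 < κ) (hC : 0 ≤ C)
    (hb : ∀ r, R ≤ r → 0 ≤ b r) (hy : ∀ r, R ≤ r → HasDerivAt y (y₁ r) r)
    (hy₁ : ∀ r, R ≤ r → HasDerivAt y₁ (y₂ r) r)
    (h_le : ∀ r, R ≤ r → κ ^ 2 * y r - b r * y₁ r ≤ y₂ r) (hR : y R ≤ C)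
    (h_lim : Tendsto y atTop (𝓝 0)) {r : ℝ} (hr : R ≤ r) :
    y r ≤ C * Real.exp (-κ * (r - R)) := by
  set z : ℝ → ℝ := fun r => C * Real.exp (-κ * (r - R)) with hz
  have hz_deriv (r : ℝ) : HasDerivAt z (-κ * z r) r := by
    refine ((((hasDerivAt_id r).sub_const R).const_mul (-κ)).exp.const_mul C).congr_deriv ?_
    simp only [hz, id_eq]
    ring
  have hz_lim : Tendsto z atTop (𝓝 0) := by
    have h_linear : Tendsto (fun r : ℝ => κ * (r - R)) atTop atTop :=
      (tendsto_atTop_add_const_right _ (-R) tendsto_id).const_mul_atTop hκ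
    simpa [hz, Function.comp_def, neg_mul] using
      (Real.tendsto_exp_neg_atTop_nhds_zero.comp h_linear).const_mul C
  refine sub_nonpos.1 <| nonpos_of_sq_mul_sub_mul_le (y := fun r => y r - z r)
    (y₁ := fun r => y₁ r - -κ * z r) (y₂ := fun r => y₂ r - -κ * (-κ * z r)) (b := b) hκ
    (fun r hr => (hy r hr).sub (hz_deriv r))
    (fun r hr => (hy₁ r hr).sub ((hz_deriv r).const_mul _)) (fun r hr => ?_)
    (by simpa [hz] using hR) (by simpa using h_lim.sub hz_lim) hr
  have : 0 ≤ b r * (κ * z r) := mul_nonneg (hb r hr) (by positivity)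
  linarith [h_le r hr]

end MaximumPrinciple

section Decay

variable {E : Type*} [NormedAddCommGroup E]

theorem norm_deriv_le_of_norm_deriv_sub_le [NormedSpace ℝ E] {φ φ' : ℝ → E} {r B : ℝ}
    (hφ : ∀ s ∈ Icc r (r + 1), HasDerivAt φ (φ' s) s)
    (hB : ∀ s ∈ Icc r (r + 1), ‖φ' s - φ' r‖ ≤ B) : ‖φ' r‖ ≤ ‖φ r‖ + ‖φ (r + 1)‖ + B := by
  have h_right : r + 1 ∈ Icc r (r + 1) := right_mem_Icc.2 (by linarith)
  have h_taylor := norm_image_sub_le_of_norm_deriv_le_segment'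
    (f := fun s => φ s - (s - r) • φ' r) (f' := fun s => φ' s - (1 : ℝ) • φ' r)
    (fun s hs => ((hφ s hs).sub (((hasDerivAt_id s).sub_const r).smul_const _)).hasDerivWithinAt)
    (fun s hs => by simpa using hB s (Ico_subset_Icc_self hs)) (r + 1) h_right
  simp only [add_sub_cancel_left, one_smul, sub_self, zero_smul, sub_zero, mul_one] at h_taylor
  have h_eq : φ' r = φ (r + 1) - φ r - (φ (r + 1) - φ' r - φ r) := by abel
  calc ‖φ' r‖ = ‖φ (r + 1) - φ r - (φ (r + 1) - φ' r - φ r)‖ := congrArg norm h_eq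
    _ ≤ ‖φ (r + 1) - φ r‖ + ‖φ (r + 1) - φ' r - φ r‖ := norm_sub_le (φ (r + 1) - φ r) _
    _ ≤ ‖φ r‖ + ‖φ (r + 1)‖ + B := by
        rw [add_comm ‖φ r‖]
        exact add_le_add (norm_sub_le (φ (r + 1)) (φ r)) h_taylor

namespace HasRadialLaplacian

section NormedSpace

variable [NormedSpace ℝ E] {m : ℕ} {f k g : ℝ → E}

theorem norm_flux_sub_le (hf : HasRadialLaplacian m f k g) {r B : ℝ} (hr : 0 < r)
    (hg : ∀ s ∈ Icc r (r + 1), ‖g s‖ ≤ B) :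
    ∀ s ∈ Icc r (r + 1), ‖s ^ m • k s - r ^ m • k r‖ ≤ (r + 1) ^ m * B := by
  have hB : 0 ≤ B := (norm_nonneg _).trans (hg r (left_mem_Icc.2 (by linarith)))
  intro s hs
  refine (norm_image_sub_le_of_norm_deriv_le_segment' (f := fun s => s ^ m • k s)
    (C := (r + 1) ^ m * B)
    (fun t ht => (hf.hasDerivAt_flux t (hr.trans_le ht.1)).hasDerivWithinAt)
    (fun t ht => ?_) s hs).trans (mul_le_of_le_one_right (by positivity) (by linarith [hs.2]))
  have ht0 : 0 < t := hr.trans_le ht.1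
  rw [norm_smul, norm_pow, Real.norm_of_nonneg ht0.le]
  have := ht.2.le
  gcongr
  exact hg t (Ico_subset_Icc_self ht)

theorem norm_deriv_le_of_norm_le (hf : HasRadialLaplacian m f k g) {r A B : ℝ} (hr : 1 ≤ r)
    (hfA : ∀ s ∈ Icc r (r + 1), ‖f s‖ ≤ A) (hgB : ∀ s ∈ Icc r (r + 1), ‖g s‖ ≤ B) :
    ‖k r‖ ≤ 2 ^ m * ((2 + 3 * m) * A + B) := by
  have hr0 : 0 < r := one_pos.trans_le hr
  have h_left : r ∈ Icc r (r + 1) := left_mem_Icc.2 (by linarith)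
  have hA : 0 ≤ A := (norm_nonneg _).trans (hfA r h_left)
  have hB : 0 ≤ B := (norm_nonneg _).trans (hgB r h_left)
  set Q : ℝ := (r + 1) ^ m
  have h_pow (s : ℝ) (hs : s ∈ Icc r (r + 1)) {j : ℕ} (hj : j ≤ m) : s ^ j ≤ Q :=
    (pow_le_pow_right₀ (hr.trans hs.1) hj).trans
      (pow_le_pow_left₀ (hr0.le.trans hs.1) hs.2 m)
  have h_weighted (s : ℝ) (hs : s ∈ Icc r (r + 1)) : ‖s ^ m • f s‖ ≤ Q * A := by
    rw [norm_smul, Real.norm_of_nonneg (pow_nonneg (hr0.le.trans hs.1) _)]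
    gcongr
    exacts [h_pow s hs le_rfl, hfA s hs]
  have h_lower (s : ℝ) (hs : s ∈ Icc r (r + 1)) :
      ‖(m * s ^ (m - 1) : ℝ) • f s‖ ≤ m * (Q * A) := by
    have hs0 : 0 ≤ s := hr0.le.trans hs.1
    rw [norm_smul, Real.norm_of_nonneg (by positivity), mul_assoc]
    gcongr
    exacts [h_pow s hs (Nat.sub_le _ _), hfA s hs]
  have h_deriv := norm_deriv_le_of_norm_deriv_sub_le (φ := fun s => s ^ m • f s)
    (φ' := fun s => s ^ m • k s + (m * s ^ (m - 1) : ℝ) • f s) (B := Q * B + 2 * (m * (Q * A)))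
    (fun s hs => (hasDerivAt_pow m s).smul (hf.hasDerivAt s (hr0.trans_le hs.1))) fun s hs => by
      rw [add_sub_add_comm, two_mul]
      exact (norm_add_le _ _).trans (add_le_add (hf.norm_flux_sub_le hr0 hgB s hs)
        ((norm_sub_le _ _).trans (add_le_add (h_lower s hs) (h_lower r h_left))))
  have h_flux : r ^ m * ‖k r‖ ≤ Q * ((2 + 3 * m) * A + B) := by
    have h_split : r ^ m * ‖k r‖ ≤ ‖r ^ m • k r + (m * r ^ (m - 1) : ℝ) • f r‖
        + ‖(m * r ^ (m - 1) : ℝ) • f r‖ := by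
      have h_norm : ‖r ^ m • k r‖ = r ^ m * ‖k r‖ := by
        rw [norm_smul, Real.norm_of_nonneg (by positivity)]
      exact h_norm ▸ norm_le_add_norm_add (r ^ m • k r) ((m * r ^ (m - 1) : ℝ) • f r)
    linarith [h_weighted r h_left, h_weighted (r + 1) (right_mem_Icc.2 (by linarith)),
      h_lower r h_left]
  refine le_of_mul_le_mul_left (h_flux.trans ?_) (pow_pos hr0 m)
  rw [← mul_assoc, ← mul_pow]
  gcongr
  exact pow_le_pow_left₀ (by positivity) (by linarith) m

theorem eventually_norm_deriv_le_exp (hf : HasRadialLaplacian m f k g) {A B δ : ℝ} (hA : 0 ≤ A)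
    (hB : 0 ≤ B) (hδ : 0 ≤ δ) (hfA : ∀ᶠ r in atTop, ‖f r‖ ≤ A * Real.exp (-δ * r))
    (hgB : ∀ᶠ r in atTop, ‖g r‖ ≤ B * Real.exp (-δ * r)) :
    ∀ᶠ r in atTop, ‖k r‖ ≤ 2 ^ m * ((2 + 3 * m) * A + B) * Real.exp (-δ * r) := by
  filter_upwards [eventually_forall_ge_atTop.2 hfA, eventually_forall_ge_atTop.2 hgB,
    eventually_ge_atTop 1] with r hfA hgB hr
  have h_exp (s : ℝ) (hs : s ∈ Icc r (r + 1)) : Real.exp (-δ * s) ≤ Real.exp (-δ * r) :=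
    Real.exp_le_exp.2 (mul_le_mul_of_nonpos_left hs.1 (neg_nonpos.2 hδ))
  refine (hf.norm_deriv_le_of_norm_le hr
    (fun s hs => (hfA s hs.1).trans (mul_le_mul_of_nonneg_left (h_exp s hs) hA))
    (fun s hs => (hgB s hs.1).trans (mul_le_mul_of_nonneg_left (h_exp s hs) hB))).trans_eq ?_
  ring

end NormedSpace

variable [InnerProductSpace ℝ E] {m : ℕ} {f k g : ℝ → E}

/-- The function `y = ‖f‖²` satisfies `y'' + (m / r) y' = 2 ⟪f, g⟫ + 2 ‖k‖² ≥ (2 δ)² y`. -/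
theorem exists_eventually_norm_le_exp (hf : HasRadialLaplacian m f k g) {δ : ℝ} (hδ : 0 < δ)
    (h_inner : ∀ᶠ r in atTop, 2 * δ ^ 2 * ‖f r‖ ^ 2 ≤ inner ℝ (f r) (g r))
    (h_lim : Tendsto (fun r => ‖f r‖ ^ 2) atTop (𝓝 0)) :
    ∃ C, 0 ≤ C ∧ ∀ᶠ r in atTop, ‖f r‖ ≤ C * Real.exp (-δ * r) := by
  obtain ⟨R, hR_inner, hR⟩ :=
    ((eventually_forall_ge_atTop.2 h_inner).and (eventually_gt_atTop 0)).exists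
  have h_pos (r : ℝ) (hr : R ≤ r) : 0 < r := hR.trans_le hr
  refine ⟨‖f R‖ * Real.exp (δ * R), by positivity, ?_⟩
  filter_upwards [eventually_ge_atTop R] with r hr
  have h_decay : ‖f r‖ ^ 2 ≤ ‖f R‖ ^ 2 * Real.exp (-(2 * δ) * (r - R)) := by
    refine le_mul_exp_of_sq_mul_sub_mul_le (y := fun r => ‖f r‖ ^ 2) (b := fun r => m / r)
      (y₁ := fun r => 2 * inner ℝ (f r) (k r))
      (y₂ := fun r => 2 * (inner ℝ (f r) (g r - (m / r) • k r) + inner ℝ (k r) (k r)))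
      (by positivity) (by positivity) (fun r hr => div_nonneg m.cast_nonneg (h_pos r hr).le)
      (fun r hr => (hf.hasDerivAt r (h_pos r hr)).norm_sq)
      (fun r hr => ((hf.hasDerivAt r (h_pos r hr)).inner ℝ
        (hf.hasDerivAt_deriv (h_pos r hr))).const_mul 2) (fun r hr => ?_) le_rfl h_lim hr
    rw [inner_sub_right, inner_smul_right, real_inner_self_eq_norm_sq]
    nlinarith [hR_inner r hr, sq_nonneg ‖k r‖]
  refine (pow_le_pow_iff_left₀ (norm_nonneg _) (by positivity) two_ne_zero).1
    (h_decay.trans_eq ?_)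
  rw [mul_assoc, ← Real.exp_add, mul_pow, ← Real.exp_nat_mul]
  congr 2
  push_cast
  ring

end HasRadialLaplacian

theorem integrableOn_Ioi_one_norm_sq {m : ℕ} {f : ℝ → E} (hf : ContinuousOn f (Ioi 0))
    (hf_sq : IntegrableOn (fun r : ℝ => r ^ m * ‖f r‖ ^ 2) (Ioi 0)) :
    IntegrableOn (fun r => ‖f r‖ ^ 2) (Ioi 1) := by
  have h_subset : Ioi (1 : ℝ) ⊆ Ioi 0 := Ioi_subset_Ioi zero_le_one
  refine (hf_sq.mono_set h_subset).mono'
    (((hf.norm.pow 2).mono h_subset).aestronglyMeasurable measurableSet_Ioi) ?_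
  filter_upwards [ae_restrict_mem measurableSet_Ioi] with r hr
  rw [Real.norm_of_nonneg (by positivity)]
  exact le_mul_of_one_le_left (by positivity) (one_le_pow₀ (le_of_lt hr))

theorem IsRadialProfile.tendsto_norm_sq [InnerProductSpace ℝ E] {m : ℕ} {f k : ℝ → E}
    (hf : IsRadialProfile m f k) (hfk : ∀ r, 0 < r → HasDerivAt f (k r) r)
    (hk : ContinuousOn k (Ioi 0)) : Tendsto (fun r => ‖f r‖ ^ 2) atTop (𝓝 0) := by
  have hf_cont : ContinuousOn f (Ioi 0) := fun r hr =>
    (hfk r hr).continuousAt.continuousWithinAt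
  have hf_sq := integrableOn_Ioi_one_norm_sq hf_cont hf.integrableOn_sq
  have hk_sq := integrableOn_Ioi_one_norm_sq hk hf.integrableOn_deriv_sq
  refine tendsto_zero_of_hasDerivAt_of_integrableOn_Ioi (a := 1)
    (f' := fun r => 2 * inner ℝ (f r) (k r))
    (fun r hr => (hfk r (one_pos.trans hr)).norm_sq) ?_ hf_sq
  have h_meas : AEStronglyMeasurable (fun r => 2 * inner ℝ (f r) (k r))
      (volume.restrict (Ioi 1)) :=
    ((continuousOn_const.mul (hf_cont.inner hk)).mono
      (Ioi_subset_Ioi zero_le_one)).aestronglyMeasurable measurableSet_Ioi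
  refine (hf_sq.add hk_sq).mono' h_meas (ae_of_all _ fun r => ?_)
  rw [norm_mul, Real.norm_of_nonneg zero_le_two, Real.norm_eq_abs, Pi.add_apply]
  nlinarith [abs_real_inner_le_norm (f r) (k r), sq_nonneg (‖f r‖ - ‖k r‖)]

variable {𝕜 : Type*} [RCLike 𝕜] {d : ℕ} {p : ℝ} {f k : ℝ → 𝕜}

theorem tendsto_profileRHS_coefficient (hd : 1 ≤ d) (hp : 0 < p) (w a : ℝ)
    (hf : Tendsto (fun r => ‖f r‖) atTop (𝓝 0)) :
    Tendsto (fun r => w + potential d r - a * (weight d p r * ‖f r‖ ^ p)) atTop (𝓝 w) := by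
  have h_rpow : Tendsto (fun r => ‖f r‖ ^ p) atTop (𝓝 0) := by
    simpa [Real.zero_rpow hp.ne'] using hf.rpow_const (Or.inr hp.le)
  have h_nonlinear : Tendsto (fun r => weight d p r * ‖f r‖ ^ p) atTop (𝓝 0) := by
    refine squeeze_zero' (Eventually.of_forall fun r => ?_) ?_ h_rpow
    · have := weight_pos d hp.le r
      positivity
    · filter_upwards [eventually_ge_atTop 0] with r hr
      exact mul_le_of_le_one_left (by positivity) (weight_le_one hd hp.le hr)
  simpa using ((tendsto_potential_atTop d).const_add w).sub (h_nonlinear.const_mul a)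

theorem IsRadialProfile.exists_eventually_le_exp (hd : 1 ≤ d) (hp : 0 < p) {w a : ℝ} (hw : 0 < w)
    (hf : IsRadialProfile (d - 1) f k)
    (hfk : HasRadialLaplacian (d - 1) f k (profileRHS d p w a f)) :
    ∃ C δ, 0 ≤ C ∧ 0 < δ ∧ ∀ᶠ r in atTop, ‖f r‖ ≤ C * Real.exp (-δ * r) ∧
      ‖k r‖ ≤ C * Real.exp (-δ * r) ∧ ‖profileRHS d p w a f r‖ ≤ C * Real.exp (-δ * r) := by
  have h_lim : Tendsto (fun r => ‖f r‖ ^ 2) atTop (𝓝 0) := hf.tendsto_norm_sq hfk.hasDerivAt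
    fun r hr => (hfk.hasDerivAt_deriv hr).continuousAt.continuousWithinAt
  have h_coeff := tendsto_profileRHS_coefficient hd hp w a (f := f) (by simpa using h_lim.sqrt)
  have h_sq : 2 * (√w / 2) ^ 2 = w / 2 := by
    rw [div_pow, Real.sq_sqrt hw.le]
    ring
  have hδ : 0 < √w / 2 := half_pos (Real.sqrt_pos.2 hw)
  have h_inner : ∀ᶠ r in atTop,
      2 * (√w / 2) ^ 2 * ‖f r‖ ^ 2 ≤ inner ℝ (f r) (profileRHS d p w a f r) := by
    filter_upwards [h_coeff.eventually_const_le (half_lt_self hw)] with r hr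
    rw [profileRHS, inner_smul_right, real_inner_self_eq_norm_sq, h_sq]
    gcongr
  obtain ⟨C, hC, hf_exp⟩ := hfk.exists_eventually_norm_le_exp hδ h_inner h_lim
  have hg_exp : ∀ᶠ r in atTop, ‖profileRHS d p w a f r‖ ≤ 2 * w * C * Real.exp (-(√w / 2) * r) := by
    filter_upwards [hf_exp, h_coeff.norm.eventually_le_const
      (by rw [Real.norm_of_nonneg hw.le]; linarith : ‖w‖ < 2 * w)] with r hfr hr
    rw [profileRHS, norm_smul, mul_assoc (2 * w)]
    gcongr
  have hk_exp := hfk.eventually_norm_deriv_le_exp hC (by positivity) hδ.le hf_exp hg_exp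
  set B : ℝ := 2 ^ (d - 1) * ((2 + 3 * ((d - 1 : ℕ) : ℝ)) * C + 2 * w * C)
  refine ⟨max C (max B (2 * w * C)), √w / 2, hC.trans (le_max_left _ _), hδ, ?_⟩
  filter_upwards [hf_exp, hk_exp, hg_exp] with r hfr hkr hgr
  refine ⟨hfr.trans ?_, hkr.trans ?_, hgr.trans ?_⟩ <;> gcongr <;> simp

end Decay

section Regularity

theorem exists_le_mul_exp {φ : ℝ → ℝ} (hφ : Continuous φ) {C δ : ℝ}
    (h : ∀ᶠ r in atTop, φ r ≤ C * Real.exp (-δ * r)) :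
    ∃ C' > 0, ∀ r, 0 ≤ r → φ r ≤ C' * Real.exp (-δ * r) := by
  obtain ⟨R, hR⟩ := eventually_atTop.1 h
  have h_quot : Continuous fun r => φ r * Real.exp (δ * r) := by fun_prop
  obtain ⟨B, hB⟩ := (isCompact_Icc (a := (0 : ℝ)) (b := R)).exists_bound_of_continuousOn
    h_quot.continuousOn
  refine ⟨max 1 (max C B), by positivity, fun r hr => ?_⟩
  rcases le_total R r with hRr | hRr
  · exact (hR r hRr).trans (by gcongr; simp)
  · have h_exp : Real.exp (δ * r) * Real.exp (-δ * r) = 1 := by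
      rw [← Real.exp_add, neg_mul, add_neg_cancel, Real.exp_zero]
    calc φ r = φ r * Real.exp (δ * r) * Real.exp (-δ * r) := by rw [mul_assoc, h_exp, mul_one]
      _ ≤ max 1 (max C B) * Real.exp (-δ * r) := by
          gcongr
          exact (le_abs_self _).trans ((hB r ⟨hr, hRr⟩).trans (by simp))

variable {𝕜 : Type*} [RCLike 𝕜] {d : ℕ} {p w a : ℝ}

theorem integrable_rpow_of_radial (hd : 2 ≤ d) (hp : 0 < p)
    (hp_sub : 3 ≤ d → p < 4 / ((d : ℝ) - 2)) {u : Space d → 𝕜} {G : Fin d → Space d → 𝕜}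
    (hsym : IsSphericallySymmetric u) (hu : MemH1WithGradient u G) :
    Integrable fun x => ‖u x‖ ^ (p + 2) := by
  have : NeZero d := ⟨by omega⟩
  have hm : ((d - 1 : ℕ) : ℝ) = d - 1 := Nat.cast_pred (by omega)
  obtain ⟨f, h, huf, hf, -⟩ := exists_isRadialProfile hu hsym
  obtain ⟨β, hβ, hβ_lower, hβ_upper⟩ := exists_admissible_exponent hd hp hp_sub
  obtain ⟨C, hC, h_near⟩ := hf.exists_norm_le_rpow hβ
    (by rw [hm]; linarith)
  obtain ⟨B, -, h_far⟩ := hf.exists_norm_le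
  have h_near_int := integrableOn_Ioc_pow_mul_rpow (m := d - 1) (q := p + 2) hf.continuousOn
    (by positivity) (by rw [hm]; linarith) hC h_near
  have h_far_int := integrableOn_Ioi_one_pow_mul_rpow hf.continuousOn hf.integrableOn_sq hp h_far
  have h_int : IntegrableOn (fun r : ℝ => r ^ (d - 1) * ‖f r‖ ^ (p + 2)) (Ioi 0) := by
    rw [← Ioc_union_Ioi_eq_Ioi (zero_le_one' ℝ)]
    exact h_near_int.union h_far_int
  refine ((integrable_comp_norm_iff (f := fun r => ‖f r‖ ^ (p + 2))).2 h_int).congr ?_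
  filter_upwards [huf] with x hx
  rw [hx]

theorem IsRadialProfile.exists_norm_le_near_zero (hd : 2 ≤ d) (hp : 0 < p)
    (hp_sub : 3 ≤ d → p < 4 / ((d : ℝ) - 2)) {f k : ℝ → 𝕜} (hf : IsRadialProfile (d - 1) f k)
    (hfk : HasRadialLaplacian (d - 1) f k (profileRHS d p w a f)) :
    ∃ C, 0 ≤ C ∧ ∀ r ∈ Ioc (0 : ℝ) 1, ‖f r‖ ≤ C := by
  have hm : ((d - 1 : ℕ) : ℝ) = d - 1 := Nat.cast_pred (by omega)
  have : (2 : ℝ) ≤ d := by exact_mod_cast hd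
  obtain ⟨β, hβ, hβ_lower, hβ_upper⟩ := exists_admissible_exponent hd hp hp_sub
  obtain ⟨C, hC, hfC⟩ := hf.exists_norm_le_rpow hβ
    (by rw [hm]; linarith)
  obtain ⟨A, hA, hgA⟩ := norm_profileRHS_le (𝕜 := 𝕜) (one_le_two.trans hd) hp.le w a
  have hg (r : ℝ) (hr : r ∈ Ioc (0 : ℝ) 1) :
      ‖profileRHS d p w a f r‖ ≤ (A + |a| * C ^ p) * r ^ (-(p * β)) * ‖f r‖ := by
    have h_one : 1 ≤ r ^ (-(p * β)) :=
      Real.one_le_rpow_of_pos_of_le_one_of_nonpos hr.1 hr.2 (neg_nonpos.2 (by positivity))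
    have h_pow : ‖f r‖ ^ p ≤ C ^ p * r ^ (-(p * β)) := by
      refine (Real.rpow_le_rpow (norm_nonneg _) (hfC r hr.1 hr.2) hp.le).trans_eq ?_
      rw [Real.mul_rpow hC (Real.rpow_nonneg hr.1.le _), ← Real.rpow_mul hr.1.le, neg_mul,
        mul_comm β]
    refine (hgA f r hr.1.le).trans (mul_le_mul_of_nonneg_right ?_ (norm_nonneg _))
    calc A + |a| * ‖f r‖ ^ p ≤ A * r ^ (-(p * β)) + |a| * (C ^ p * r ^ (-(p * β))) := by
          gcongr
          exact le_mul_of_one_le_right hA h_one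
      _ = (A + |a| * C ^ p) * r ^ (-(p * β)) := by ring
  refine hfk.exists_norm_le (fun η hη => hf.frequently_norm_flux_lt (by omega) hη)
    (by positivity) hC hg ?_ hβ ?_ fun r hr => hfC r hr.1 hr.2
  · linarith
  · rw [hm]
    nlinarith

theorem IsRadialProfile.exists_isRadialC2 (hd : 2 ≤ d) (hp : 0 < p)
    (hp_sub : 3 ≤ d → p < 4 / ((d : ℝ) - 2)) {f k : ℝ → 𝕜} (hf : IsRadialProfile (d - 1) f k)
    (hfk : HasRadialLaplacian (d - 1) f k (profileRHS d p w a f)) :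
    ∃ F ℓ M, IsRadialC2 F ℓ M ∧ ∀ r, 0 < r →
      F r = f r ∧ r • ℓ r = k r ∧ M r = profileRHS d p w a f r - (d : ℝ) • ℓ r := by
  have hm : ((d - 1 : ℕ) : ℝ) = d - 1 := Nat.cast_pred (by omega)
  have h_flux (η : ℝ) (hη : 0 < η) : ∃ᶠ r in 𝓝[>] 0, ‖r ^ (d - 1) • k r‖ < η :=
    hf.frequently_norm_flux_lt (by omega) hη
  obtain ⟨C, hC, hfC⟩ := hf.exists_norm_le_near_zero hd hp hp_sub hfk
  obtain ⟨A, hA, hgA⟩ := norm_profileRHS_le (𝕜 := 𝕜) (one_le_two.trans hd) hp.le w a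
  have hg (r : ℝ) (hr : r ∈ Ioc (0 : ℝ) 1) :
      ‖profileRHS d p w a f r‖ ≤ (A + |a| * C ^ p) * C := by
    refine (hgA f r hr.1.le).trans ?_
    gcongr <;> exact hfC r hr
  obtain ⟨f₀, hf₀⟩ := hfk.exists_tendsto h_flux hg
  obtain ⟨F, ℓ, M, hF, h_eq⟩ := hfk.exists_isRadialC2 h_flux
    (continuousOn_profileRHS d hp.le w a hf.continuousOn) hf₀
    (tendsto_profileRHS d hp.le w a nhdsWithin_le_nhds hf₀)
  refine ⟨F, ℓ, M, hF, fun r hr => ?_⟩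
  simpa only [hm, sub_add_cancel] using h_eq r hr

theorem norm_add_mul_norm_slope_add_le {f k g ℓ M : 𝕜} {c r B : ℝ} (hc : 0 ≤ c) (hr : 1 ≤ r)
    (h_slope : r • ℓ = k) (h_defect : M = g - c • ℓ) (hf : ‖f‖ ≤ B) (hk : ‖k‖ ≤ B)
    (hg : ‖g‖ ≤ B) : ‖f‖ + r * ‖ℓ‖ + (‖ℓ‖ + ‖M‖) ≤ (4 + c) * B := by
  have h_norm : r * ‖ℓ‖ = ‖k‖ := by
    rw [← h_slope, norm_smul, Real.norm_of_nonneg (zero_le_one.trans hr)]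
  have hℓ : ‖ℓ‖ ≤ B := (le_mul_of_one_le_left (norm_nonneg ℓ) hr).trans (h_norm.trans_le hk)
  have hM : ‖M‖ ≤ B + c * B := by
    rw [h_defect]
    refine (norm_sub_le _ _).trans (add_le_add hg ?_)
    rw [norm_smul, Real.norm_of_nonneg hc]
    gcongr
  linarith

theorem IsRadialProfile.exists_contDiff_comp_norm (hd : 2 ≤ d) (hp : 0 < p)
    (hp_sub : 3 ≤ d → p < 4 / ((d : ℝ) - 2)) (hw : 0 < w) {f k : ℝ → 𝕜}
    (hf : IsRadialProfile (d - 1) f k)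
    (hfk : HasRadialLaplacian (d - 1) f k (profileRHS d p w a f)) :
    ∃ F : ℝ → 𝕜, (∀ r, 0 < r → F r = f r) ∧ ContDiff ℝ 2 (fun x : Space d => F ‖x‖) ∧
      ∃ C > 0, ∃ δ > 0, ∀ j : ℕ, j ≤ 2 → ∀ x : Space d,
        ‖iteratedFDeriv ℝ j (fun x : Space d => F ‖x‖) x‖ ≤ C * Real.exp (-δ * ‖x‖) := by
  obtain ⟨F, ℓ, M, hF, h_eq⟩ := hf.exists_isRadialC2 hd hp hp_sub hfk
  obtain ⟨C, δ, -, hδ, h_decay⟩ := hf.exists_eventually_le_exp (one_le_two.trans hd) hp hw hfk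
  have h_cont : Continuous fun r : ℝ => ‖F r‖ + r * ‖ℓ r‖ + (‖ℓ r‖ + ‖M r‖) := by
    have := hF.continuous
    have := hF.continuous_slope
    have := hF.continuous_defect
    fun_prop
  have h_event : ∀ᶠ r in atTop, ‖F r‖ + r * ‖ℓ r‖ + (‖ℓ r‖ + ‖M r‖) ≤
      (4 + d) * C * Real.exp (-δ * r) := by
    filter_upwards [h_decay, eventually_ge_atTop 1] with r ⟨hfr, hkr, hgr⟩ hr
    obtain ⟨hFf, hℓk, hMg⟩ := h_eq r (one_pos.trans_le hr)
    rw [mul_assoc]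
    exact norm_add_mul_norm_slope_add_le d.cast_nonneg hr hℓk hMg (hFf ▸ hfr) hkr hgr
  obtain ⟨C', hC', h_le⟩ := exists_le_mul_exp h_cont h_event
  exact ⟨F, fun r hr => (h_eq r hr).1, hF.contDiff_comp_norm, C', hC', δ, hδ, fun j hj x =>
    (hF.norm_iteratedFDeriv_comp_norm_le hj x).trans (h_le ‖x‖ (norm_nonneg x))⟩

end Regularity

end HypSoliton

end

theorem mainTheorem6 {𝕜 : Type*} [RCLike 𝕜] (d : ℕ) (hd : 2 ≤ d)
    (p : ℝ) (hp : 0 < p) (hp_sub : 3 ≤ d → p < 4 / ((d : ℝ) - 2))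
    (Λ : ℝ) (hΛ : -(((d : ℝ) - 1) / 2) ^ 2 < Λ) (lam : ℝ) (hlam : 0 < lam)
    (u : HypSoliton.Space d → 𝕜) (hsym : HypSoliton.IsSphericallySymmetric u)
    (hmin : HypSoliton.IsMinimizerI d p lam u ∨ HypSoliton.IsMinimizerJ d p Λ lam u) :
    ∃ v : HypSoliton.Space d → 𝕜, u =ᵐ[volume] v ∧ ContDiff ℝ 2 v ∧
      ∃ C > 0, ∃ δ > 0, ∀ k : ℕ, k ≤ 2 → ∀ x : HypSoliton.Space d,
        ‖iteratedFDeriv ℝ k v x‖ ≤ C * Real.exp (-δ * ‖x‖) := by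
  have : NeZero d := ⟨by omega⟩
  obtain ⟨G₀, hu₀⟩ : ∃ G, HypSoliton.MemH1WithGradient u G :=
    hmin.elim (fun ⟨G, hu, _⟩ => ⟨G, hu⟩) fun ⟨G, hu, _⟩ => ⟨G, hu⟩
  have hup : Integrable fun x => ‖u x‖ ^ (p + 2) :=
    HypSoliton.integrable_rpow_of_radial hd hp hp_sub hsym hu₀
  obtain ⟨G, w, a, hu, hw, h_sol⟩ :=
    HypSoliton.exists_isWeakSolution_of_isMinimizer hp hΛ hlam hmin hup
  obtain ⟨f, h, huf, hf, h_radial⟩ := HypSoliton.exists_isRadialProfile hu hsym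
  obtain ⟨k, hf, hfk⟩ := hf.exists_hasRadialLaplacian
    (HypSoliton.continuousOn_profileRHS d hp.le w a hf.continuousOn)
    (h_sol.hasWeakDerivOn_profile hp.le hu hup huf h_radial)
  obtain ⟨F, hFf, hF, h_decay⟩ := hf.exists_contDiff_comp_norm hd hp hp_sub hw hfk
  refine ⟨fun x => F ‖x‖, ?_, hF, h_decay⟩
  have h_ne : ∀ᵐ x : HypSoliton.Space d, x ≠ 0 := Measure.ae_ne volume 0
  filter_upwards [huf, h_ne] with x hx hx₀
  rw [hx, hFf _ (norm_pos_iff.2 hx₀)]
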